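/- Let $(M,\omega)$ be a $2n$-dimensional symplectic manifold with a Lagrangian distribution $\Lambda$, let $H:M\to\mathbb R$ be a smooth function and let $\vec H$ be its Hamiltonian vector field, $\omega(\vec H,\cdot)=-dH$, with flow $\varphi_t$. Assume that $\vec H$ is monotone, that is, the bilinear form $\langle V_1,V_2\rangle=\omega([\vec H,V_1],V_2)$ ($V_1,V_2$ sections of $\Lambda$) is positive definite on $\Lambda$. Let $c$ be a regular value of $H$ such that $\Sigma_c=H^{-1}(c)$ is compact (so that the flow is defined on $\Sigma_c$ for all times), and assume that the flow has no conjugate points on $\Sigma_c$: for all $\alpha\in\Sigma_c$ and $t\neq 0$ the subspaces $d\varphi_t(\Lambda_\alpha)$ and $\Lambda_{\varphi_t(\alpha)}$ are transversal. For $\alpha\in\Sigma_c$ let $\vec H^\angle_\alpha$ be the $\omega$-orthogonal complement of $\vec H(\alpha)$, let $\mathfrak V_\alpha=\vec H^\angle_\alpha/\mathbb R\vec H(\alpha)$ with the induced symplectic form $\tilde\omega$, let $\widetilde{d\varphi}_t:\mathfrak V_\alpha\to\mathfrak V_{\varphi_t(\alpha)}$ be the map induced by $d\varphi_t$, and let $\tilde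 J_\alpha(t)\subset\mathfrak V_\alpha$ be the reduced Jacobi curve, the image of $d\varphi_t^{-1}(\Lambda_{\varphi_t(\alpha)})\cap\vec H^\angle_\alpha$. A canonical frame of $\tilde J_\alpha$ is a smooth family of bases $e^1(t),\dots,e^{n-1}(t),f^1(t),\dots,f^{n-1}(t)$ of $\mathfrak V_\alpha$ ($t\in\mathbb R$) with $e^i(t)\in\tilde J_\alpha(t)$, $f^i=\dot e^i$, $\tilde\omega(e^i,e^j)=\tilde\omega(f^i,f^j)=0$ and $\tilde\omega(f^i,e^j)=\delta_{ij}$. It exists, and it is unique up to a constant orthogonal matrix. Let $|\cdot|$ be the norm on $\mathfrak V_\alpha$ for which $e^1(0),\dots,e^{n-1}(0),f^1(0),\dots,f^{n-1}(0)$ is orthonormal, and let $\tilde w^h$ be the component of $\tilde w\in\mathfrak V_\alpha$ in $\mathrm{span}\{f^i(0)\}$ along $\tilde J_\alpha(0)=\mathrm{span}\{e^i(0)\}$. Then the limits $\tilde\Delta^\pm_\alpha=\lim_{t\to\pm\infty}\tilde J_\alpha(t)$ (the reduced Green bundles) exist in the Grassmannian of $\mathfrak V_\alpha$ for all $\alpha\in\Sigma_c$,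 and the following conditions are equivalent. (1) $\tilde\Delta^+_\alpha\cap\tilde\Delta^-_\alpha=\{0\}$ for all $\alpha\in\Sigma_c$. (2) $\mathfrak V_\alpha=\tilde\Delta^+_\alpha\oplus\tilde\Delta^-_\alpha$ for all $\alpha\in\Sigma_c$. (3) There are no $\alpha\in\Sigma_c$ and $\tilde w\in\mathfrak V_\alpha$, $\tilde w\neq0$, such that $|(\widetilde{d\varphi}_t\tilde w)^h|$ is bounded uniformly in $t\in\mathbb R$. (4) There are constants $c_1,c_2>0$ such that $|\widetilde{d\varphi}_{\pm t}(\tilde w)|\le c_1|\tilde w|e^{-c_2t}$ for all $t\ge0$, $\alpha\in\Sigma_c$ and $\tilde w\in\tilde\Delta^\pm_\alpha$. -/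

import Mathlib

open scoped Manifold ContDiff Topology
open Module

/-! ## Curves of vectors and of subspaces in a finite-dimensional real vector space

Limits, derivatives and smoothness of curves are taken coordinatewise, that is, after composing with
an arbitrary linear functional. -/

section LinearAlgebra

variable {V : Type*} [AddCommGroup V] [Module ℝ V]

/-- The curve `u` in `V` is smooth. -/
def SmoothCurve (u : ℝ → V) : Prop :=
  ∀ l : Dual ℝ V, ContDiff ℝ ∞ (fun t => l (u t))

/-- The curve `u` in `V` has velocity `v` at time `t`. -/
def HasVelocity (u : ℝ → V) (v : V) (t : ℝ) : Prop :=
  ∀ l : Dual ℝ V, HasDerivAt (fun s => l (u s)) (l v) t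

/-- The family `u` of vectors tends to `v` along the filter `F`. -/
def VectorTendsto (u : ℝ → V) (F : Filter ℝ) (v : V) : Prop :=
  ∀ l : Dual ℝ V, Filter.Tendsto (fun t => l (u t)) F (𝓝 (l v))

/-- The family `L` of subspaces tends to the subspace `Δ` along `F` in the Grassmannian (with its
topology as a quotient of the space of frames): eventually `L t` has a basis that tends
to a basis of `Δ`. -/
def SubspaceTendsto (L : ℝ → Submodule ℝ V) (F : Filter ℝ) (Δ : Submodule ℝ V) : Prop :=
  ∃ (k : ℕ) (u : ℝ → Fin k → V) (v : Fin k → V),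
    LinearIndependent ℝ v ∧ Submodule.span ℝ (Set.range v) = Δ ∧
    (∀ᶠ t in F, LinearIndependent ℝ (u t) ∧ Submodule.span ℝ (Set.range (u t)) = L t) ∧
    ∀ i, VectorTendsto (fun t => u t i) F (v i)

open Classical in
/-- The limit of the family `L` of subspaces along `F` (and `⊥` if there is none). -/
noncomputable def limSubspace (L : ℝ → Submodule ℝ V) (F : Filter ℝ) : Submodule ℝ V :=
  if h : ∃ Δ, SubspaceTendsto L F Δ then h.choose else ⊥

/-! ### Canonical frames of curves of Lagrangian subspaces -/

/-- `b` is a canonical frame of the curve `J` of Lagrangian subspaces of the symplectic vector space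
`(V, σ)`. For each time `t`, `b t` is a basis `e¹(t), …, eᵐ(t), f¹(t), …, fᵐ(t)` of `V`, with
`eⁱ(t) = b t (inl i)` and `fⁱ(t) = b t (inr i)`; it is a Darboux basis, smooth in `t`,
with `eⁱ(t) ∈ J(t)` and `fⁱ(t)` the velocity of `eⁱ`. -/
structure IsCanonicalFrame (σ : V →ₗ[ℝ] V →ₗ[ℝ] ℝ) (J : ℝ → Submodule ℝ V) {m : ℕ}
    (b : ℝ → Basis (Fin m ⊕ Fin m) ℝ V) : Prop where
  smooth : ∀ i, SmoothCurve (fun t => b t (Sum.inl i))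
  mem : ∀ t i, b t (Sum.inl i) ∈ J t
  velocity : ∀ t i, HasVelocity (fun s => b s (Sum.inl i)) (b t (Sum.inr i)) t
  form_e_e : ∀ t i j, σ (b t (Sum.inl i)) (b t (Sum.inl j)) = 0
  form_f_f : ∀ t i j, σ (b t (Sum.inr i)) (b t (Sum.inr j)) = 0
  form_f_e : ∀ t i j, σ (b t (Sum.inr i)) (b t (Sum.inl j)) = if i = j then 1 else 0

/-- The norm on `V` for which the basis `b` is orthonormal. -/
noncomputable def basisNorm {ι : Type*} [Fintype ι] (b : Basis ι ℝ V) (w : V) : ℝ :=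
  Real.sqrt (∑ k, (b.repr w k) ^ 2)

open Classical in
/-- The norm on `V` for which the canonical frame `e¹(0), …, eᵐ(0), f¹(0), …, fᵐ(0)` of the curve `J`
is orthonormal. Canonical frames are unique up to a constant orthogonal matrix, so it does not matter
which one is used. (The value is `0` if `J` has no canonical frame.) -/
noncomputable def canonicalNorm (σ : V →ₗ[ℝ] V →ₗ[ℝ] ℝ) (J : ℝ → Submodule ℝ V) (m : ℕ) (w : V) : ℝ :=
  if h : ∃ b : ℝ → Basis (Fin m ⊕ Fin m) ℝ V, IsCanonicalFrame σ J b then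
    basisNorm (h.choose 0) w
  else 0

open Classical in
/-- The horizontal part of `w`: its component in `J°(0) = span {f¹(0), …, fᵐ(0)}` along `J(0)`, that
is, along `span {e¹(0), …, eᵐ(0)}`. (The value is `0` if `J` has no canonical frame.) -/
noncomputable def horizontalPart (σ : V →ₗ[ℝ] V →ₗ[ℝ] ℝ) (J : ℝ → Submodule ℝ V) (m : ℕ) (w : V) : V :=
  if h : ∃ b : ℝ → Basis (Fin m ⊕ Fin m) ℝ V, IsCanonicalFrame σ J b then
    ∑ i, (h.choose 0).repr w (Sum.inr i) • h.choose 0 (Sum.inr i)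
  else 0

/-! ### Linear symplectic reduction -/

/-- The skew-orthogonal complement `v^∠` of a vector `v`. -/
def skewCompl (σ : V →ₗ[ℝ] V →ₗ[ℝ] ℝ) (v : V) : Submodule ℝ V := LinearMap.ker (σ v)

/-- The line `ℝ v` inside `v^∠` (for a skew form `σ`). -/
def lineIn (σ : V →ₗ[ℝ] V →ₗ[ℝ] ℝ) (v : V) : Submodule ℝ (skewCompl σ v) :=
  (Submodule.span ℝ {v}).comap (skewCompl σ v).subtype

/-- The symplectic reduction `v^∠ / ℝ v`. -/
abbrev Reduction (σ : V →ₗ[ℝ] V →ₗ[ℝ] ℝ) (v : V) : Type _ := skewCompl σ v ⧸ lineIn σ v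

/-- The reduction `(J ∩ v^∠) / ℝ v` of a subspace `J`, that is, the image of `J ∩ v^∠` in
`v^∠ / ℝ v`. -/
def reduceSubspace (σ : V →ₗ[ℝ] V →ₗ[ℝ] ℝ) (v : V) (J : Submodule ℝ V) :
    Submodule ℝ (Reduction σ v) :=
  (J.comap (skewCompl σ v).subtype).map (lineIn σ v).mkQ

/-- The form on `v^∠ / ℝ v` induced by the skew form `σ`: `([u], [w]) ↦ σ u w`. -/
def reduceForm (σ : V →ₗ[ℝ] V →ₗ[ℝ] ℝ) (hσ : ∀ u w, σ u w = - σ w u) (v : V) :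
    Reduction σ v →ₗ[ℝ] Reduction σ v →ₗ[ℝ] ℝ :=
  have key : ∀ a ∈ lineIn σ v, ∀ w : skewCompl σ v, σ a w = 0 := by
    intro a ha w
    obtain ⟨r, hr⟩ := Submodule.mem_span_singleton.1 (Submodule.mem_comap.1 ha)
    have hw : σ v w = 0 := w.2
    have h : (a : V) = r • v := hr.symm
    rw [h, map_smul, LinearMap.smul_apply, hw, smul_zero]
  (lineIn σ v).liftQ
    { toFun := fun u => (lineIn σ v).liftQ ((σ u).comp (skewCompl σ v).subtype) (by
        intro a ha
        have h := key a ha u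
        simp only [LinearMap.mem_ker, LinearMap.comp_apply, Submodule.subtype_apply]
        rw [hσ, h, neg_zero])
      map_add' := by
        intro u u'
        ext w
        simp
      map_smul' := by
        intro r u
        ext w
        simp }
    (by
      intro a ha
      rw [LinearMap.mem_ker]
      ext w
      simpa using key a ha w)

theorem reduceForm_mk (σ : V →ₗ[ℝ] V →ₗ[ℝ] ℝ) (hσ : ∀ u w, σ u w = - σ w u) (v : V)
    (u w : skewCompl σ v) :
    reduceForm σ hσ v ((lineIn σ v).mkQ u) ((lineIn σ v).mkQ w) = σ u w := rfl

/-- The map `v^∠ / ℝ v → v'^∠ / ℝ v'` induced by a linear map `A` that takes `v^∠` to `v'^∠` and `v`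
to `v'`. -/
def reduceMap {V' : Type*} [AddCommGroup V'] [Module ℝ V'] {σ : V →ₗ[ℝ] V →ₗ[ℝ] ℝ} {v : V}
    {σ' : V' →ₗ[ℝ] V' →ₗ[ℝ] ℝ} {v' : V'} (A : V →ₗ[ℝ] V')
    (hA : ∀ w ∈ skewCompl σ v, A w ∈ skewCompl σ' v') (hv : A v = v') :
    Reduction σ v →ₗ[ℝ] Reduction σ' v' :=
  (lineIn σ v).mapQ (lineIn σ' v') (A.restrict hA) (by
    intro a ha
    obtain ⟨r, hr⟩ := Submodule.mem_span_singleton.1 (Submodule.mem_comap.1 ha)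
    have h : (a : V) = r • v := hr.symm
    refine Submodule.mem_span_singleton.2 ⟨r, ?_⟩
    change r • v' = A a
    rw [h, map_smul, hv])

end LinearAlgebra

/-! ## Symplectic manifolds, Lagrangian distributions, Hamiltonian flows -/

section Manifold

variable {E : Type*} [NormedAddCommGroup E] [NormedSpace ℝ E]
  {M : Type*} [TopologicalSpace M] [ChartedSpace E M]

/-- The expression of the two-form `Ω` in the chart at `x₀`, a two-form on (an open subset of) `E`. -/
noncomputable def formInChart (Ω : (x : M) → TangentSpace 𝓘(ℝ, E) x [⋀^Fin 2]→L[ℝ] ℝ) (x₀ : M) (y : E) :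
    E [⋀^Fin 2]→L[ℝ] ℝ :=
  (Ω ((extChartAt 𝓘(ℝ, E) x₀).symm y)).compContinuousLinearMap
    (mfderiv 𝓘(ℝ, E) 𝓘(ℝ, E) (extChartAt 𝓘(ℝ, E) x₀).symm y)

/-- `Ω` is a symplectic form: a smooth, closed, nondegenerate two-form. -/
structure IsSymplecticForm (Ω : (x : M) → TangentSpace 𝓘(ℝ, E) x [⋀^Fin 2]→L[ℝ] ℝ) : Prop where
  smooth : ∀ x₀ : M, ContDiffOn ℝ ∞ (formInChart Ω x₀) (extChartAt 𝓘(ℝ, E) x₀).target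
  closed : ∀ x₀ : M, ∀ y ∈ (extChartAt 𝓘(ℝ, E) x₀).target, extDeriv (formInChart Ω x₀) y = 0
  nondegenerate : ∀ (x : M) (v : TangentSpace 𝓘(ℝ, E) x), (∀ w, Ω x ![v, w] = 0) → v = 0

/-- The two-form `Ω` at the point `x`, as a bilinear form `(v, w) ↦ Ω(v, w)`. -/
noncomputable def formAt (Ω : (x : M) → TangentSpace 𝓘(ℝ, E) x [⋀^Fin 2]→L[ℝ] ℝ) (x : M) :
    TangentSpace 𝓘(ℝ, E) x →ₗ[ℝ] TangentSpace 𝓘(ℝ, E) x →ₗ[ℝ] ℝ :=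
  LinearMap.mk₂ ℝ (fun v w => Ω x ![v, w])
    (fun v v' w => by
      have h := (Ω x).map_update_add ![v, w] 0 v v'
      have e : ∀ u, Function.update ![v, w] 0 u = ![u, w] := fun u => by
        ext i; fin_cases i <;> simp
      rwa [e, e, e] at h)
    (fun c v w => by
      have h := (Ω x).map_update_smul ![v, w] 0 c v
      have e : ∀ u, Function.update ![v, w] 0 u = ![u, w] := fun u => by
        ext i; fin_cases i <;> simp
      rwa [e, e] at h)
    (fun v w w' => by
      have h := (Ω x).map_update_add ![v, w] 1 w w'
      have e : ∀ u, Function.update ![v, w] 1 u = ![v, u] := fun u => by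
        ext i; fin_cases i <;> simp
      rwa [e, e, e] at h)
    (fun c v w => by
      have h := (Ω x).map_update_smul ![v, w] 1 c w
      have e : ∀ u, Function.update ![v, w] 1 u = ![v, u] := fun u => by
        ext i; fin_cases i <;> simp
      rwa [e, e] at h)

theorem formAt_apply (Ω : (x : M) → TangentSpace 𝓘(ℝ, E) x [⋀^Fin 2]→L[ℝ] ℝ) (x : M)
    (v w : TangentSpace 𝓘(ℝ, E) x) : formAt Ω x v w = Ω x ![v, w] := rfl

theorem formAt_skew (Ω : (x : M) → TangentSpace 𝓘(ℝ, E) x [⋀^Fin 2]→L[ℝ] ℝ) (x : M)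
    (v w : TangentSpace 𝓘(ℝ, E) x) : formAt Ω x v w = - formAt Ω x w v := by
  have h := (Ω x).toAlternatingMap.map_swap ![w, v] (i := 0) (j := 1) (by decide)
  have e : (![w, v] ∘ (Equiv.swap (0 : Fin 2) 1)) = ![v, w] := by
    ext i; fin_cases i <;> simp
  rw [e] at h
  exact h

/-- The vector field `X` is smooth on the set `U`. -/
def SmoothFieldOn [IsManifold 𝓘(ℝ, E) ∞ M] (X : (x : M) → TangentSpace 𝓘(ℝ, E) x) (U : Set M) : Prop :=
  ContMDiffOn 𝓘(ℝ, E) 𝓘(ℝ, E).tangent ∞ (fun x => (⟨x, X x⟩ : TangentBundle 𝓘(ℝ, E) M)) U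

/-- `Λ` is a (smooth) Lagrangian distribution of `(M, Ω)`, where `dim M = 2 n`: it is locally spanned
by `n` pointwise linearly independent smooth vector fields, and `Ω` vanishes on it. -/
structure IsLagrangianDistribution [IsManifold 𝓘(ℝ, E) ∞ M] (n : ℕ)
    (Ω : (x : M) → TangentSpace 𝓘(ℝ, E) x [⋀^Fin 2]→L[ℝ] ℝ)
    (Λ : (x : M) → Submodule ℝ (TangentSpace 𝓘(ℝ, E) x)) : Prop where
  smooth : ∀ x₀ : M, ∃ U : Set M, IsOpen U ∧ x₀ ∈ U ∧
    ∃ V : Fin n → (x : M) → TangentSpace 𝓘(ℝ, E) x, (∀ i, SmoothFieldOn (V i) U) ∧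
      ∀ x ∈ U, LinearIndependent ℝ (fun i => V i x) ∧
        Submodule.span ℝ (Set.range fun i => V i x) = Λ x
  isotropic : ∀ x, ∀ v ∈ Λ x, ∀ w ∈ Λ x, Ω x ![v, w] = 0

/-- `φ` is the (smooth, local) flow of the vector field `X`, on the open flow domain `D`. -/
structure IsFlow (X : (x : M) → TangentSpace 𝓘(ℝ, E) x) (D : Set (ℝ × M)) (φ : ℝ → M → M) : Prop where
  isOpen : IsOpen D
  zero_mem : ∀ x, ((0 : ℝ), x) ∈ D
  interval : ∀ x, {t : ℝ | (t, x) ∈ D}.OrdConnected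
  smooth : ContMDiffOn (𝓘(ℝ, ℝ).prod 𝓘(ℝ, E)) 𝓘(ℝ, E) ∞ (fun p : ℝ × M => φ p.1 p.2) D
  zero : ∀ x, φ 0 x = x
  integralCurve : ∀ x, IsMIntegralCurveOn (fun t => φ t x) X {t : ℝ | (t, x) ∈ D}
  comp : ∀ s t x, (t, x) ∈ D → (s, φ t x) ∈ D → (s + t, x) ∈ D → φ s (φ t x) = φ (s + t) x

end Manifold

/-- The setting: a symplectic manifold `(M, Ω)` of dimension `2 n` with a Lagrangian distribution `Λ`,
a Hamiltonian `H` with Hamiltonian vector field `X` and its flow `φ`, and a regular value `c` of `H`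
such that the flow is defined for all times on the level set `H⁻¹(c)` (for a compact level set, this
holds for the maximal flow). -/
structure HamiltonianLevel (E : Type*) [NormedAddCommGroup E] [NormedSpace ℝ E]
    (M : Type*) [TopologicalSpace M] [ChartedSpace E M] [IsManifold 𝓘(ℝ, E) ∞ M] where
  n : ℕ
  finrank_eq : finrank ℝ E = 2 * n
  Ω : (x : M) → TangentSpace 𝓘(ℝ, E) x [⋀^Fin 2]→L[ℝ] ℝ
  symplectic : IsSymplecticForm Ω
  Λ : (x : M) → Submodule ℝ (TangentSpace 𝓘(ℝ, E) x)
  lagrangian : IsLagrangianDistribution n Ω Λ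
  H : M → ℝ
  smooth_H : ContMDiff 𝓘(ℝ, E) 𝓘(ℝ, ℝ) ∞ H
  X : (x : M) → TangentSpace 𝓘(ℝ, E) x
  hamiltonian : ∀ x w, Ω x ![X x, w] = - mfderiv 𝓘(ℝ, E) 𝓘(ℝ, ℝ) H x w
  D : Set (ℝ × M)
  φ : ℝ → M → M
  flow : IsFlow X D φ
  c : ℝ
  regular : ∀ x, H x = c → mfderiv 𝓘(ℝ, E) 𝓘(ℝ, ℝ) H x ≠ 0
  complete : ∀ t x, H x = c → (t, x) ∈ D

namespace HamiltonianLevel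

variable {E : Type*} [NormedAddCommGroup E] [NormedSpace ℝ E]
  {M : Type*} [TopologicalSpace M] [ChartedSpace E M] [IsManifold 𝓘(ℝ, E) ∞ M]
  (S : HamiltonianLevel E M)

/-- The Hamiltonian vector field is monotone: the bilinear form `⟨V₁, V₂⟩ = Ω([X, V₁], V₂)`, for
sections `V₁`, `V₂` of `Λ` (on which it depends only through their values at the point), is positive
definite on `Λ`. -/
def Monotone : Prop :=
  ∀ (x : M) (U : Set M) (V : (y : M) → TangentSpace 𝓘(ℝ, E) y),
    IsOpen U → x ∈ U → SmoothFieldOn V U → (∀ y ∈ U, V y ∈ S.Λ y) → V x ≠ 0 →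
      0 < S.Ω x ![VectorField.mlieBracket 𝓘(ℝ, E) S.X V x, V x]

/-- The level set `Σ_c = H⁻¹(c)`. -/
def level : Set M := {x | S.H x = S.c}

/-- The differential `dφ_t` at `x`. -/
noncomputable def dφ (t : ℝ) (x : M) :
    TangentSpace 𝓘(ℝ, E) x →ₗ[ℝ] TangentSpace 𝓘(ℝ, E) (S.φ t x) :=
  (mfderiv 𝓘(ℝ, E) 𝓘(ℝ, E) (S.φ t) x : _ →L[ℝ] _)

/-- The flow has no conjugate points on `Σ_c`: `dφ_t(Λ_α)` and `Λ_{φ_t(α)}` are transversal for all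
`α` in `Σ_c` and all `t ≠ 0`. -/
def NoConjugatePoints : Prop :=
  ∀ x ∈ S.level, ∀ t : ℝ, t ≠ 0 → (S.Λ x).map (S.dφ t x) ⊔ S.Λ (S.φ t x) = ⊤

/-- The Jacobi curve `J_α(t) = dφ_t⁻¹(Λ_{φ_t(α)})`. -/
noncomputable def jacobi (x : M) (t : ℝ) : Submodule ℝ (TangentSpace 𝓘(ℝ, E) x) :=
  (S.Λ (S.φ t x)).comap (S.dφ t x)

theorem H_φ {t : ℝ} {x : M} (h : (t, x) ∈ S.D) : S.H (S.φ t x) = S.H x := by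
  set I : Set ℝ := {s : ℝ | (s, x) ∈ S.D} with hI
  have hIo : IsOpen I := S.flow.isOpen.preimage (by fun_prop : Continuous fun s : ℝ => (s, x))
  have hIc : IsPreconnected I := (S.flow.interval x).isPreconnected
  have hd : ∀ s ∈ I, HasDerivAt (fun s => S.H (S.φ s x)) 0 s := by
    intro s hs
    have h1 := (S.flow.integralCurve x s hs).hasMFDerivAt (hIo.mem_nhds hs)
    have h2 : HasMFDerivAt 𝓘(ℝ, E) 𝓘(ℝ, ℝ) S.H (S.φ s x)
        (mfderiv 𝓘(ℝ, E) 𝓘(ℝ, ℝ) S.H (S.φ s x)) :=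
      ((S.smooth_H (S.φ s x)).mdifferentiableAt (by simp)).hasMFDerivAt
    have h4 := S.hamiltonian (S.φ s x) (S.X (S.φ s x))
    have h5 : S.Ω (S.φ s x) ![S.X (S.φ s x), S.X (S.φ s x)] = 0 :=
      (S.Ω (S.φ s x)).map_eq_zero_of_eq _ (i := 0) (j := 1) rfl (by decide)
    rw [h5] at h4
    have h6 := neg_eq_zero.1 h4.symm
    have h3 : ∃ A : ℝ →L[ℝ] ℝ, HasFDerivAt (fun s => S.H (S.φ s x)) A s ∧ A 1 = 0 :=
      ⟨_, (h2.comp s h1).hasFDerivAt,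
        (congrArg (mfderiv 𝓘(ℝ, E) 𝓘(ℝ, ℝ) S.H (S.φ s x))
          (one_smul ℝ (S.X (S.φ s x)))).trans h6⟩
    obtain ⟨A, hA, hA1⟩ := h3
    have h7 := hA.hasDerivAt
    rwa [hA1] at h7
  have hz : (0 : ℝ) ∈ I := S.flow.zero_mem x
  have h7 := hIo.is_const_of_deriv_eq_zero hIc
    (fun s hs => (hd s hs).differentiableAt.differentiableWithinAt)
    (fun s hs => (hd s hs).deriv) (x := t) (y := 0) h hz
  simpa [S.flow.zero] using h7

theorem mdifferentiableAt_φ {t : ℝ} {x : M} (h : (t, x) ∈ S.D) :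
    MDifferentiableAt 𝓘(ℝ, E) 𝓘(ℝ, E) (S.φ t) x := by
  have h1 := (S.flow.smooth.contMDiffAt (S.flow.isOpen.mem_nhds h)).mdifferentiableAt
    (by simp)
  have h2 : MDifferentiableAt 𝓘(ℝ, E) (𝓘(ℝ, ℝ).prod 𝓘(ℝ, E)) (fun y : M => (t, y)) x :=
    mdifferentiableAt_const.prodMk mdifferentiableAt_id
  exact h1.comp x h2

/-- The flow on the level set. -/
abbrev levelFlow (t : ℝ) (α : S.level) : S.level :=
  ⟨S.φ t α, (S.H_φ (S.complete t α α.2)).trans α.2⟩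

theorem dφ_mem (t : ℝ) (α : S.level) :
    ∀ w ∈ skewCompl (formAt S.Ω (α : M)) (S.X α),
      S.dφ t α w ∈ skewCompl (formAt S.Ω (S.levelFlow t α : M)) (S.X (S.levelFlow t α)) := by
  intro w hw
  have hm : ∀ (x : M) (u : TangentSpace 𝓘(ℝ, E) x), u ∈ skewCompl (formAt S.Ω x) (S.X x) ↔
      mfderiv 𝓘(ℝ, E) 𝓘(ℝ, ℝ) S.H x u = 0 := by
    intro x u
    change S.Ω x ![S.X x, u] = 0 ↔ _
    rw [S.hamiltonian x u]
    exact neg_eq_zero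
  rw [hm] at hw
  refine (hm _ _).2 ?_
  have hD := S.complete t α α.2
  have he : (fun y => S.H (S.φ t y)) =ᶠ[𝓝 (α : M)] S.H := by
    have ho : IsOpen {y : M | (t, y) ∈ S.D} :=
      S.flow.isOpen.preimage (by fun_prop : Continuous fun y : M => (t, y))
    filter_upwards [ho.mem_nhds hD] with y hy using S.H_φ hy
  have h1 : MDifferentiableAt 𝓘(ℝ, E) 𝓘(ℝ, ℝ) S.H (S.φ t α) :=
    (S.smooth_H (S.φ t α)).mdifferentiableAt (by simp)
  have h2 := mfderiv_comp (α : M) h1 (S.mdifferentiableAt_φ hD)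
  have h3 : mfderiv 𝓘(ℝ, E) 𝓘(ℝ, ℝ) (S.H ∘ S.φ t) (α : M) = mfderiv 𝓘(ℝ, E) 𝓘(ℝ, ℝ) S.H (α : M) :=
    Filter.EventuallyEq.mfderiv_eq he
  have h4 := congrArg (fun A => A w) (h2.symm.trans h3)
  exact h4.trans hw

theorem dφ_X (t : ℝ) (α : S.level) : S.dφ t α (S.X α) = S.X (S.levelFlow t α : M) := by
  have hx := α.2
  have hI : ∀ s : ℝ, HasMFDerivAt 𝓘(ℝ, ℝ) 𝓘(ℝ, E) (fun r => S.φ r (α : M)) s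
      ((1 : ℝ →L[ℝ] ℝ).smulRight (S.X (S.φ s α))) := fun s =>
    (S.flow.integralCurve α s (S.complete s α hx)).hasMFDerivAt
      (Filter.mem_of_superset Filter.univ_mem fun r _ => S.complete r α hx)
  have h0 := hI 0
  have h1 : HasMFDerivAt 𝓘(ℝ, E) 𝓘(ℝ, E) (S.φ t) (S.φ 0 (α : M))
      (mfderiv 𝓘(ℝ, E) 𝓘(ℝ, E) (S.φ t) (S.φ 0 (α : M))) := by
    apply MDifferentiableAt.hasMFDerivAt
    rw [S.flow.zero]
    exact S.mdifferentiableAt_φ (S.complete t α hx)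
  have h2 := h1.comp (0 : ℝ) h0
  have h3 : (S.φ t ∘ fun r => S.φ r (α : M)) = (fun r => S.φ r (α : M)) ∘ fun r => t + r := by
    funext r
    exact S.flow.comp t r α (S.complete r α hx)
      (S.complete t _ ((S.H_φ (S.complete r α hx)).trans hx)) (S.complete (t + r) α hx)
  have h4 : HasMFDerivAt 𝓘(ℝ, ℝ) 𝓘(ℝ, ℝ) (fun r : ℝ => t + r) 0 (ContinuousLinearMap.id ℝ ℝ) :=
    ((hasFDerivAt_id (0 : ℝ)).const_add t).hasMFDerivAt
  have h5 := (hI (t + 0)).comp (0 : ℝ) h4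
  rw [h3] at h2
  have h6 := congrArg (fun A : ℝ →L[ℝ] E => A 1) (hasMFDerivAt_unique h2 h5)
  have h7 : S.dφ t (S.φ 0 (α : M)) (S.X (S.φ 0 (α : M))) = S.X (S.φ (t + 0) α) := by
    have e1 := congrArg (mfderiv 𝓘(ℝ, E) 𝓘(ℝ, E) (S.φ t) (S.φ 0 (α : M)))
      (one_smul ℝ (S.X (S.φ 0 (α : M))))
    exact e1.symm.trans (h6.trans (one_smul ℝ (S.X (S.φ (t + 0) α))))
  rw [S.flow.zero, add_zero] at h7
  exact h7

/-- The fibre `𝔙_α = X^∠ / ℝ X` of the reduced bundle `𝔙` over `Σ_c`. -/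
abbrev ReducedBundle (α : S.level) : Type _ := Reduction (formAt S.Ω (α : M)) (S.X α)

/-- The reduced symplectic form on `𝔙_α`. -/
noncomputable def reducedForm (α : S.level) :
    S.ReducedBundle α →ₗ[ℝ] S.ReducedBundle α →ₗ[ℝ] ℝ :=
  reduceForm (formAt S.Ω (α : M)) (formAt_skew S.Ω (α : M)) (S.X α)

/-- The reduced flow `𝔙_α → 𝔙_{φ_t(α)}` induced by `dφ_t`. -/
noncomputable def reducedFlow (t : ℝ) (α : S.level) :
    S.ReducedBundle α →ₗ[ℝ] S.ReducedBundle (S.levelFlow t α) :=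
  reduceMap (S.dφ t α) (S.dφ_mem t α) (S.dφ_X t α)

/-- The reduced Jacobi curve `(J_α(t) ∩ X^∠) / ℝ X` in `𝔙_α`. -/
noncomputable def reducedJacobi (α : S.level) (t : ℝ) : Submodule ℝ (S.ReducedBundle α) :=
  reduceSubspace (formAt S.Ω (α : M)) (S.X α) (S.jacobi α t)

/-- The reduced Green bundle at `α`: the limit of the reduced Jacobi curve as `t → +∞`. -/
noncomputable def greenPlus (α : S.level) : Submodule ℝ (S.ReducedBundle α) :=
  limSubspace (S.reducedJacobi α) Filter.atTop

/-- The reduced Green bundle at `α`: the limit of the reduced Jacobi curve as `t → -∞`. -/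
noncomputable def greenMinus (α : S.level) : Submodule ℝ (S.ReducedBundle α) :=
  limSubspace (S.reducedJacobi α) Filter.atBot

/-- The norm on `𝔙_α` for which the canonical frame of the reduced Jacobi curve at `t = 0`
is orthonormal (`dim 𝔙_α = 2 (n - 1)`; here `n ≥ 1` since `dH` does not vanish on `Σ_c`). -/
noncomputable def norm (α : S.level) (w : S.ReducedBundle α) : ℝ :=
  canonicalNorm (S.reducedForm α) (S.reducedJacobi α) (S.n - 1) w

/-- The horizontal part of a vector of `𝔙_α`. -/
noncomputable def horizontal (α : S.level) (w : S.ReducedBundle α) : S.ReducedBundle α :=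
  horizontalPart (S.reducedForm α) (S.reducedJacobi α) (S.n - 1) w

end HamiltonianLevel

/-! Fix a point `x` of the level set and let `J(t)` be the preimage of `Λ` under `dφ_t`. The flow is
symplectic, and the time derivative of the pullback of a section `V` of `Λ` is the pullback of `[X,
V]`. Hence the velocity form `σ(e', e)` of curves `e(t) ∈ J(t)` is the transported monotonicity
form, so it is positive definite, and the absence of conjugate points makes the members of the curve
pairwise transversal. For such a curve and a fixed `s`, let `π_t` be the projection onto `J(t)`
along `J(s)`. The quadratic form `q_t(w) = σ(π_t w, w)` has the velocity form at `π_t w` as its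
derivative, so it increases for `t > s`; its values at times before `s` bound it from above. So the
projections converge, and the range of the limit is a Lagrangian limit of the curve, transversal to
every member (`IsMonotoneCurve.exists_limit`). Reversing time gives the other limit.

The limit is recognised by a growth criterion (`IsMonotoneCurve.mem_limSubspace`): if `σ(w, e)² ≤ C
σ(e', e)` along the curve for all late times, then `w` belongs to the limit, since otherwise some
`q_t(z)` would grow linearly. On a compact level set `X` satisfies such a bound, so `X` lies in the
limit. This is what makes the symplectic reduction by `X` a monotone curve with transversal members
again (`IsMonotoneFamily.reduce`). The reduced Green bundles therefore exist and are Lagrangian, and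
(1) and (2) are equivalent by dimension.

In a canonical frame the velocity form is a sum of squares, so a bound on the horizontal part of `w`
in the future or in the past is a bound of the above kind, and it puts `w` into the corresponding
Green bundle (`mem_greenPlus`, `mem_greenMinus`). This gives (1) → (3). For (4) → (1), a common
vector of the two bundles is compared with its image under the flow forth and back.

The step (3) → (4) is a compactness argument, isolated in `IsGreenSystem`. A failure of uniform
bounds on a Green bundle is recentred where the orbit is largest and rescaled; the limit is a
nonzero vector that either has a bounded orbit or lies in both `Λ` and the opposite Green bundle
(`IsGreenSystem.bounded_growth`). Recentring at midpoints then yields halving after a fixed time,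
hence exponential decay (`IsGreenSystem.exponential_decay`). Taking such limits requires control of
the canonical norms as the base point varies. They are compared, with locally uniform constants,
with the pairings against local fields `W_j` and `[X, W_j]` (`norming_frame_spec`), and these
pairings depend continuously on the base point. -/

set_option linter.unusedSectionVars false

/-! ### Lagrangian subspaces and projections along them -/

section SymplecticLinearAlgebra

variable {V : Type*} [AddCommGroup V] [Module ℝ V]

/-- The bilinear form `σ` is a symplectic form on the vector space `V`. -/
structure IsSymplecticBilin (σ : V →ₗ[ℝ] V →ₗ[ℝ] ℝ) : Prop where
  skew : ∀ u w, σ u w = - σ w u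
  nondeg : ∀ u, (∀ w, σ u w = 0) → u = 0

/-- `K` is a Lagrangian subspace: it is its own skew-orthogonal complement. -/
def IsLagrangianSubspace (σ : V →ₗ[ℝ] V →ₗ[ℝ] ℝ) (K : Submodule ℝ V) : Prop :=
  ∀ u, u ∈ K ↔ ∀ w ∈ K, σ u w = 0

variable {σ : V →ₗ[ℝ] V →ₗ[ℝ] ℝ} {K L : Submodule ℝ V}

theorem IsSymplecticBilin.self_eq_zero (h : IsSymplecticBilin σ) (u : V) : σ u u = 0 := by
  have := h.skew u u
  linarith

theorem IsSymplecticBilin.neg (h : IsSymplecticBilin σ) : IsSymplecticBilin (-σ) where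
  skew u w := by simpa using congrArg Neg.neg (h.skew u w)
  nondeg u hu := h.nondeg u fun w => by simpa using hu w

theorem IsLagrangianSubspace.neg (h : IsLagrangianSubspace σ K) : IsLagrangianSubspace (-σ) K :=
  fun u => by simpa using h u

theorem IsLagrangianSubspace.apply_eq_zero (h : IsLagrangianSubspace σ K) {u w : V}
    (hu : u ∈ K) (hw : w ∈ K) : σ u w = 0 := (h u).1 hu w hw

/-- Nondegeneracy makes `σ` an isomorphism onto the dual, and functionals on `K` extend to `V`; the
rank theorem for `V → K*` does the rest. -/
theorem IsSymplecticBilin.finrank_ker_add [FiniteDimensional ℝ V] (h : IsSymplecticBilin σ)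
    (K : Submodule ℝ V) :
    finrank ℝ (LinearMap.ker (K.subtype.dualMap ∘ₗ σ)) + finrank ℝ K = finrank ℝ V := by
  have hinj : Function.Injective σ := by
    rw [← LinearMap.ker_eq_bot, LinearMap.ker_eq_bot']
    intro u hu
    exact h.nondeg u fun w => by rw [hu]; rfl
  have hsurj : Function.Surjective σ :=
    (LinearMap.injective_iff_surjective_of_finrank_eq_finrank
      (Subspace.dual_finrank_eq (K := ℝ) (V := V)).symm).1 hinj
  have hs : Function.Surjective (K.subtype.dualMap ∘ₗ σ) :=
    (LinearMap.dualMap_surjective_of_injective K.injective_subtype).comp hsurj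
  have h1 := LinearMap.finrank_range_add_finrank_ker (K.subtype.dualMap ∘ₗ σ)
  rw [LinearMap.range_eq_top.2 hs, finrank_top, Subspace.dual_finrank_eq] at h1
  omega

theorem mem_ker_dualMap_comp {u : V} :
    u ∈ LinearMap.ker (K.subtype.dualMap ∘ₗ σ) ↔ ∀ w ∈ K, σ u w = 0 := by
  rw [LinearMap.mem_ker]
  constructor
  · intro h w hw
    exact congrArg (fun f => f (⟨w, hw⟩ : K)) h
  · intro h
    ext w
    exact h w w.2

theorem IsLagrangianSubspace.two_mul_finrank [FiniteDimensional ℝ V] (hσ : IsSymplecticBilin σ)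
    (h : IsLagrangianSubspace σ K) : 2 * finrank ℝ K = finrank ℝ V := by
  have h1 := hσ.finrank_ker_add K
  have h2 : LinearMap.ker (K.subtype.dualMap ∘ₗ σ) = K := by
    ext u
    rw [mem_ker_dualMap_comp, h u]
  rw [h2] at h1
  omega

theorem isLagrangianSubspace_of_finrank [FiniteDimensional ℝ V] (hσ : IsSymplecticBilin σ)
    (h0 : ∀ u ∈ K, ∀ w ∈ K, σ u w = 0) (hd : 2 * finrank ℝ K = finrank ℝ V) :
    IsLagrangianSubspace σ K := by
  have h1 := hσ.finrank_ker_add K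
  have h2 : K = LinearMap.ker (K.subtype.dualMap ∘ₗ σ) := by
    refine Submodule.eq_of_le_of_finrank_eq (fun u hu => mem_ker_dualMap_comp.2 (h0 u hu)) ?_
    omega
  intro u
  conv_lhs => rw [h2]
  exact mem_ker_dualMap_comp

theorem isCompl_of_inf_eq_bot_of_finrank [FiniteDimensional ℝ V] (h : K ⊓ L = ⊥)
    (hd : finrank ℝ K + finrank ℝ L = finrank ℝ V) : IsCompl K L := by
  refine ⟨disjoint_iff.2 h, codisjoint_iff.2 (Submodule.eq_top_of_finrank_eq ?_)⟩
  have := Submodule.finrank_sup_add_finrank_inf_eq K L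
  rw [h, finrank_bot] at this
  omega

theorem IsLagrangianSubspace.isCompl [FiniteDimensional ℝ V] (hσ : IsSymplecticBilin σ)
    (hK : IsLagrangianSubspace σ K) (hL : IsLagrangianSubspace σ L) (h : K ⊓ L = ⊥) :
    IsCompl K L := by
  refine isCompl_of_inf_eq_bot_of_finrank h ?_
  have h1 := hK.two_mul_finrank hσ
  have h2 := hL.two_mul_finrank hσ
  omega

open Classical in
/-- The projection onto `K` along `L` (and `0` if they are not complementary). -/
noncomputable def projAlong (K L : Submodule ℝ V) : V →ₗ[ℝ] V :=
  if h : IsCompl K L then K.projection L h else 0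

theorem projAlong_mem (h : IsCompl K L) (w : V) : projAlong K L w ∈ K := by
  rw [projAlong, dif_pos h]
  exact Submodule.projection_apply_mem h w

theorem projAlong_eq_zero (h : IsCompl K L) {w : V} : projAlong K L w = 0 ↔ w ∈ L := by
  rw [projAlong, dif_pos h]
  exact Submodule.projection_apply_eq_zero_iff h

theorem projAlong_of_mem (h : IsCompl K L) {w : V} (hw : w ∈ K) : projAlong K L w = w := by
  rw [projAlong, dif_pos h]
  exact Submodule.projection_apply_of_mem_left h hw

theorem sub_projAlong_mem (h : IsCompl K L) (w : V) : w - projAlong K L w ∈ L := by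
  rw [← projAlong_eq_zero h, map_sub, projAlong_of_mem h (projAlong_mem h w), sub_self]

theorem projAlong_eq (h : IsCompl K L) {u w : V} (hu : u ∈ K) (hw : w - u ∈ L) :
    projAlong K L w = u := by
  have := (projAlong_eq_zero h).2 hw
  rw [map_sub, projAlong_of_mem h hu] at this
  exact sub_eq_zero.1 this

/-- Both projections lie in `K` and both remainders lie in `L`, so two of the four terms of `σ w w'`
vanish. The adjoint of the projection with respect to `σ` is the complementary projection. -/
theorem apply_projAlong_swap (hK : IsLagrangianSubspace σ K)
    (hL : IsLagrangianSubspace σ L) (h : IsCompl K L) (w w' : V) :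
    σ (projAlong K L w) w' = σ w w' - σ w (projAlong K L w') := by
  have h1 := hL.apply_eq_zero (sub_projAlong_mem h w) (sub_projAlong_mem h w')
  have h2 := hK.apply_eq_zero (projAlong_mem h w) (projAlong_mem h w')
  simp only [map_sub, LinearMap.sub_apply] at h1
  linarith

/-- Polarisation. The antisymmetric part of `σ (π w) w'` is half of `σ w w'`, independently of the
subspaces, so the quadratic form `w ↦ σ (π w) w` determines the projection; convergence of the
former gives convergence of the latter. -/
theorem two_mul_apply_projAlong (hσ : IsSymplecticBilin σ) (hK : IsLagrangianSubspace σ K)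
    (hL : IsLagrangianSubspace σ L) (h : IsCompl K L) (w w' : V) :
    2 * σ (projAlong K L w) w' = σ (projAlong K L (w + w')) (w + w') - σ (projAlong K L w) w
      - σ (projAlong K L w') w' + σ w w' := by
  have h1 := apply_projAlong_swap hK hL h w w'
  have h2 := hσ.skew w (projAlong K L w')
  simp only [map_add, LinearMap.add_apply]
  linarith

end SymplecticLinearAlgebra

/-! ### Monotone curves of Lagrangian subspaces and their velocity form -/

section Curves

variable {V : Type*} [NormedAddCommGroup V] [NormedSpace ℝ V] [FiniteDimensional ℝ V]

theorem HasDerivAt.bilin (σ : V →ₗ[ℝ] V →ₗ[ℝ] ℝ) {e w : ℝ → V} {e' w' : V} {t : ℝ}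
    (he : HasDerivAt e e' t) (hw : HasDerivAt w w' t) :
    HasDerivAt (fun s => σ (e s) (w s)) (σ e' (w t) + σ (e t) w') t := by
  have h := (σ.toContinuousBilinearMap.hasFDerivAt.comp_hasDerivAt t he).clm_apply hw
  simpa using h

theorem ContDiffAt.bilin (σ : V →ₗ[ℝ] V →ₗ[ℝ] ℝ) {e w : ℝ → V} {n : WithTop ℕ∞} {t : ℝ}
    (he : ContDiffAt ℝ n e t) (hw : ContDiffAt ℝ n w t) :
    ContDiffAt ℝ n (fun s => σ (e s) (w s)) t :=
  (σ.toContinuousBilinearMap.contDiff.contDiffAt.comp t he).clm_apply hw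

theorem continuous_bilin_left (σ : V →ₗ[ℝ] V →ₗ[ℝ] ℝ) (w : V) : Continuous fun u => σ u w :=
  (σ.toContinuousBilinearMap.flip w).continuous

/-- `J` is a smooth monotone curve of Lagrangian subspaces of the symplectic vector space `(V, σ)`
whose members are pairwise transversal. -/
structure IsMonotoneCurve (σ : V →ₗ[ℝ] V →ₗ[ℝ] ℝ) (J : ℝ → Submodule ℝ V) : Prop where
  symplectic : IsSymplecticBilin σ
  lagrangian : ∀ t, IsLagrangianSubspace σ (J t)
  frame : ∀ t₀, ∃ (m : ℕ) (E : Fin m → ℝ → V), (∀ i, ContDiffAt ℝ ∞ (E i) t₀) ∧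
    (∀ᶠ t in 𝓝 t₀, LinearIndependent ℝ (fun i => E i t) ∧
      Submodule.span ℝ (Set.range fun i => E i t) = J t) ∧
    ∀ c : Fin m → ℝ, c ≠ 0 → 0 < σ (∑ i, c i • deriv (E i) t₀) (∑ i, c i • E i t₀)
  transversal : ∀ s t, s ≠ t → J s ⊓ J t = ⊥

/-- The curve `e` of vectors lies in the curve `J` of subspaces near the time `t`, where it has the
derivative `e'`. -/
def IsCurveIn (J : ℝ → Submodule ℝ V) (t : ℝ) (e : ℝ → V) (e' : V) : Prop :=
  HasDerivAt e e' t ∧ ∀ᶠ s in 𝓝 t, e s ∈ J s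

theorem IsCurveIn.mem {J : ℝ → Submodule ℝ V} {t : ℝ} {e : ℝ → V} {e' : V}
    (h : IsCurveIn J t e e') : e t ∈ J t := h.2.self_of_nhds

theorem IsCurveIn.sub {J : ℝ → Submodule ℝ V} {t : ℝ} {e w : ℝ → V} {e' w' : V}
    (h : IsCurveIn J t e e') (h' : IsCurveIn J t w w') :
    IsCurveIn J t (fun s => e s - w s) (e' - w') := by
  refine ⟨h.1.sub h'.1, ?_⟩
  filter_upwards [h.2, h'.2] with s h1 h2 using (J s).sub_mem h1 h2

theorem IsCurveIn.sum_smul {J : ℝ → Submodule ℝ V} {t : ℝ} {m : ℕ} {E : Fin m → ℝ → V}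
    {E' : Fin m → V} (h : ∀ i, IsCurveIn J t (E i) (E' i)) (c : Fin m → ℝ) :
    IsCurveIn J t (fun s => ∑ i, c i • E i s) (∑ i, c i • E' i) := by
  refine ⟨HasDerivAt.fun_sum fun i _ => (h i).1.const_smul (c i), ?_⟩
  filter_upwards [Filter.eventually_all.2 fun i => (h i).2] with s hs
  exact (J s).sum_mem fun i _ => (J s).smul_mem _ (hs i)

namespace IsMonotoneCurve

variable {σ : V →ₗ[ℝ] V →ₗ[ℝ] ℝ} {J : ℝ → Submodule ℝ V}

theorem isCompl (h : IsMonotoneCurve σ J) {s t : ℝ} (hst : s ≠ t) : IsCompl (J s) (J t) :=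
  (h.lagrangian s).isCompl h.symplectic (h.lagrangian t) (h.transversal s t hst)

theorem exists_curve (h : IsMonotoneCurve σ J) {t : ℝ} {u : V} (hu : u ∈ J t) :
    ∃ e e', IsCurveIn J t e e' ∧ e t = u ∧ (u ≠ 0 → 0 < σ e' u) := by
  obtain ⟨m, E, hE, hsp, hpos⟩ := h.frame t
  have hsp0 := hsp.self_of_nhds.2
  rw [← hsp0, Submodule.mem_span_range_iff_exists_fun] at hu
  obtain ⟨c, rfl⟩ := hu
  refine ⟨fun s => ∑ i, c i • E i s, ∑ i, c i • deriv (E i) t, IsCurveIn.sum_smul (fun i => ?_) c,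
    rfl, fun h0 => hpos c ?_⟩
  · refine ⟨((hE i).differentiableAt (by simp)).hasDerivAt, ?_⟩
    filter_upwards [hsp] with s hs
    rw [← hs.2]
    exact Submodule.subset_span ⟨i, rfl⟩
  · rintro rfl
    simp at h0

/-- Differentiating `σ (e s) (f s) = 0` for an arbitrary curve `f` in `J` leaves only `σ e' (f t)`,
because `e t = 0`. This is what makes the velocity form well defined on `J t`. -/
theorem deriv_mem (h : IsMonotoneCurve σ J) {t : ℝ} {e : ℝ → V} {e' : V}
    (he : IsCurveIn J t e e') (h0 : e t = 0) : e' ∈ J t := by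
  rw [h.lagrangian t]
  intro w hw
  obtain ⟨f, f', hf, rfl, -⟩ := h.exists_curve hw
  have h1 := he.1.bilin σ hf.1
  have h2 : HasDerivAt (fun s => σ (e s) (f s)) 0 t := by
    refine (hasDerivAt_const t (0 : ℝ)).congr_of_eventuallyEq ?_
    filter_upwards [he.2, hf.2] with s h1 h2 using (h.lagrangian s).apply_eq_zero h1 h2
  simpa [h0] using h1.unique h2

theorem velocity_eq (h : IsMonotoneCurve σ J) {t : ℝ} {e f : ℝ → V} {e' f' : V}
    (he : IsCurveIn J t e e') (hf : IsCurveIn J t f f') (hef : e t = f t) :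
    σ e' (e t) = σ f' (f t) := by
  have h1 := h.deriv_mem (he.sub hf) (sub_eq_zero.2 hef)
  have h2 := (h.lagrangian t).apply_eq_zero h1 hf.mem
  rw [map_sub, LinearMap.sub_apply] at h2
  rw [hef]
  linarith

theorem velocity_pos (h : IsMonotoneCurve σ J) {t : ℝ} {e : ℝ → V} {e' : V}
    (he : IsCurveIn J t e e') (h0 : e t ≠ 0) : 0 < σ e' (e t) := by
  obtain ⟨f, f', hf, hft, hpos⟩ := h.exists_curve he.mem
  rw [h.velocity_eq he hf hft.symm, hft]
  exact hpos h0

theorem velocity_nonneg (h : IsMonotoneCurve σ J) {t : ℝ} {e : ℝ → V} {e' : V}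
    (he : IsCurveIn J t e e') : 0 ≤ σ e' (e t) := by
  by_cases h0 : e t = 0
  · rw [h0, map_zero]
  · exact (h.velocity_pos he h0).le

/-- Reversing time changes the sign of velocities, and passing to `-σ` restores positivity.
Statements about the limit at `-∞` reduce to the limit at `+∞` in this way. -/
theorem reverse (h : IsMonotoneCurve σ J) : IsMonotoneCurve (-σ) (fun t => J (-t)) where
  symplectic := h.symplectic.neg
  lagrangian t := (h.lagrangian (-t)).neg
  frame t₀ := by
    obtain ⟨m, E, hE, hsp, hpos⟩ := h.frame (-t₀)
    refine ⟨m, fun i t => E i (-t), fun i => ?_, ?_, fun c hc => ?_⟩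
    · exact (hE i).comp t₀ contDiff_neg.contDiffAt
    · exact (continuous_neg.tendsto t₀).eventually hsp
    · have := hpos c hc
      simpa [deriv_comp_neg] using this
  transversal s t hst := h.transversal (-s) (-t) (by simpa using hst)

end IsMonotoneCurve

/-- Smooth dependence on time of the projection along a fixed complement. -/
theorem contDiffAt_projAlong {J : ℝ → Submodule ℝ V} {L : Submodule ℝ V} {t₀ : ℝ} {m : ℕ}
    {E : Fin m → ℝ → V} (hE : ∀ i, ContDiffAt ℝ ∞ (E i) t₀)
    (hsp : ∀ᶠ t in 𝓝 t₀, LinearIndependent ℝ (fun i => E i t) ∧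
      Submodule.span ℝ (Set.range fun i => E i t) = J t)
    (hL : ∀ᶠ t in 𝓝 t₀, IsCompl (J t) L) (w : V) :
    ContDiffAt ℝ ∞ (fun t => projAlong (J t) L w) t₀ := by
  -- `T t` assembles a vector from its coordinates in the frame of `J t` and its part in `L`. It is
  -- smooth in `t` and invertible, so the coordinates, read off from its inverse, are smooth as
  -- well.
  set T : ℝ → ((Fin m → ℝ) × L) →L[ℝ] V := fun t =>
    (∑ i, ((ContinuousLinearMap.proj i).comp (ContinuousLinearMap.fst ℝ (Fin m → ℝ) L)).smulRight
      (E i t)) + L.subtypeL.comp (ContinuousLinearMap.snd ℝ (Fin m → ℝ) L) with hT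
  have hTapp : ∀ t p, T t p = ∑ i, p.1 i • E i t + p.2 := by
    intro t p
    simp [hT]
  have hTs : ContDiffAt ℝ ∞ T t₀ := by
    refine ContDiffAt.add (ContDiffAt.sum fun i _ => ?_) contDiffAt_const
    exact contDiffAt_const.smulRight (hE i)
  have hbij : ∀ᶠ t in 𝓝 t₀, Function.Bijective (T t) := by
    filter_upwards [hsp, hL] with t ht hc
    constructor
    · rw [injective_iff_map_eq_zero]
      rintro ⟨c, l⟩ h0
      rw [hTapp] at h0
      have h1 : ∑ i, c i • E i t ∈ J t := by
        rw [← ht.2]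
        exact Submodule.sum_mem _ fun i _ => Submodule.smul_mem _ _ (Submodule.subset_span ⟨i, rfl⟩)
      have h2 : ∑ i, c i • E i t ∈ L := by
        rw [eq_neg_of_add_eq_zero_left h0]
        exact L.neg_mem l.2
      have h3 : ∑ i, c i • E i t = 0 := by
        have : ∑ i, c i • E i t ∈ J t ⊓ L := ⟨h1, h2⟩
        rwa [hc.inf_eq_bot, Submodule.mem_bot] at this
      have h4 := Fintype.linearIndependent_iff.1 ht.1 c h3
      have h5 : (l : V) = 0 := by simpa [h3] using h0
      ext i
      · simpa using h4 i
      · simpa using h5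
    · intro v
      have h1 : projAlong (J t) L v ∈ Submodule.span ℝ (Set.range fun i => E i t) :=
        ht.2 ▸ projAlong_mem hc v
      obtain ⟨c, hcv⟩ := (Submodule.mem_span_range_iff_exists_fun ℝ).1 h1
      refine ⟨(c, ⟨_, sub_projAlong_mem hc v⟩), ?_⟩
      rw [hTapp]
      simp [hcv]
  have hinv : ∀ᶠ t in 𝓝 t₀, ∃ e : ((Fin m → ℝ) × L) ≃L[ℝ] V, (e : _ →L[ℝ] V) = T t := by
    filter_upwards [hbij] with t ht
    refine ⟨(LinearEquiv.ofBijective (T t : _ →ₗ[ℝ] V) ht).toContinuousLinearEquiv, ?_⟩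
    ext <;> rfl
  obtain ⟨e₀, he₀⟩ := hinv.self_of_nhds
  have hinvs : ContDiffAt ℝ ∞ (fun t => (T t).inverse) t₀ := by
    have h1 := contDiffAt_map_inverse (n := ∞) (𝕜 := ℝ) e₀
    rw [he₀] at h1
    exact h1.comp t₀ hTs
  have hmain : ContDiffAt ℝ ∞ (fun t => ∑ i, ((T t).inverse w).1 i • E i t) t₀ := by
    refine ContDiffAt.sum fun i _ => ContDiffAt.smul ?_ (hE i)
    have h1 : ContDiffAt ℝ ∞ (fun t => (T t).inverse w) t₀ := hinvs.clm_apply contDiffAt_const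
    exact ((ContinuousLinearMap.proj (R := ℝ) (φ := fun _ : Fin m => ℝ) i).comp
      (ContinuousLinearMap.fst ℝ (Fin m → ℝ) L)).contDiff.contDiffAt.comp t₀ h1
  refine hmain.congr_of_eventuallyEq ?_
  filter_upwards [hsp, hL, hinv] with t ht hc ⟨e, he⟩
  refine projAlong_eq hc ?_ ?_
  · rw [← ht.2]
    exact Submodule.sum_mem _ fun i _ => Submodule.smul_mem _ _ (Submodule.subset_span ⟨i, rfl⟩)
  · have h1 : T t ((T t).inverse w) = w := by
      rw [← he, ContinuousLinearMap.inverse_equiv]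
      simp
    rw [hTapp] at h1
    rw [sub_eq_of_eq_add' h1.symm]
    exact ((T t).inverse w).2.2

end Curves

/-! ### Existence of the limit of a monotone curve, and a criterion for belonging to it -/

section Limits

variable {V : Type*} [NormedAddCommGroup V] [NormedSpace ℝ V] [FiniteDimensional ℝ V]

theorem tendsto_clm_apply {ι U W : Type*} [NormedAddCommGroup U] [NormedSpace ℝ U]
    [NormedAddCommGroup W] [NormedSpace ℝ W] {F : Filter ι} {A : ι → U →L[ℝ] W} {A₀ : U →L[ℝ] W}
    {u : ι → U} {u₀ : U} (hA : Filter.Tendsto A F (𝓝 A₀)) (hu : Filter.Tendsto u F (𝓝 u₀)) :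
    Filter.Tendsto (fun t => A t (u t)) F (𝓝 (A₀ u₀)) :=
  (isBoundedBilinearMap_apply.continuous.tendsto (A₀, u₀)).comp (hA.prodMk_nhds hu)

theorem vectorTendsto_iff {u : ℝ → V} {F : Filter ℝ} {v : V} :
    VectorTendsto u F v ↔ Filter.Tendsto u F (𝓝 v) := by
  constructor
  · intro h
    set e := (finBasis ℝ V).equivFun.toContinuousLinearEquiv with he
    have h1 : Filter.Tendsto (fun t => e (u t)) F (𝓝 (e v)) := by
      rw [tendsto_pi_nhds]
      intro i
      exact h ((finBasis ℝ V).coord i)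
    have h2 := (e.symm.continuous.tendsto (e v)).comp h1
    simpa [Function.comp_def] using h2
  · intro h l
    exact ((LinearMap.continuous_of_finiteDimensional l).tendsto v).comp h

theorem SubspaceTendsto.exists_tendsto {J : ℝ → Submodule ℝ V} {F : Filter ℝ} {Δ : Submodule ℝ V}
    (h : SubspaceTendsto J F Δ) {w : V} (hw : w ∈ Δ) :
    ∃ u : ℝ → V, (∀ᶠ t in F, u t ∈ J t) ∧ Filter.Tendsto u F (𝓝 w) := by
  obtain ⟨k, u, v, -, hv, hu, hlim⟩ := h
  rw [← hv, Submodule.mem_span_range_iff_exists_fun] at hw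
  obtain ⟨c, rfl⟩ := hw
  refine ⟨fun t => ∑ i, c i • u t i, ?_, tendsto_finsetSum _ fun i _ =>
    (vectorTendsto_iff.1 (hlim i)).const_smul (c i)⟩
  filter_upwards [hu] with t ht
  rw [← ht.2]
  exact Submodule.sum_mem _ fun i _ => Submodule.smul_mem _ _ (Submodule.subset_span ⟨i, rfl⟩)

/-- A left inverse `D` of the limit frame map `U v` turns `D ∘ U (f t)` into a map tending to the
identity, hence eventually invertible. So the coordinates of `u t` in the moving frame converge, and
`w` is the combination of `v` with the limit coordinates. -/
theorem SubspaceTendsto.mem_of_tendsto {J : ℝ → Submodule ℝ V} {F : Filter ℝ} [F.NeBot]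
    {Δ : Submodule ℝ V} (h : SubspaceTendsto J F Δ) {w : V} {u : ℝ → V}
    (hu : ∀ᶠ t in F, u t ∈ J t) (hlim : Filter.Tendsto u F (𝓝 w)) : w ∈ Δ := by
  obtain ⟨k, f, v, hvi, hv, hf, hfl⟩ := h
  set U : (Fin k → V) → (Fin k → ℝ) →L[ℝ] V := fun g =>
    ∑ i, (ContinuousLinearMap.proj (R := ℝ) (φ := fun _ : Fin k => ℝ) i).smulRight (g i) with hU
  have hUapp : ∀ g c, U g c = ∑ i, c i • g i := fun g c => by simp [hU]
  have hUlim : Filter.Tendsto (fun t => U (f t)) F (𝓝 (U v)) := by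
    refine tendsto_finsetSum _ fun i _ => ?_
    exact ((ContinuousLinearMap.smulRightL ℝ (Fin k → ℝ) V
      (ContinuousLinearMap.proj i)).continuous.tendsto (v i)).comp (vectorTendsto_iff.1 (hfl i))
  have hinj : LinearMap.ker (U v : (Fin k → ℝ) →ₗ[ℝ] V) = ⊥ := by
    rw [LinearMap.ker_eq_bot']
    intro c hc
    have hc' : ∑ i, c i • v i = 0 := (hUapp v c).symm.trans hc
    ext i
    exact Fintype.linearIndependent_iff.1 hvi c hc' i
  obtain ⟨D', hD'⟩ := LinearMap.exists_leftInverse_of_injective _ hinj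
  set D : V →L[ℝ] (Fin k → ℝ) := D'.toContinuousLinearMap with hD
  have hDU : D.comp (U v) = ContinuousLinearMap.id ℝ _ := by
    ext1 c
    exact congrArg (fun A => A c) hD'
  have hcomp : Filter.Tendsto (fun t => D.comp (U (f t))) F
      (𝓝 ((ContinuousLinearEquiv.refl ℝ (Fin k → ℝ) : (Fin k → ℝ) →L[ℝ] (Fin k → ℝ)))) := by
    have h1 := ((ContinuousLinearMap.compL ℝ (Fin k → ℝ) V (Fin k → ℝ) D).continuous.tendsto
      (U v)).comp hUlim
    have h2 : ContinuousLinearMap.compL ℝ (Fin k → ℝ) V (Fin k → ℝ) D (U v)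
      = (ContinuousLinearEquiv.refl ℝ (Fin k → ℝ) : (Fin k → ℝ) →L[ℝ] (Fin k → ℝ)) := hDU
    rw [h2] at h1
    exact h1
  have hinv := ((contDiffAt_map_inverse (𝕜 := ℝ) (n := 0)
    (ContinuousLinearEquiv.refl ℝ (Fin k → ℝ))).continuousAt.tendsto).comp hcomp
  have hunit : ∀ᶠ t in F, ∃ e : (Fin k → ℝ) ≃L[ℝ] (Fin k → ℝ),
      (e : (Fin k → ℝ) →L[ℝ] (Fin k → ℝ)) = D.comp (U (f t)) :=
    hcomp.eventually ((ContinuousLinearEquiv.refl ℝ (Fin k → ℝ)).nhds)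
  have hDu : Filter.Tendsto (fun t => D (u t)) F (𝓝 (D w)) := (D.continuous.tendsto w).comp hlim
  have hc := tendsto_clm_apply hinv hDu
  have hfin := tendsto_clm_apply hUlim hc
  have heq : (fun t => U (f t) (((ContinuousLinearMap.inverse ∘ fun t => D.comp (U (f t))) t)
      (D (u t)))) =ᶠ[F] u := by
    filter_upwards [hu, hf, hunit] with t h1 h2 ⟨e, he⟩
    rw [← h2.2] at h1
    obtain ⟨c, hc⟩ := (Submodule.mem_span_range_iff_exists_fun ℝ).1 h1
    have h3 : D (u t) = e c := by
      rw [← hc, ← hUapp, ← ContinuousLinearEquiv.coe_coe, he]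
      rfl
    rw [Function.comp_apply, ← he, ContinuousLinearMap.inverse_equiv, h3, ← hc, ← hUapp]
    simp
  have hfin' := hfin.congr' heq
  have hw := tendsto_nhds_unique hlim hfin'
  rw [hw, hUapp, ← hv]
  exact Submodule.sum_mem _ fun i _ => Submodule.smul_mem _ _ (Submodule.subset_span ⟨i, rfl⟩)

theorem SubspaceTendsto.unique {J : ℝ → Submodule ℝ V} {F : Filter ℝ} [F.NeBot]
    {Δ Δ' : Submodule ℝ V} (h : SubspaceTendsto J F Δ) (h' : SubspaceTendsto J F Δ') : Δ = Δ' := by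
  ext w
  constructor
  · intro hw
    obtain ⟨u, hu, hl⟩ := h.exists_tendsto hw
    exact h'.mem_of_tendsto hu hl
  · intro hw
    obtain ⟨u, hu, hl⟩ := h'.exists_tendsto hw
    exact h.mem_of_tendsto hu hl

theorem SubspaceTendsto.limSubspace_eq {J : ℝ → Submodule ℝ V} {F : Filter ℝ} [F.NeBot]
    {Δ : Submodule ℝ V} (h : SubspaceTendsto J F Δ) : limSubspace J F = Δ := by
  have h1 : ∃ Δ, SubspaceTendsto J F Δ := ⟨Δ, h⟩
  rw [limSubspace, dif_pos h1]
  exact h1.choose_spec.unique h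

theorem exists_tendsto_of_bilin {σ : V →ₗ[ℝ] V →ₗ[ℝ] ℝ} (hσ : IsSymplecticBilin σ)
    {F : Filter ℝ} {u : ℝ → V} (h : ∀ w, ∃ a, Filter.Tendsto (fun t => σ (u t) w) F (𝓝 a)) :
    ∃ v, Filter.Tendsto u F (𝓝 v) := by
  set b := finBasis ℝ V
  let Φ : V →ₗ[ℝ] (Fin (finrank ℝ V) → ℝ) := LinearMap.pi fun i => σ.flip (b i)
  have hinj : Function.Injective Φ := by
    rw [injective_iff_map_eq_zero]
    intro v hv
    refine hσ.nondeg v fun w => ?_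
    have h1 : σ v = 0 := b.ext fun i => congrFun hv i
    rw [h1]; rfl
  let e := (LinearEquiv.ofInjectiveOfFinrankEq Φ hinj (by simp)).toContinuousLinearEquiv
  choose a ha using h
  refine ⟨e.symm fun i => a (b i), ?_⟩
  have h1 : Filter.Tendsto (fun t => e (u t)) F (𝓝 fun i => a (b i)) := by
    rw [tendsto_pi_nhds]
    intro i
    exact ha (b i)
  have h2 := (e.symm.continuous.tendsto _).comp h1
  simpa [Function.comp_def] using h2

namespace IsMonotoneCurve

variable {σ : V →ₗ[ℝ] V →ₗ[ℝ] ℝ} {J : ℝ → Submodule ℝ V}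

theorem contDiffAt_projAlong (h : IsMonotoneCurve σ J) {s t : ℝ} (hst : t ≠ s) (w : V) :
    ContDiffAt ℝ ∞ (fun t => projAlong (J t) (J s) w) t := by
  obtain ⟨m, E, hE, hsp, -⟩ := h.frame t
  refine _root_.contDiffAt_projAlong hE hsp ?_ w
  filter_upwards [isOpen_ne.mem_nhds hst] with r hr using h.isCompl hr

theorem isCurveIn_projAlong (h : IsMonotoneCurve σ J) {s t : ℝ} (hst : t ≠ s) (w : V) :
    IsCurveIn J t (fun t => projAlong (J t) (J s) w)
      (deriv (fun t => projAlong (J t) (J s) w) t) := by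
  refine ⟨((h.contDiffAt_projAlong hst w).differentiableAt (by simp)).hasDerivAt, ?_⟩
  filter_upwards [isOpen_ne.mem_nhds hst] with r hr using projAlong_mem (h.isCompl hr) w

/-- The vectors `π_t w - w` stay in `J s`, and so does their derivative. Since `w - π_t w` is also
in `J s`, the second argument `w` of `σ` may be replaced by `π_t w`, which turns the derivative into
the velocity form. -/
theorem hasDerivAt_apply_projAlong (h : IsMonotoneCurve σ J) {s t : ℝ} (hst : t ≠ s) (w : V) :
    HasDerivAt (fun t => σ (projAlong (J t) (J s) w) w)
      (σ (deriv (fun t => projAlong (J t) (J s) w) t) (projAlong (J t) (J s) w)) t := by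
  have h1 := (h.isCurveIn_projAlong hst w).1
  have h2 := h1.bilin σ (hasDerivAt_const t w)
  rw [map_zero, add_zero] at h2
  convert h2 using 1
  have h3 : deriv (fun t => projAlong (J t) (J s) w) t ∈ J s := by
    have h4 : HasDerivAt (fun t => projAlong (J t) (J s) w - w)
      (deriv (fun t => projAlong (J t) (J s) w) t) t := h1.sub_const w
    rw [h.lagrangian s]
    intro v hv
    have h5 := h4.bilin σ (hasDerivAt_const t v)
    rw [map_zero, add_zero] at h5
    refine h5.unique ((hasDerivAt_const t (0 : ℝ)).congr_of_eventuallyEq ?_)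
    filter_upwards [isOpen_ne.mem_nhds hst] with r hr
    have h6 := (J s).neg_mem (sub_projAlong_mem (h.isCompl hr) w)
    rw [neg_sub] at h6
    exact (h.lagrangian s).apply_eq_zero h6 hv
  have h4 := (h.lagrangian s).apply_eq_zero h3 (sub_projAlong_mem (h.isCompl hst) w)
  rw [map_sub] at h4
  linarith

theorem strictMonoOn (h : IsMonotoneCurve σ J) {s : ℝ} {w : V} (hw : w ∉ J s) :
    StrictMonoOn (fun t => σ (projAlong (J t) (J s) w) w) (Set.Ioi s) := by
  refine strictMonoOn_of_deriv_pos (convex_Ioi s) (fun t ht => ?_) fun t ht => ?_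
  · exact (h.hasDerivAt_apply_projAlong (ne_of_gt ht) w).continuousAt.continuousWithinAt
  · rw [interior_Ioi] at ht
    have hst : t ≠ s := ne_of_gt ht
    rw [(h.hasDerivAt_apply_projAlong hst w).deriv]
    refine h.velocity_pos (h.isCurveIn_projAlong hst w) ?_
    rwa [Ne, projAlong_eq_zero (h.isCompl hst)]

theorem monotoneOn (h : IsMonotoneCurve σ J) (s : ℝ) (w : V) :
    MonotoneOn (fun t => σ (projAlong (J t) (J s) w) w) (Set.Ioi s) := by
  by_cases hw : w ∈ J s
  · intro a ha b hb _
    have h1 := (projAlong_eq_zero (h.isCompl (ne_of_gt ha))).2 hw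
    have h2 := (projAlong_eq_zero (h.isCompl (ne_of_gt hb))).2 hw
    simp [h1, h2]
  · exact (h.strictMonoOn hw).monotoneOn

/-- Three members of the curve at times `r < s < t` are positively ordered. -/
theorem apply_nonneg_of_add_mem (h : IsMonotoneCurve σ J) {r s t : ℝ} (hrs : r < s) (hst : s < t)
    {a b : V} (ha : a ∈ J s) (hb : b ∈ J r) (hab : a + b ∈ J t) : 0 ≤ σ b a := by
  have h1 := h.monotoneOn r a (Set.mem_Ioi.2 hrs) (Set.mem_Ioi.2 (hrs.trans hst)) hst.le
  have h2 : projAlong (J s) (J r) a = a := projAlong_of_mem (h.isCompl hrs.ne') ha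
  have h3 : projAlong (J t) (J r) a = a + b :=
    projAlong_eq (h.isCompl (hrs.trans hst).ne') hab (by simpa using hb)
  simp only [h2, h3, map_add, LinearMap.add_apply, h.symplectic.self_eq_zero] at h1
  linarith

/-- The two projections along `J s` differ by an element of `J s`, which makes a triple with members
in `J r`, `J s` and `J t`; the positive ordering of the triple gives the inequality. It supplies the
upper bound that monotonicity needs in order to yield a limit. -/
theorem apply_projAlong_le (h : IsMonotoneCurve σ J) {r s t : ℝ} (hrs : r < s) (hst : s < t)
    (w : V) : σ (projAlong (J t) (J s) w) w ≤ σ (projAlong (J r) (J s) w) w := by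
  set b := projAlong (J r) (J s) w with hb
  set u := projAlong (J t) (J s) w with hu
  have hwb : w - b ∈ J s := sub_projAlong_mem (h.isCompl hrs.ne) w
  have hwu : w - u ∈ J s := sub_projAlong_mem (h.isCompl hst.ne') w
  have ha : u - b ∈ J s := by
    have := (J s).sub_mem hwb hwu
    rwa [sub_sub_sub_cancel_left] at this
  have h1 := h.apply_nonneg_of_add_mem hrs hst ha (projAlong_mem (h.isCompl hrs.ne) w)
    (by rw [← hb, sub_add_cancel]; exact projAlong_mem (h.isCompl hst.ne') w)
  have h2 := (h.lagrangian s).apply_eq_zero ha hwb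
  have h3 := h.symplectic.skew b (u - b)
  rw [← hb] at h1
  simp only [map_sub, LinearMap.sub_apply] at h1 h2 h3
  linarith

theorem exists_tendsto_apply_projAlong (h : IsMonotoneCurve σ J) (s : ℝ) (w : V) :
    ∃ a, Filter.Tendsto (fun t => σ (projAlong (J t) (J s) w) w) Filter.atTop (𝓝 a) ∧
      ∀ t > s, σ (projAlong (J t) (J s) w) w ≤ a := by
  set q := fun t => σ (projAlong (J t) (J s) w) w with hq
  -- At `t = s` the projection degenerates. Freezing `q` before `s + 1` gives a function that is
  -- monotone on the whole line and has the same limit.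
  set q' : ℝ → ℝ := fun t => q (max t (s + 1)) with hq'
  have hlt : ∀ t, s < max t (s + 1) := fun t => lt_max_of_lt_right (by linarith)
  have hmono : Monotone q' := fun a b hab =>
    h.monotoneOn s w (hlt a) (hlt b) (max_le_max_right _ hab)
  have hbdd : BddAbove (Set.range q') := by
    refine ⟨σ (projAlong (J (s - 1)) (J s) w) w, ?_⟩
    rintro _ ⟨t, rfl⟩
    exact h.apply_projAlong_le (by linarith) (hlt t) w
  have hlim := tendsto_atTop_ciSup hmono hbdd
  refine ⟨_, hlim.congr' ?_, fun t ht => ?_⟩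
  · filter_upwards [Filter.eventually_ge_atTop (s + 1)] with t ht
    simp [hq', max_eq_left ht]
  · refine le_trans ?_ (le_ciSup hbdd t)
    exact h.monotoneOn s w ht (hlt t) (le_max_left _ _)

/-- The quadratic forms of the projections along `J s` are monotone and bounded. By polarisation and
nondegeneracy the projections converge, and the range of the limit map is the limit subspace. -/
theorem exists_limit_along (h : IsMonotoneCurve σ J) (s : ℝ) :
    ∃ Δ, IsLagrangianSubspace σ Δ ∧ SubspaceTendsto J Filter.atTop Δ ∧ IsCompl Δ (J s) ∧
      ∀ w, Filter.Tendsto (fun t => projAlong (J t) (J s) w) Filter.atTop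
        (𝓝 (projAlong Δ (J s) w)) := by
  have hgt : ∀ᶠ t in Filter.atTop, IsCompl (J t) (J s) := by
    filter_upwards [Filter.eventually_gt_atTop s] with t ht using h.isCompl (ne_of_gt ht)
  have h1 : ∀ w, ∃ v, Filter.Tendsto (fun t => projAlong (J t) (J s) w) Filter.atTop (𝓝 v) := by
    intro w
    refine exists_tendsto_of_bilin h.symplectic fun w' => ?_
    obtain ⟨a, ha, -⟩ := h.exists_tendsto_apply_projAlong s (w + w')
    obtain ⟨b, hb, -⟩ := h.exists_tendsto_apply_projAlong s w
    obtain ⟨c, hc, -⟩ := h.exists_tendsto_apply_projAlong s w'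
    refine ⟨(a - b - c + σ w w') / 2,
      ((((ha.sub hb).sub hc).add_const (σ w w')).div_const 2).congr' ?_⟩
    filter_upwards [hgt] with t ht
    have := two_mul_apply_projAlong h.symplectic (h.lagrangian t) (h.lagrangian s) ht w w'
    linarith
  choose f hf using h1
  set P : V →ₗ[ℝ] V := linearMapOfTendsto (l := Filter.atTop) f
    (fun t => projAlong (J t) (J s)) (tendsto_pi_nhds.2 hf) with hP
  have hPlim : ∀ w, Filter.Tendsto (fun t => projAlong (J t) (J s) w) Filter.atTop (𝓝 (P w)) := hf
  have hsub : ∀ w, w - P w ∈ J s := by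
    intro w
    refine (J s).closed_of_finiteDimensional.mem_of_tendsto ((hPlim w).const_sub w) ?_
    filter_upwards [hgt] with t ht using sub_projAlong_mem ht w
  have hzero : ∀ w ∈ J s, P w = 0 := by
    intro w hw
    refine tendsto_nhds_unique (hPlim w) (tendsto_const_nhds.congr' ?_)
    filter_upwards [hgt] with t ht using ((projAlong_eq_zero ht).2 hw).symm
  have hid : ∀ w, P (P w) = P w := by
    intro w
    have := hzero _ (hsub w)
    rw [map_sub] at this
    exact (sub_eq_zero.1 this).symm
  have hcompl : IsCompl (LinearMap.range P) (J s) := by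
    constructor
    · rw [Submodule.disjoint_def]
      rintro _ ⟨w, rfl⟩ hw
      rw [← hid, hzero _ hw]
    · rw [codisjoint_iff, Submodule.eq_top_iff']
      intro w
      have := Submodule.add_mem_sup (LinearMap.mem_range_self P w) (hsub w)
      rwa [add_sub_cancel] at this
  have hproj : ∀ w, projAlong (LinearMap.range P) (J s) w = P w := fun w =>
    projAlong_eq hcompl (LinearMap.mem_range_self P w) (hsub w)
  have hcontσ : ∀ u v, Filter.Tendsto (fun t => σ (projAlong (J t) (J s) u)
      (projAlong (J t) (J s) v)) Filter.atTop (𝓝 (σ (P u) (P v))) := by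
    intro u v
    exact tendsto_clm_apply ((σ.toContinuousBilinearMap.continuous.tendsto _).comp (hPlim u))
      (hPlim v)
  -- Isotropy passes to the limit, and the limit has the right dimension since it is complementary
  -- to `J s`.
  have hiso : ∀ u ∈ LinearMap.range P, ∀ w ∈ LinearMap.range P, σ u w = 0 := by
    rintro _ ⟨u, rfl⟩ _ ⟨w, rfl⟩
    refine tendsto_nhds_unique (hcontσ u w) (tendsto_const_nhds.congr' ?_)
    filter_upwards [hgt] with t ht
    exact ((h.lagrangian t).apply_eq_zero (projAlong_mem ht u) (projAlong_mem ht w)).symm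
  have hfin : ∀ K : Submodule ℝ V, IsCompl K (J s) → 2 * finrank ℝ K = finrank ℝ V := by
    intro K hK
    have h2 := Submodule.finrank_add_eq_of_isCompl hK
    have h3 := (h.lagrangian s).two_mul_finrank h.symplectic
    omega
  refine ⟨LinearMap.range P, isLagrangianSubspace_of_finrank h.symplectic hiso (hfin _ hcompl), ?_,
    hcompl, fun w => by rw [hproj]; exact hPlim w⟩
  -- The approximating frames of `J t` are the projections of a basis of the limit. They stay
  -- independent because the kernel `J s` of the projection is complementary to the limit.
  set b := finBasis ℝ (LinearMap.range P) with hb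
  have hbli : LinearIndependent ℝ fun i => (b i : V) :=
    b.linearIndependent.map' _ (Submodule.ker_subtype _)
  have hbP : ∀ i, P (b i : V) = b i := by
    intro i
    obtain ⟨v, hv⟩ := (b i).2
    rw [← hv, hid]
  refine ⟨finrank ℝ (LinearMap.range P), fun t i => projAlong (J t) (J s) (b i : V),
    fun i => (b i : V), hbli, ?_, ?_, fun i => vectorTendsto_iff.2 ?_⟩
  · have := b.span_eq
    have h2 := congrArg (Submodule.map (LinearMap.range P).subtype) this
    rw [Submodule.map_span, Submodule.map_top, Submodule.range_subtype, ← Set.range_comp] at h2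
    exact h2
  · filter_upwards [hgt] with t ht
    have hli : LinearIndependent ℝ fun i => projAlong (J t) (J s) (b i : V) := by
      rw [Fintype.linearIndependent_iff]
      intro c hc
      have h2 : projAlong (J t) (J s) (∑ i, c i • (b i : V)) = 0 := by
        rw [map_sum]
        simpa using hc
      rw [projAlong_eq_zero ht] at h2
      have h3 : ∑ i, c i • (b i : V) ∈ LinearMap.range P :=
        Submodule.sum_mem _ fun i _ => Submodule.smul_mem _ _ (b i).2
      have h4 : ∑ i, c i • (b i : V) = 0 := (Submodule.disjoint_def.1 hcompl.disjoint) _ h3 h2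
      exact Fintype.linearIndependent_iff.1 hbli c h4
    refine ⟨hli, Submodule.eq_of_le_of_finrank_eq ?_ ?_⟩
    · rw [Submodule.span_le]
      rintro _ ⟨i, rfl⟩
      exact projAlong_mem ht _
    · rw [finrank_span_eq_card hli, Fintype.card_fin]
      have h2 := hfin _ hcompl
      have h3 := hfin _ ht
      omega
  · have := hPlim (b i)
    rwa [hbP] at this

/-- The curve has a limit as `t → ∞`; it is a Lagrangian subspace transversal to the curve. -/
theorem exists_limit (h : IsMonotoneCurve σ J) :
    ∃ Δ, SubspaceTendsto J Filter.atTop Δ ∧ IsLagrangianSubspace σ Δ ∧ ∀ s, IsCompl Δ (J s) ∧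
      ∀ w, Filter.Tendsto (fun t => projAlong (J t) (J s) w) Filter.atTop
        (𝓝 (projAlong Δ (J s) w)) := by
  obtain ⟨Δ, h1, h2, -⟩ := h.exists_limit_along 0
  refine ⟨Δ, h2, h1, fun s => ?_⟩
  obtain ⟨Δ', -, h2', h3, h4⟩ := h.exists_limit_along s
  rw [h2.unique h2']
  exact ⟨h3, h4⟩

theorem limit_spec (h : IsMonotoneCurve σ J) :
    SubspaceTendsto J Filter.atTop (limSubspace J Filter.atTop) ∧
      IsLagrangianSubspace σ (limSubspace J Filter.atTop) ∧
      ∀ s, IsCompl (limSubspace J Filter.atTop) (J s) ∧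
        ∀ w, Filter.Tendsto (fun t => projAlong (J t) (J s) w) Filter.atTop
          (𝓝 (projAlong (limSubspace J Filter.atTop) (J s) w)) := by
  obtain ⟨Δ, h1, h2⟩ := h.exists_limit
  rw [h1.limSubspace_eq]
  exact ⟨h1, h2⟩

theorem _root_.subspaceTendsto_neg_iff {J : ℝ → Submodule ℝ V} {Δ : Submodule ℝ V} :
    SubspaceTendsto (fun t => J (-t)) Filter.atTop Δ ↔ SubspaceTendsto J Filter.atBot Δ := by
  constructor
  · rintro ⟨k, u, v, h1, h2, h3, h4⟩
    refine ⟨k, fun t => u (-t), v, h1, h2, ?_, fun i l => (h4 i l).comp Filter.tendsto_neg_atBot_atTop⟩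
    simpa using Filter.tendsto_neg_atBot_atTop.eventually h3
  · rintro ⟨k, u, v, h1, h2, h3, h4⟩
    exact ⟨k, fun t => u (-t), v, h1, h2, Filter.tendsto_neg_atTop_atBot.eventually h3,
      fun i l => (h4 i l).comp Filter.tendsto_neg_atTop_atBot⟩

theorem limSubspace_reverse (h : IsMonotoneCurve σ J) :
    limSubspace (fun t => J (-t)) Filter.atTop = limSubspace J Filter.atBot :=
  (subspaceTendsto_neg_iff.1 h.reverse.limit_spec.1).limSubspace_eq.symm

/-- Vectors whose pairing with the curve is controlled by the velocity form belong to the limit. -/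
theorem mem_limSubspace (h : IsMonotoneCurve σ J) {w : V} {t₀ C : ℝ}
    (hw : ∀ t ≥ t₀, ∀ e e', IsCurveIn J t e e' → σ w (e t) ^ 2 ≤ C * σ e' (e t)) :
    w ∈ limSubspace J Filter.atTop := by
  obtain ⟨-, hlag, hlim⟩ := h.limit_spec
  obtain ⟨hcompl, hproj⟩ := hlim t₀
  set Δ := limSubspace J Filter.atTop
  by_contra hne
  have hξ : w - projAlong Δ (J t₀) w ≠ 0 := by
    intro h0
    rw [sub_eq_zero] at h0
    exact hne (h0 ▸ projAlong_mem hcompl w)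
  obtain ⟨z, hz⟩ : ∃ z, σ (w - projAlong Δ (J t₀) w) z ≠ 0 := by
    by_contra! hcon
    exact hξ (h.symplectic.nondeg _ hcon)
  set a := σ (w - projAlong Δ (J t₀) w) z with ha
  have ha2 : 0 < a ^ 2 / 2 := by positivity
  -- By `apply_projAlong_swap`, `σ w (π_t z) = σ (w - π_t w) z`, which tends to `a ≠ 0`. By
  -- hypothesis, the velocity form at `π_t z`, which is the derivative of `σ (π_t z) z`, is then
  -- bounded away from zero.
  have hlim1 : Filter.Tendsto (fun t => σ w (projAlong (J t) (J t₀) z) ^ 2) Filter.atTop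
      (𝓝 (a ^ 2)) := by
    have h1 : Filter.Tendsto (fun t => σ (w - projAlong (J t) (J t₀) w) z ^ 2) Filter.atTop
        (𝓝 (a ^ 2)) :=
      (((continuous_bilin_left σ z).tendsto _).comp ((hproj w).const_sub w)).pow 2
    refine h1.congr' ?_
    filter_upwards [Filter.eventually_gt_atTop t₀] with t ht
    have h2 := apply_projAlong_swap (h.lagrangian t) (h.lagrangian t₀) (h.isCompl (ne_of_gt ht)) w z
    rw [map_sub, LinearMap.sub_apply, h2, sub_sub_cancel]
  obtain ⟨b, -, hb⟩ := h.exists_tendsto_apply_projAlong t₀ z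
  have hev : ∀ᶠ t in Filter.atTop, a ^ 2 / 2 < σ w (projAlong (J t) (J t₀) z) ^ 2 :=
    hlim1.eventually (lt_mem_nhds (by linarith))
  obtain ⟨t₁, ht₁⟩ := Filter.eventually_atTop.1 (hev.and (Filter.eventually_gt_atTop t₀))
  have hder : ∀ t ≥ t₁, a ^ 2 / 2 < C * deriv (fun t => σ (projAlong (J t) (J t₀) z) z) t := by
    intro t ht
    obtain ⟨h1, h2⟩ := ht₁ t ht
    rw [(h.hasDerivAt_apply_projAlong (ne_of_gt h2) z).deriv]
    exact h1.trans_le (hw t h2.le _ _ (h.isCurveIn_projAlong (ne_of_gt h2) z))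
  have hdiff : ∀ t ≥ t₁, DifferentiableAt ℝ (fun t => C * σ (projAlong (J t) (J t₀) z) z) t :=
    fun t ht => ((h.hasDerivAt_apply_projAlong (ne_of_gt (ht₁ t ht).2) z).const_mul
      C).differentiableAt
  have hgrow : ∀ t ≥ t₁, a ^ 2 / 2 * (t - t₁) ≤ C * σ (projAlong (J t) (J t₀) z) z
      - C * σ (projAlong (J t₁) (J t₀) z) z := by
    intro t ht
    refine (convex_Ici t₁).mul_sub_le_image_sub_of_le_deriv
      (f := fun t => C * σ (projAlong (J t) (J t₀) z) z)
      (fun r hr => (hdiff r hr).continuousAt.continuousWithinAt)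
      (fun r hr => (hdiff r (interior_subset hr)).differentiableWithinAt) (fun r hr => ?_)
      t₁ Set.self_mem_Ici t ht ht
    have hr' : r ≥ t₁ := interior_subset hr
    have h3 := (h.hasDerivAt_apply_projAlong (ne_of_gt (ht₁ r hr').2) z)
    rw [(h3.const_mul C).deriv, ← h3.deriv]
    exact (hder r hr').le
  have hC : 0 < C := by
    have h1 := hder t₁ le_rfl
    have h3 := (h.hasDerivAt_apply_projAlong (ne_of_gt (ht₁ t₁ le_rfl).2) z).deriv
    have h4 := h.velocity_nonneg (h.isCurveIn_projAlong (ne_of_gt (ht₁ t₁ le_rfl).2) z)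
    rw [h3] at h1
    by_contra hC
    nlinarith
  set c := C * σ (projAlong (J t₁) (J t₀) z) z
  -- A time at which the linear lower bound equals `|C * b - c| + 1`, which exceeds the total growth
  -- `C * b - c` that the upper bound `b` allows.
  set t := t₁ + (|C * b - c| + 1) / (a ^ 2 / 2) with ht
  have htt : t ≥ t₁ := by
    have : 0 ≤ (|C * b - c| + 1) / (a ^ 2 / 2) := by positivity
    linarith
  have h1 := hgrow t htt
  have h2 := mul_le_mul_of_nonneg_left (hb t (ht₁ t htt).2) hC.le
  have h3 : a ^ 2 / 2 * (t - t₁) = |C * b - c| + 1 := by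
    rw [ht, add_sub_cancel_left]
    field_simp
  have h4 := le_abs_self (C * b - c)
  linarith

end IsMonotoneCurve

end Limits

/-! ### Linear differential equations with variable coefficients -/

section LinearODE

variable {F : Type*} [NormedAddCommGroup F] [NormedSpace ℝ F] [CompleteSpace F]

open intervalIntegral in
/-- A linear differential equation on the line has global solutions. -/
theorem exists_solution_linear {M : ℝ → F →L[ℝ] F} (hM : Continuous M) (x₀ : F) :
    ∃ a : ℝ → F, a 0 = x₀ ∧ ∀ t, HasDerivAt a (M t (a t)) t := by
  -- The increments of the Picard iteration: each is the integral of `M` applied to the preceding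
  -- one. The factorial bound allows termwise differentiation of their sum, which therefore solves
  -- the equation.
  let I : ℕ → ℝ → F := fun k => Nat.rec (fun _ => x₀) (fun _ f t => ∫ s in (0 : ℝ)..t, M s (f s)) k
  have hI0 : ∀ t, I 0 t = x₀ := fun t => rfl
  have hIs : ∀ k t, I (k + 1) t = ∫ s in (0 : ℝ)..t, M s (I k s) := fun k t => rfl
  have hcont : ∀ k, Continuous (I k) := by
    intro k
    induction k with
    | zero => exact continuous_const
    | succ k ih =>
      have h1 : Continuous fun s => M s (I k s) := hM.clm_apply ih
      exact continuous_iff_continuousAt.2 fun t =>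
        (h1.integral_hasStrictDerivAt 0 t).hasDerivAt.continuousAt
  have hder : ∀ k t, HasDerivAt (I (k + 1)) (M t (I k t)) t := fun k t =>
    ((hM.clm_apply (hcont k)).integral_hasStrictDerivAt 0 t).hasDerivAt
  have hzero : ∀ k, I (k + 1) 0 = 0 := fun k => by simp [hIs]
  have hbound : ∀ R : ℝ, ∃ K : ℝ, 0 ≤ K ∧ (∀ t, |t| ≤ R → ‖M t‖ ≤ K) ∧
      ∀ k t, |t| ≤ R → ‖I k t‖ ≤ ‖x₀‖ * (K * |t|) ^ k / k.factorial := by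
    intro R
    obtain ⟨K, hK⟩ := (isCompact_Icc (a := -R) (b := R)).exists_bound_of_continuousOn
      hM.norm.continuousOn
    refine ⟨max K 0, le_max_right _ _, fun t ht => ?_, fun k => ?_⟩
    · have := hK t (abs_le.1 ht)
      rw [norm_norm] at this
      exact this.trans (le_max_left _ _)
    induction k with
    | zero => intro t _; simp [hI0]
    | succ k ih =>
      intro t ht
      have hsub : ∀ s ∈ Set.uIoc 0 t, |s| ≤ R := by
        intro s hs
        have h1 : |s| ≤ |t| := by
          have := Set.abs_sub_left_of_mem_uIcc (Set.uIoc_subset_uIcc hs)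
          simpa using this
        exact h1.trans ht
      rw [hIs]
      have hint : MeasureTheory.IntegrableOn
          (fun s => ‖x₀‖ * (max K 0) ^ (k + 1) / k.factorial * |s - 0| ^ k) (Set.uIoc 0 t) := by
        have h1 : Continuous fun s : ℝ => ‖x₀‖ * (max K 0) ^ (k + 1) / k.factorial * |s - 0| ^ k := by
          fun_prop
        exact (h1.intervalIntegrable 0 t).def'
      calc ‖∫ s in (0 : ℝ)..t, M s (I k s)‖
          ≤ ∫ s in Set.uIoc 0 t, ‖M s (I k s)‖ := norm_integral_le_integral_norm_uIoc
        _ ≤ ∫ s in Set.uIoc 0 t, ‖x₀‖ * (max K 0) ^ (k + 1) / k.factorial * |s - 0| ^ k := by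
            refine MeasureTheory.setIntegral_mono_on ?_ hint measurableSet_uIoc fun s hs => ?_
            · exact ((hM.clm_apply (hcont k)).norm.intervalIntegrable 0 t).def'
            · have h1 : ‖M s‖ ≤ max K 0 := by
                have := hK s (abs_le.1 (hsub s hs))
                rw [norm_norm] at this
                exact this.trans (le_max_left _ _)
              calc ‖M s (I k s)‖ ≤ ‖M s‖ * ‖I k s‖ := (M s).le_opNorm _
                _ ≤ max K 0 * (‖x₀‖ * (max K 0 * |s|) ^ k / k.factorial) :=
                    mul_le_mul h1 (ih s (hsub s hs)) (norm_nonneg _) (le_max_right _ _)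
                _ = _ := by rw [sub_zero]; ring
        _ = _ := by
            rw [MeasureTheory.integral_const_mul, integral_pow_abs_sub_uIoc, sub_zero,
              Nat.factorial_succ]
            push_cast
            rw [mul_pow]
            field_simp
  refine ⟨fun t => x₀ + ∑' n, I (n + 1) t, by simp [hzero], fun t => ?_⟩
  obtain ⟨K, hK0, hKM, hKI⟩ := hbound (|t| + 1)
  set R := |t| + 1 with hR
  have hR0 : 0 ≤ R := by positivity
  set u : ℕ → ℝ := fun n => K * ‖x₀‖ * ((K * R) ^ n / n.factorial) with hu
  have hus : Summable u := (Real.summable_pow_div_factorial (K * R)).mul_left _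
  have hIbound : ∀ n s, |s| ≤ R → ‖I n s‖ ≤ ‖x₀‖ * ((K * R) ^ n / n.factorial) := by
    intro n s hs
    refine (hKI n s hs).trans ?_
    rw [mul_div_assoc]
    gcongr
  have hball : ∀ s ∈ Metric.ball (0 : ℝ) R, |s| ≤ R := fun s hs => by
    rw [mem_ball_zero_iff, Real.norm_eq_abs] at hs
    exact hs.le
  have htR : t ∈ Metric.ball (0 : ℝ) R := by
    rw [mem_ball_zero_iff, Real.norm_eq_abs]
    linarith
  have hd := hasDerivAt_tsum_of_isPreconnected (𝕜 := ℝ) (g := fun n => I (n + 1))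
    (g' := fun n s => M s (I n s)) (y₀ := 0) hus Metric.isOpen_ball
    (convex_ball (0 : ℝ) R).isPreconnected (fun n s _ => hder n s) (fun n s hs => by
      calc ‖M s (I n s)‖ ≤ ‖M s‖ * ‖I n s‖ := (M s).le_opNorm _
        _ ≤ K * (‖x₀‖ * ((K * R) ^ n / n.factorial)) :=
            mul_le_mul (hKM s (hball s hs)) (hIbound n s (hball s hs)) (norm_nonneg _) hK0
        _ = u n := by rw [hu]; ring)
    (Metric.mem_ball_self (by positivity)) (by simp [hzero, summable_zero]) htR
  have hsum : Summable fun n => I n t := by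
    refine Summable.of_norm_bounded
      ((Real.summable_pow_div_factorial (K * R)).mul_left ‖x₀‖) fun n => ?_
    exact hIbound n t (hball t htR)
  have heq : ∑' n, M t (I n t) = M t (x₀ + ∑' n, I (n + 1) t) := by
    rw [← (M t).map_tsum hsum, hsum.tsum_eq_zero_add, hI0]
  rw [heq] at hd
  exact hd.const_add x₀

theorem contDiff_of_linear_ode {M : ℝ → F →L[ℝ] F} (hM : ContDiff ℝ ∞ M) {a : ℝ → F}
    (ha : ∀ t, HasDerivAt a (M t (a t)) t) : ContDiff ℝ ∞ a := by
  rw [contDiff_infty]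
  intro n
  have hdiff : Differentiable ℝ a := fun t => (ha t).differentiableAt
  have hderiv : deriv a = fun t => M t (a t) := funext fun t => (ha t).deriv
  induction n with
  | zero => exact contDiff_zero.2 hdiff.continuous
  | succ n ih =>
    push_cast
    rw [contDiff_succ_iff_deriv]
    refine ⟨hdiff, fun h => by simp at h, ?_⟩
    rw [hderiv]
    exact (hM.of_le (by exact_mod_cast le_top)).clm_apply ih

end LinearODE

/-! ### Existence of canonical frames -/

section CanonicalFrame

variable {V : Type*} [NormedAddCommGroup V] [NormedSpace ℝ V] [FiniteDimensional ℝ V]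
  {σ : V →ₗ[ℝ] V →ₗ[ℝ] ℝ} {J : ℝ → Submodule ℝ V} {m : ℕ}

theorem bilin_sum_sum (σ : V →ₗ[ℝ] V →ₗ[ℝ] ℝ) (x y : Fin m → ℝ) (u v : Fin m → V) :
    σ (∑ i, x i • u i) (∑ j, y j • v j) = ∑ i, ∑ j, x i * y j * σ (u i) (v j) := by
  simp only [map_sum, map_smul, LinearMap.sum_apply, LinearMap.smul_apply, smul_eq_mul,
    Finset.mul_sum]
  rw [Finset.sum_comm]
  refine Finset.sum_congr rfl fun i _ => Finset.sum_congr rfl fun j _ => by ring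

/-- The difference of `projAlong (J t) Δ w` and the constant `w` runs in the fixed subspace `Δ`,
hence so does its derivative. -/
theorem deriv_projAlong_mem {Δ : Submodule ℝ V} (hΔ : IsLagrangianSubspace σ Δ)
    (hc : ∀ t, IsCompl (J t) Δ) {w : V} (hw : Differentiable ℝ fun t => projAlong (J t) Δ w) (t : ℝ) :
    deriv (fun t => projAlong (J t) Δ w) t ∈ Δ := by
  rw [hΔ]
  intro v hv
  have h2 := ((hw t).hasDerivAt.sub_const w).bilin σ (hasDerivAt_const t v)
  rw [map_zero, add_zero] at h2
  refine h2.unique ((hasDerivAt_const t (0 : ℝ)).congr_of_eventuallyEq ?_)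
  refine Filter.Eventually.of_forall fun r => ?_
  have h3 := Δ.neg_mem (sub_projAlong_mem (hc r) w)
  rw [neg_sub] at h3
  exact hΔ.apply_eq_zero h3 hv

/-- The limit `Δ` is transversal to the whole curve, so projecting a fixed basis of `J 0` along `Δ`
gives a frame for all times at once. Its derivatives lie in the Lagrangian subspace `Δ` and are
therefore mutually skew-orthogonal. -/
theorem IsMonotoneCurve.exists_global_frame (h : IsMonotoneCurve σ J) (hd : finrank ℝ V = 2 * m) :
    ∃ E : Fin m → ℝ → V, (∀ i, ContDiff ℝ ∞ (E i)) ∧ (∀ t, LinearIndependent ℝ fun i => E i t) ∧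
      (∀ t i, E i t ∈ J t) ∧ ∀ t i j, σ (deriv (E i) t) (deriv (E j) t) = 0 := by
  obtain ⟨Δ, -, hlag, hlim⟩ := h.exists_limit
  have hc : ∀ t, IsCompl (J t) Δ := fun t => (hlim t).1.symm
  have hfin : finrank ℝ (J 0) = m := by
    have := (h.lagrangian 0).two_mul_finrank h.symplectic
    omega
  obtain ⟨b, hb⟩ : ∃ b : Fin m → V, LinearIndependent ℝ b ∧ ∀ i, b i ∈ J 0 := by
    obtain ⟨b⟩ : Nonempty (Basis (Fin m) ℝ (J 0)) := ⟨finBasisOfFinrankEq ℝ (J 0) hfin⟩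
    have hb : LinearIndependent ℝ fun i => (b i : V) :=
      b.linearIndependent.map' (J 0).subtype (Submodule.ker_subtype _)
    exact ⟨fun i => (b i : V), hb, fun i => (b i).2⟩
  have hsm : ∀ i, ContDiff ℝ ∞ fun t => projAlong (J t) Δ (b i) := by
    intro i
    rw [contDiff_iff_contDiffAt]
    intro t
    obtain ⟨k, E, hE, hsp, -⟩ := h.frame t
    exact _root_.contDiffAt_projAlong hE hsp (Filter.Eventually.of_forall hc) _
  have hderiv : ∀ t i, deriv (fun t => projAlong (J t) Δ (b i)) t ∈ Δ := fun t i =>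
    deriv_projAlong_mem hlag hc ((hsm i).differentiable (by simp)) t
  refine ⟨fun i t => projAlong (J t) Δ (b i), hsm, fun t => ?_,
    fun t i => projAlong_mem (hc t) _, fun t i j => hlag.apply_eq_zero (hderiv t i) (hderiv t j)⟩
  rw [Fintype.linearIndependent_iff]
  intro c hc0
  have h1 : projAlong (J t) Δ (∑ i, c i • b i) = 0 := by
    rw [map_sum]
    simpa using hc0
  rw [projAlong_eq_zero (hc t)] at h1
  have h2 : ∑ i, c i • b i ∈ J 0 :=
    Submodule.sum_mem _ fun i _ => Submodule.smul_mem _ _ (hb.2 i)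
  have h3 := Submodule.disjoint_def.1 (hc 0).disjoint _ h2 h1
  exact Fintype.linearIndependent_iff.1 hb.1 c h3

/-- Vectors satisfying the Darboux relations are linearly independent. -/
theorem linearIndependent_of_darboux {V : Type*} [AddCommGroup V] [Module ℝ V]
    {σ : V →ₗ[ℝ] V →ₗ[ℝ] ℝ} {e f : Fin m → V}
    (hee : ∀ i j, σ (e i) (e j) = 0) (hff : ∀ i j, σ (f i) (f j) = 0)
    (hfe : ∀ i j, σ (f i) (e j) = if i = j then 1 else 0) :
    LinearIndependent ℝ (Sum.elim e f) := by
  rw [Fintype.linearIndependent_iff]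
  intro c hc
  rw [Fintype.sum_sum_type] at hc
  simp only [Sum.elim_inl, Sum.elim_inr] at hc
  rintro (k | k)
  · have h1 := congrArg (σ (f k)) hc
    simpa [map_sum, hfe, hff] using h1
  · have h1 := congrArg (fun v => σ v (e k)) hc
    simpa [map_sum, hfe, hee] using h1

theorem exists_orthonormal_coordinates {F : Type*} [AddCommGroup F] [Module ℝ F]
    [FiniteDimensional ℝ F] (hF : finrank ℝ F = m) (g : F →ₗ[ℝ] F →ₗ[ℝ] ℝ)
    (hs : ∀ x y, g x y = g y x) (hp : ∀ x, x ≠ 0 → 0 < g x x) :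
    ∃ x : Fin m → F, ∀ k l, g (x k) (x l) = if k = l then 1 else 0 := by
  subst hF
  obtain ⟨v, hv⟩ := LinearMap.BilinForm.exists_orthogonal_basis (B := g) ⟨fun x y => hs x y⟩
  refine ⟨fun k => (Real.sqrt (g (v k) (v k)))⁻¹ • v k, fun k l => ?_⟩
  by_cases hkl : k = l
  · subst hkl
    have h1 := hp (v k) (v.ne_zero k)
    rw [if_pos rfl, map_smul, map_smul, LinearMap.smul_apply, smul_eq_mul, smul_eq_mul]
    have h2 := Real.sqrt_pos.2 h1
    field_simp
    exact (Real.sq_sqrt h1.le).symm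
  · rw [if_neg hkl, map_smul, map_smul, LinearMap.smul_apply, hv hkl]
    simp

/-- Existence of canonical frames. -/
theorem IsMonotoneCurve.exists_canonicalFrame (h : IsMonotoneCurve σ J)
    (hd : finrank ℝ V = 2 * m) :
    ∃ b : ℝ → Basis (Fin m ⊕ Fin m) ℝ V, IsCanonicalFrame σ J b := by
  obtain ⟨E, hE, hli, hmem, hRR⟩ := h.exists_global_frame hd
  set E' : Fin m → ℝ → V := fun i => deriv (E i) with hE'
  have hEd : ∀ i t, HasDerivAt (E i) (E' i t) t := fun i t =>
    ((hE i).differentiable (by simp) t).hasDerivAt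
  have hE's : ∀ i, ContDiff ℝ ∞ (E' i) := fun i => (contDiff_infty_iff_deriv.1 (hE i)).2
  set G : Fin m → Fin m → ℝ → ℝ := fun i j t => σ (E' i t) (E j t) with hG
  have hGs : ∀ i j, ContDiff ℝ ∞ (G i j) := fun i j => contDiff_iff_contDiffAt.2 fun t =>
    ContDiffAt.bilin σ (hE's i).contDiffAt (hE j).contDiffAt
  have hGd : ∀ i j t, HasDerivAt (G i j) (deriv (G i j) t) t := fun i j t =>
    ((hGs i j).differentiable (by simp) t).hasDerivAt
  have hEE : ∀ i j t, σ (E i t) (E j t) = 0 := fun i j t =>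
    (h.lagrangian t).apply_eq_zero (hmem t i) (hmem t j)
  have hEE' : ∀ i j t, σ (E i t) (E' j t) = - G i j t := by
    intro i j t
    have h1 := (hEd i t).bilin σ (hEd j t)
    have h2 : HasDerivAt (fun s => σ (E i s) (E j s)) 0 t :=
      (hasDerivAt_const t (0 : ℝ)).congr_of_eventuallyEq
        (Filter.Eventually.of_forall fun s => hEE i j s)
    have := h1.unique h2
    simp only [hG]
    linarith
  have hGsymm : ∀ i j t, G i j t = G j i t := by
    intro i j t
    have h1 := hEE' i j t
    rw [h.symplectic.skew] at h1
    simp only [hG] at h1 ⊢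
    linarith
  have hG'symm : ∀ i j t, deriv (G i j) t = deriv (G j i) t := by
    intro i j t
    rw [funext (hGsymm i j)]
  -- the quadratic forms on coordinates
  set g : ℝ → (Fin m → ℝ) → (Fin m → ℝ) → ℝ := fun t x y => ∑ i, ∑ j, x i * y j * G i j t with hg
  set g' : ℝ → (Fin m → ℝ) → (Fin m → ℝ) → ℝ := fun t x y =>
    ∑ i, ∑ j, x i * y j * deriv (G i j) t with hg'
  have hgsymm : ∀ t x y, g t x y = g t y x := by
    intro t x y
    simp only [hg]
    rw [Finset.sum_comm]
    refine Finset.sum_congr rfl fun i _ => Finset.sum_congr rfl fun j _ => ?_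
    rw [hGsymm]; ring
  have hg'symm : ∀ t x y, g' t x y = g' t y x := by
    intro t x y
    simp only [hg']
    rw [Finset.sum_comm]
    refine Finset.sum_congr rfl fun i _ => Finset.sum_congr rfl fun j _ => ?_
    rw [hG'symm]; ring
  have hgpos : ∀ t x, x ≠ 0 → 0 < g t x x := by
    intro t x hx
    have h1 : IsCurveIn J t (fun s => ∑ i, x i • E i s) (∑ i, x i • E' i t) :=
      IsCurveIn.sum_smul (fun i => ⟨hEd i t, Filter.Eventually.of_forall fun s => hmem s i⟩) x
    have h2 := h.velocity_pos h1 (fun h0 => hx (funext (Fintype.linearIndependent_iff.1 (hli t) x h0)))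
    rwa [bilin_sum_sum] at h2
  -- the operators of the linear differential equation
  set Lop : (Fin m → Fin m → ℝ) → (Fin m → ℝ) →L[ℝ] (Fin m → ℝ) := fun B => ∑ i, ∑ j,
    B i j • (ContinuousLinearMap.proj (R := ℝ) (φ := fun _ : Fin m => ℝ) i).smulRight
      (Pi.single j (1 : ℝ)) with hLop
  have hLapp : ∀ (B : Fin m → Fin m → ℝ) (x y : Fin m → ℝ), ∑ j, Lop B x j * y j = ∑ i, ∑ j, x i * y j * B i j := by
    intro B x y
    rw [Finset.sum_comm]
    refine Finset.sum_congr rfl fun j _ => ?_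
    simp only [hLop, _root_.sum_apply, _root_.smul_apply,
      ContinuousLinearMap.smulRight_apply, Finset.sum_apply, Pi.smul_apply, smul_eq_mul,
      ContinuousLinearMap.proj_apply, Finset.sum_mul, Pi.single_apply]
    refine Finset.sum_congr rfl fun i _ => ?_
    rw [Finset.sum_eq_single j (fun k _ hk => by simp [hk.symm]) (by simp)]
    simp; ring
  have hLs : ∀ B : ℝ → Fin m → Fin m → ℝ, (∀ i j, ContDiff ℝ ∞ fun t => B t i j) →
      ContDiff ℝ ∞ fun t => Lop (B t) := fun B hB =>
    ContDiff.sum fun i _ => ContDiff.sum fun j _ => (hB i j).smul contDiff_const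
  have hinv : ∀ t, ∃ e : (Fin m → ℝ) ≃L[ℝ] (Fin m → ℝ),
      (e : (Fin m → ℝ) →L[ℝ] (Fin m → ℝ)) = Lop fun i j => G i j t := by
    intro t
    have hinj : Function.Injective (Lop fun i j => G i j t) := by
      rw [injective_iff_map_eq_zero]
      intro x hx
      by_contra hne
      have h1 := hgpos t x hne
      have h2 : ∑ j, Lop (fun i j => G i j t) x j * x j = g t x x := hLapp _ x x
      rw [hx] at h2
      simp at h2
      linarith
    refine ⟨(LinearEquiv.ofInjectiveEndo
      (Lop fun i j => G i j t : (Fin m → ℝ) →ₗ[ℝ] (Fin m → ℝ)) hinj).toContinuousLinearEquiv, ?_⟩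
    ext1 x
    rfl
  -- `N = -½ G⁻¹ G'`. Among the equations `a' = N a` that keep coordinates orthonormal for the
  -- moving inner product `g`, this is the one with `N` self-adjoint for `g`; self-adjointness is
  -- what makes the derivatives of the resulting frame isotropic.
  set N : ℝ → (Fin m → ℝ) →L[ℝ] (Fin m → ℝ) := fun t =>
    (-(1 / 2) : ℝ) • ((Lop fun i j => G i j t).inverse.comp (Lop fun i j => deriv (G i j) t)) with hN
  have hNs : ContDiff ℝ ∞ N := by
    refine ContDiff.const_smul _ (ContDiff.clm_comp ?_ ?_)
    · rw [contDiff_iff_contDiffAt]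
      intro t
      obtain ⟨e, he⟩ := hinv t
      have h1 := contDiffAt_map_inverse (n := ∞) (𝕜 := ℝ) e
      rw [he] at h1
      exact h1.comp t (hLs _ fun i j => hGs i j).contDiffAt
    · exact hLs _ fun i j => (contDiff_infty_iff_deriv.1 (hGs i j)).2
  have hNg : ∀ t x y, g t (N t x) y = -(1 / 2) * g' t x y := by
    intro t x y
    obtain ⟨e, he⟩ := hinv t
    have h1 : g t (N t x) y = ∑ j, Lop (fun i j => G i j t) (N t x) j * y j := (hLapp _ _ _).symm
    have h2 : Lop (fun i j => G i j t) (N t x) = (-(1 / 2) : ℝ) • Lop (fun i j => deriv (G i j) t) x := by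
      simp only [hN, _root_.smul_apply, map_smul, ContinuousLinearMap.comp_apply]
      rw [← he, ContinuousLinearMap.inverse_equiv]
      simp
    rw [h1, h2]
    have h3 := hLapp (fun i j => deriv (G i j) t) x y
    simp only [hg']
    rw [← h3, Finset.mul_sum]
    refine Finset.sum_congr rfl fun j _ => ?_
    simp [mul_assoc]
  -- an orthonormal initial frame
  obtain ⟨x, hx⟩ := exists_orthonormal_coordinates (m := m) (F := Fin m → ℝ) (by simp)
    (LinearMap.mk₂ ℝ (g 0)
      (fun x x' y => by
        simp only [hg, Pi.add_apply, ← Finset.sum_add_distrib]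
        exact Finset.sum_congr rfl fun i _ => Finset.sum_congr rfl fun j _ => by ring)
      (fun c x y => by
        simp only [hg, Pi.smul_apply, smul_eq_mul, Finset.mul_sum]
        exact Finset.sum_congr rfl fun i _ => Finset.sum_congr rfl fun j _ => by ring)
      (fun x y y' => by
        simp only [hg, Pi.add_apply, ← Finset.sum_add_distrib]
        exact Finset.sum_congr rfl fun i _ => Finset.sum_congr rfl fun j _ => by ring)
      (fun c x y => by
        simp only [hg, Pi.smul_apply, smul_eq_mul, Finset.mul_sum]
        exact Finset.sum_congr rfl fun i _ => Finset.sum_congr rfl fun j _ => by ring))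
    (hgsymm 0) (hgpos 0)
  choose a ha0 ha using fun k => exists_solution_linear hNs.continuous (x k)
  have has : ∀ k, ContDiff ℝ ∞ (a k) := fun k => contDiff_of_linear_ode hNs (ha k)
  have hai : ∀ k i t, HasDerivAt (fun s => a k s i) (N t (a k t) i) t := fun k i t =>
    hasDerivAt_pi.1 (ha k t) i
  have hconst : ∀ k l t, g t (a k t) (a l t) = if k = l then 1 else 0 := by
    intro k l t
    have h1 : ∀ t, HasDerivAt (fun t => g t (a k t) (a l t)) 0 t := by
      intro t
      have h2 : HasDerivAt (fun t => g t (a k t) (a l t))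
          (∑ i, ∑ j, ((N t (a k t) i * a l t j + a k t i * N t (a l t) j) * G i j t
            + a k t i * a l t j * deriv (G i j) t)) t :=
        HasDerivAt.fun_sum fun i _ => HasDerivAt.fun_sum fun j _ =>
          ((hai k i t).mul (hai l j t)).mul (hGd i j t)
      convert h2 using 1
      have h3 : ∑ i, ∑ j, ((N t (a k t) i * a l t j + a k t i * N t (a l t) j) * G i j t
            + a k t i * a l t j * deriv (G i j) t)
          = g t (N t (a k t)) (a l t) + g t (a k t) (N t (a l t)) + g' t (a k t) (a l t) := by
        simp only [hg, hg', ← Finset.sum_add_distrib]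
        exact Finset.sum_congr rfl fun i _ => Finset.sum_congr rfl fun j _ => by ring
      rw [h3, hgsymm t (a k t), hNg, hNg, hg'symm t (a l t)]
      ring
    have h2 := is_const_of_deriv_eq_zero (fun t => (h1 t).differentiableAt)
      (fun t => (h1 t).deriv) t 0
    refine h2.trans ?_
    have h3 := hx k l
    rw [← ha0 k, ← ha0 l] at h3
    exact h3
  set e : ℝ → Fin m → V := fun t k => ∑ i, a k t i • E i t with he
  set f : ℝ → Fin m → V := fun t k => ∑ i, N t (a k t) i • E i t + ∑ i, a k t i • E' i t with hf
  have hes : ∀ k, ContDiff ℝ ∞ fun t => e t k := fun k => ContDiff.sum fun i _ =>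
    (contDiff_pi.1 (has k) i).smul (hE i)
  have hed : ∀ k t, HasDerivAt (fun t => e t k) (f t k) t := by
    intro k t
    have h1 : HasDerivAt (fun t => e t k) (∑ i, (a k t i • E' i t + N t (a k t) i • E i t)) t :=
      HasDerivAt.fun_sum fun i _ => (hai k i t).smul (hEd i t)
    convert h1 using 1
    rw [hf, Finset.sum_add_distrib, add_comm]
  have hemem : ∀ t k, e t k ∈ J t := fun t k =>
    Submodule.sum_mem _ fun i _ => Submodule.smul_mem _ _ (hmem t i)
  have hee : ∀ t k l, σ (e t k) (e t l) = 0 := fun t k l =>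
    (h.lagrangian t).apply_eq_zero (hemem t k) (hemem t l)
  have hTT' : ∀ t x y, σ (∑ i, x i • E i t) (∑ j, y j • E' j t) = - g t x y := by
    intro t x y
    rw [bilin_sum_sum]
    simp only [hEE', hg, mul_neg, Finset.sum_neg_distrib]
  have hfe : ∀ t k l, σ (f t k) (e t l) = if k = l then 1 else 0 := by
    intro t k l
    rw [← hconst k l t, hf, he]
    simp only [map_add, LinearMap.add_apply]
    rw [bilin_sum_sum, bilin_sum_sum]
    simp [hEE, hg, hG]
  -- The vectors `E` are isotropic, and so are the `E'` by the choice of the global frame. The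
  -- remaining cross terms are `-g(N a_k, a_l) + g(N a_l, a_k)`, which cancel because `g'` is
  -- symmetric.
  have hff : ∀ t k l, σ (f t k) (f t l) = 0 := by
    intro t k l
    simp only [hf, map_add, LinearMap.add_apply]
    rw [hTT', h.symplectic.skew (∑ i, a k t i • E' i t) (∑ i, N t (a l t) i • E i t), hTT',
      bilin_sum_sum, bilin_sum_sum]
    have h1 : ∀ i j, σ (E' i t) (E' j t) = 0 := hRR t
    simp only [hEE, h1, mul_zero, Finset.sum_const_zero, hNg, hg'symm t (a l t)]
    ring
  have hbli : ∀ t, LinearIndependent ℝ (Sum.elim (e t) (f t)) := fun t =>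
    linearIndependent_of_darboux (hee t) (hff t) (hfe t)
  have hcard : Fintype.card (Fin m ⊕ Fin m) = finrank ℝ V := by
    rw [hd]; simp; ring
  -- The basis with prescribed vectors is constructed for a nonempty index type, so the zero space
  -- is treated apart.
  rcases Nat.eq_zero_or_pos m with hm | hm
  · subst hm
    have hsub : Subsingleton V := finrank_zero_iff.1 (by simpa using hd)
    refine ⟨fun t => Basis.empty V, ?_, ?_, ?_, ?_, ?_, ?_⟩ <;> intros <;> rename Fin 0 => i <;>
      exact i.elim0
  have : Nonempty (Fin m ⊕ Fin m) := ⟨Sum.inl ⟨0, hm⟩⟩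
  have hbc : ∀ t, (basisOfLinearIndependentOfCardEqFinrank (hbli t) hcard : _ → V)
      = Sum.elim (e t) (f t) := fun t => coe_basisOfLinearIndependentOfCardEqFinrank _ _
  refine ⟨fun t => basisOfLinearIndependentOfCardEqFinrank (hbli t) hcard, ?_, ?_, ?_, ?_, ?_, ?_⟩
  · intro k l
    simp only [hbc, Sum.elim_inl]
    exact l.toContinuousLinearMap.contDiff.comp (hes k)
  · intro t k
    simpa only [hbc, Sum.elim_inl] using hemem t k
  · intro t k l
    simp only [hbc, Sum.elim_inl, Sum.elim_inr]
    exact l.toContinuousLinearMap.hasFDerivAt.comp_hasDerivAt t (hed k t)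
  · intro t k l
    simpa only [hbc, Sum.elim_inl] using hee t k l
  · intro t k l
    simpa only [hbc, Sum.elim_inr] using hff t k l
  · intro t k l
    simpa only [hbc, Sum.elim_inl, Sum.elim_inr] using hfe t k l

end CanonicalFrame

/-! ### Coordinatewise calculus agrees with calculus in a norm -/

section WeakCalculus

variable {V : Type*} [NormedAddCommGroup V] [NormedSpace ℝ V] [FiniteDimensional ℝ V]

theorem hasVelocity_iff {u : ℝ → V} {v : V} {t : ℝ} : HasVelocity u v t ↔ HasDerivAt u v t := by
  constructor
  · intro h
    set e := (finBasis ℝ V).equivFun.toContinuousLinearEquiv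
    have h1 : HasDerivAt (fun s => e (u s)) (e v) t := by
      rw [hasDerivAt_pi]
      intro i
      exact h ((finBasis ℝ V).coord i)
    have h2 := e.symm.hasFDerivAt.comp_hasDerivAt t h1
    simpa [Function.comp_def] using h2
  · intro h l
    exact l.toContinuousLinearMap.hasFDerivAt.comp_hasDerivAt t h

theorem contDiffAt_iff_dual {u : ℝ → V} {n : WithTop ℕ∞} {t : ℝ} :
    (∀ l : Dual ℝ V, ContDiffAt ℝ n (fun s => l (u s)) t) ↔ ContDiffAt ℝ n u t := by
  constructor
  · intro h
    set e := (finBasis ℝ V).equivFun.toContinuousLinearEquiv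
    have h1 : ContDiffAt ℝ n (fun s => e (u s)) t := by
      rw [contDiffAt_pi]
      intro i
      exact h ((finBasis ℝ V).coord i)
    have h2 := e.symm.contDiff.contDiffAt.comp t h1
    simpa [Function.comp_def] using h2
  · intro h l
    exact l.toContinuousLinearMap.contDiff.contDiffAt.comp t h

theorem smoothCurve_iff {u : ℝ → V} : SmoothCurve u ↔ ContDiff ℝ ∞ u := by
  simp only [SmoothCurve, contDiff_iff_contDiffAt]
  rw [forall_comm]
  exact forall_congr' fun t => contDiffAt_iff_dual

end WeakCalculus

/-! ### Coordinates in a Darboux basis -/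

section DarbouxBasis

variable {V : Type*} [AddCommGroup V] [Module ℝ V] {σ : V →ₗ[ℝ] V →ₗ[ℝ] ℝ} {m : ℕ}
  {J : ℝ → Submodule ℝ V} {b : ℝ → Basis (Fin m ⊕ Fin m) ℝ V}

theorem IsCanonicalFrame.repr_inl (hb : IsCanonicalFrame σ J b) (t : ℝ) (w : V) (k : Fin m) :
    (b t).repr w (Sum.inl k) = σ (b t (Sum.inr k)) w := by
  conv_rhs => rw [← (b t).sum_repr w]
  rw [Fintype.sum_sum_type]
  simp [map_sum, hb.form_f_e, hb.form_f_f]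

theorem IsCanonicalFrame.repr_inr (hσ : IsSymplecticBilin σ) (hb : IsCanonicalFrame σ J b) (t : ℝ)
    (w : V) (k : Fin m) : (b t).repr w (Sum.inr k) = σ w (b t (Sum.inl k)) := by
  rw [hσ.skew]
  conv_rhs => rw [← (b t).sum_repr w]
  have h : ∀ i j, σ (b t (Sum.inl i)) (b t (Sum.inr j)) = - if j = i then 1 else 0 := fun i j => by
    rw [hσ.skew, hb.form_f_e]
  rw [Fintype.sum_sum_type]
  simp [map_sum, hb.form_e_e, h]

theorem IsCanonicalFrame.expand (hσ : IsSymplecticBilin σ) (hb : IsCanonicalFrame σ J b) (t : ℝ)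
    (w : V) : w = ∑ k, σ (b t (Sum.inr k)) w • b t (Sum.inl k)
      + ∑ k, σ w (b t (Sum.inl k)) • b t (Sum.inr k) := by
  conv_lhs => rw [← (b t).sum_repr w]
  rw [Fintype.sum_sum_type]
  simp only [hb.repr_inl, hb.repr_inr hσ]

theorem abs_repr_le_basisNorm {ι : Type*} [Fintype ι] (b : Basis ι ℝ V) (w : V) (k : ι) :
    |b.repr w k| ≤ basisNorm b w :=
  Real.abs_le_sqrt (Finset.single_le_sum (f := fun k => (b.repr w k) ^ 2)
    (fun _ _ => sq_nonneg _) (Finset.mem_univ k))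

theorem basisNorm_le_sum {ι : Type*} [Fintype ι] (b : Basis ι ℝ V) (w : V) :
    basisNorm b w ≤ ∑ k, |b.repr w k| := by
  refine Real.sqrt_le_iff.2 ⟨Finset.sum_nonneg fun i _ => abs_nonneg _, ?_⟩
  have := Finset.sum_sq_le_sq_sum_of_nonneg (s := Finset.univ) (f := fun k => |b.repr w k|)
    fun i _ => abs_nonneg _
  simpa using this

theorem basisNorm_nonneg {ι : Type*} [Fintype ι] (b : Basis ι ℝ V) (w : V) : 0 ≤ basisNorm b w :=
  Real.sqrt_nonneg _

end DarbouxBasis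

/-! ### Quantitative comparison of a canonical frame with an arbitrary moving frame -/

section FrameComparison

variable {V : Type*} [NormedAddCommGroup V] [NormedSpace ℝ V] [FiniteDimensional ℝ V]
  {σ : V →ₗ[ℝ] V →ₗ[ℝ] ℝ} {J : ℝ → Submodule ℝ V} {m : ℕ}
  {b : ℝ → Basis (Fin m ⊕ Fin m) ℝ V} {E E' : Fin m → ℝ → V} {E'' : Fin m → V}

/-- A canonical frame at time `0` in terms of another moving frame of the curve. -/
theorem IsMonotoneCurve.exists_coefficients (h : IsMonotoneCurve σ J) (hb : IsCanonicalFrame σ J b)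
    (hE : ∀ᶠ s in 𝓝 (0 : ℝ), ∀ i, HasDerivAt (E i) (E' i s) s)
    (hE' : ∀ i, HasDerivAt (E' i) (E'' i) 0) (hmem : ∀ᶠ s in 𝓝 (0 : ℝ), ∀ i, E i s ∈ J s)
    (hsp : J 0 ≤ Submodule.span ℝ (Set.range fun i => E i 0)) (k : Fin m) :
    ∃ A B : Fin m → ℝ, b 0 (Sum.inl k) = ∑ j, A j • E j 0 ∧
      b 0 (Sum.inr k) = ∑ j, A j • E' j 0 + ∑ j, B j • E j 0 ∧
      ∀ j, 2 * σ (b 0 (Sum.inr k)) (E' j 0) = - σ (b 0 (Sum.inl k)) (E'' j) := by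
  have hed : ∀ t l, HasDerivAt (fun s => b s (Sum.inl l)) (b t (Sum.inr l)) t := fun t l =>
    hasVelocity_iff.1 (hb.velocity t l)
  have hes : ∀ l, ContDiff ℝ ∞ fun s => b s (Sum.inl l) := fun l => smoothCurve_iff.1 (hb.smooth l)
  have hfd : ∀ l, HasDerivAt (fun s => b s (Sum.inr l)) (deriv (fun s => b s (Sum.inr l)) 0) 0 := by
    intro l
    have h1 : (fun s => b s (Sum.inr l)) = deriv fun s => b s (Sum.inl l) :=
      funext fun t => (hed t l).deriv.symm
    rw [h1]
    exact (((contDiff_infty_iff_deriv.1 (hes l)).2).differentiable (by simp) 0).hasDerivAt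
  have hcE : ∀ i, IsCurveIn J 0 (E i) (E' i 0) := fun i =>
    ⟨hE.self_of_nhds i, hmem.mono fun s hs => hs i⟩
  have hce : ∀ l, IsCurveIn J 0 (fun s => b s (Sum.inl l)) (b 0 (Sum.inr l)) := fun l =>
    ⟨hed 0 l, Filter.Eventually.of_forall fun s => hb.mem s l⟩
  obtain ⟨A, hA⟩ := (Submodule.mem_span_range_iff_exists_fun ℝ).1 (hsp (hb.mem 0 k))
  have h1 := h.deriv_mem ((hce k).sub (IsCurveIn.sum_smul hcE A)) (by simp [hA])
  obtain ⟨B, hB⟩ := (Submodule.mem_span_range_iff_exists_fun ℝ).1 (hsp h1)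
  refine ⟨A, B, hA.symm, by rw [hB]; abel, fun j => ?_⟩
  -- the derivative of `fᵏ` lies in `J 0`
  have hfe : ∀ l, σ (deriv (fun s => b s (Sum.inr k)) 0) (b 0 (Sum.inl l)) = 0 := by
    intro l
    have h2 := (hfd k).bilin σ (hed 0 l)
    rw [hb.form_f_f, add_zero] at h2
    exact h2.unique ((hasDerivAt_const 0 _).congr_of_eventuallyEq
      (Filter.Eventually.of_forall fun s => hb.form_f_e s k l))
  have hfE : σ (deriv (fun s => b s (Sum.inr k)) 0) (E j 0) = 0 := by
    have h2 : ∀ l, σ (E j 0) (b 0 (Sum.inl l)) = 0 := fun l =>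
      (h.lagrangian 0).apply_eq_zero (hcE j).mem (hb.mem 0 l)
    rw [hb.expand h.symplectic 0 (E j 0)]
    simp [map_sum, h2, hfe]
  -- The first derivative of `σ (e s) (E j s) = 0`. The second derivative at `0` contains the mixed
  -- term twice, and its term with the derivative of `fᵏ` vanishes by `hfE`.
  have h3 : ∀ᶠ s in 𝓝 (0 : ℝ),
      σ (b s (Sum.inr k)) (E j s) + σ (b s (Sum.inl k)) (E' j s) = 0 := by
    filter_upwards [hE, hmem.eventually_nhds] with s hs hs'
    refine ((hed s k).bilin σ (hs j)).unique ((hasDerivAt_const s (0 : ℝ)).congr_of_eventuallyEq ?_)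
    filter_upwards [hs'] with r hr
    exact (h.lagrangian r).apply_eq_zero (hb.mem r k) (hr j)
  have h4 := ((hfd k).bilin σ (hE.self_of_nhds j)).add ((hed 0 k).bilin σ (hE' j))
  have h5 := h4.unique ((hasDerivAt_const 0 (0 : ℝ)).congr_of_eventuallyEq h3)
  rw [hfE] at h5
  linarith

/-- The constant in the comparison of the canonical norm with the coordinates in a moving frame. -/
noncomputable def frameConst (m : ℕ) (c B : ℝ) : ℝ :=
  1 + (2 * m + 4 * m ^ 3 * B) * ((1 + 1 / c) + m * (2 * m * (1 + 1 / c) * B) / c)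

theorem abs_sum_mul_le {m : ℕ} {x y : Fin m → ℝ} {a c : ℝ} (hx : ∀ i, |x i| ≤ a)
    (hy : ∀ i, |y i| ≤ c) : |∑ i, x i * y i| ≤ m * (a * c) := by
  calc |∑ i, x i * y i| ≤ ∑ i, |x i * y i| := Finset.abs_sum_le_sum_abs _ _
    _ ≤ ∑ _i : Fin m, a * c := Finset.sum_le_sum fun i _ => by
        rw [abs_mul]
        exact mul_le_mul (hx i) (hy i) (abs_nonneg _) ((abs_nonneg _).trans (hx i))
    _ = m * (a * c) := by simp

/-- The normalisation `σ(fᵏ, eᵏ) = 1` and the ellipticity constant `c` bound `A`. The second-order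
identity of `exists_coefficients` bounds the image of `B` under the Gram matrix, and ellipticity
again bounds `B`. So two derivatives of the moving frame control the canonical frame. -/
theorem IsMonotoneCurve.exists_bounded_coefficients (h : IsMonotoneCurve σ J)
    (hb : IsCanonicalFrame σ J b)
    (hE : ∀ᶠ s in 𝓝 (0 : ℝ), ∀ i, HasDerivAt (E i) (E' i s) s)
    (hE' : ∀ i, HasDerivAt (E' i) (E'' i) 0) (hmem : ∀ᶠ s in 𝓝 (0 : ℝ), ∀ i, E i s ∈ J s)
    (hsp : J 0 ≤ Submodule.span ℝ (Set.range fun i => E i 0)) {c B₀ : ℝ} (hc : 0 < c)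
    (hell : ∀ x : Fin m → ℝ, c * ∑ i, x i ^ 2 ≤ ∑ i, ∑ j, x i * x j * σ (E' i 0) (E j 0))
    (hB2 : ∀ i j, |σ (E' i 0) (E' j 0)| ≤ B₀)
    (hB3 : ∀ i j, |σ (E'' i) (E j 0)| ≤ B₀) (k : Fin m) :
    ∃ A B : Fin m → ℝ, b 0 (Sum.inl k) = ∑ j, A j • E j 0 ∧
      b 0 (Sum.inr k) = ∑ j, A j • E' j 0 + ∑ j, B j • E j 0 ∧
      (∀ j, |A j| ≤ 1 + 1 / c) ∧ ∀ j, |B j| ≤ m * (2 * m * (1 + 1 / c) * B₀) / c := by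
  obtain ⟨A, B, hA, hB, hS⟩ := h.exists_coefficients hb hE hE' hmem hsp k
  have hm0 := hmem.self_of_nhds
  have hEE : ∀ i j, σ (E i 0) (E j 0) = 0 := fun i j =>
    (h.lagrangian 0).apply_eq_zero (hm0 i) (hm0 j)
  have hB0 : 0 ≤ B₀ := (abs_nonneg _).trans (hB2 k k)
  have hinv : 0 < 1 / c := by positivity
  have hAb : ∀ j, |A j| ≤ 1 + 1 / c := by
    intro j
    have h1 : σ (b 0 (Sum.inr k)) (b 0 (Sum.inl k)) = 1 := by rw [hb.form_f_e]; simp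
    rw [hB, hA, map_add, LinearMap.add_apply, bilin_sum_sum, bilin_sum_sum] at h1
    simp only [hEE, mul_zero, Finset.sum_const_zero, add_zero] at h1
    have h2 := hell A
    rw [h1] at h2
    have h3 : A j ^ 2 ≤ ∑ i, A i ^ 2 :=
      Finset.single_le_sum (f := fun i => A i ^ 2) (fun i _ => sq_nonneg _) (Finset.mem_univ j)
    have h4 : A j ^ 2 ≤ 1 / c := by
      rw [le_div_iff₀ hc]
      nlinarith
    refine abs_le_of_sq_le_sq ?_ (by positivity)
    nlinarith
  refine ⟨A, B, hA, hB, hAb, fun j => ?_⟩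
  set R := 2 * m * (1 + 1 / c) * B₀ with hR
  have hR0 : 0 ≤ R := by positivity
  -- One summand contributes `m (1 + 1 / c) B₀` and the other half of that; `R` rounds the factor
  -- `3/2` up to `2`.
  have hr : ∀ j, |∑ i, B i * σ (E i 0) (E' j 0)| ≤ R := by
    intro j
    have h1 : σ (b 0 (Sum.inr k)) (E' j 0) = ∑ i, A i * σ (E' i 0) (E' j 0)
        + ∑ i, B i * σ (E i 0) (E' j 0) := by
      rw [hB]
      simp [map_sum]
    have h2 : σ (b 0 (Sum.inl k)) (E'' j) = ∑ i, A i * σ (E i 0) (E'' j) := by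
      rw [hA]
      simp [map_sum]
    have h3 := hS j
    rw [h2, h1] at h3
    have h4 := abs_sum_mul_le hAb fun i => hB2 i j
    have h5 := abs_sum_mul_le hAb (y := fun i => σ (E i 0) (E'' j)) (c := B₀) fun i => by
      rw [h.symplectic.skew, abs_neg]
      exact hB3 j i
    rw [abs_le] at h4 h5 ⊢
    constructor <;> nlinarith
  have hq : c * ∑ i, B i ^ 2 ≤ R * ∑ i, |B i| := by
    refine (hell B).trans ?_
    have h1 : ∑ i, ∑ j, B i * B j * σ (E' i 0) (E j 0)
        = ∑ i, B i * -∑ j, B j * σ (E j 0) (E' i 0) := by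
      refine Finset.sum_congr rfl fun i _ => ?_
      rw [← Finset.sum_neg_distrib, Finset.mul_sum]
      refine Finset.sum_congr rfl fun j _ => ?_
      rw [h.symplectic.skew (E j 0)]
      ring
    rw [h1, Finset.mul_sum]
    refine Finset.sum_le_sum fun i _ => ?_
    refine (le_abs_self _).trans ?_
    rw [abs_mul, abs_neg, mul_comm]
    exact mul_le_mul_of_nonneg_right (hr i) (abs_nonneg _)
  have hcs : (∑ i, |B i|) ^ 2 ≤ m * ∑ i, B i ^ 2 := by
    have := sq_sum_le_card_mul_sum_sq (s := Finset.univ) (f := fun i => |B i|)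
    simpa using this
  have hjs : |B j| ≤ ∑ i, |B i| :=
    Finset.single_le_sum (f := fun i => |B i|) (fun i _ => abs_nonneg _) (Finset.mem_univ j)
  set S := ∑ i, |B i| with hSdef
  have hS0 : 0 ≤ S := Finset.sum_nonneg fun i _ => abs_nonneg _
  refine hjs.trans ?_
  rw [le_div_iff₀ hc]
  rcases hS0.eq_or_lt with h0 | h0
  · rw [← h0, zero_mul]; positivity
  · have h1 : c * S ^ 2 ≤ m * (R * S) := by
      calc c * S ^ 2 ≤ c * (m * ∑ i, B i ^ 2) := mul_le_mul_of_nonneg_left hcs hc.le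
        _ = m * (c * ∑ i, B i ^ 2) := by ring
        _ ≤ m * (R * S) := mul_le_mul_of_nonneg_left hq (Nat.cast_nonneg m)
    have h2 : (S * c) * S ≤ (m * R) * S := by nlinarith
    exact le_of_mul_le_mul_right h2 h0

/-- The canonical norm is comparable, with explicit constants, to the coordinates in, and the
pairings with, a moving frame. -/
theorem IsMonotoneCurve.basisNorm_comparison (h : IsMonotoneCurve σ J)
    (hb : IsCanonicalFrame σ J b)
    (hE : ∀ᶠ s in 𝓝 (0 : ℝ), ∀ i, HasDerivAt (E i) (E' i s) s)
    (hE' : ∀ i, HasDerivAt (E' i) (E'' i) 0) (hmem : ∀ᶠ s in 𝓝 (0 : ℝ), ∀ i, E i s ∈ J s)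
    (hsp : J 0 ≤ Submodule.span ℝ (Set.range fun i => E i 0)) {c B₀ : ℝ} (hc : 0 < c)
    (hB0 : 0 ≤ B₀)
    (hell : ∀ x : Fin m → ℝ, c * ∑ i, x i ^ 2 ≤ ∑ i, ∑ j, x i * x j * σ (E' i 0) (E j 0))
    (hB1 : ∀ i j, |σ (E' i 0) (E j 0)| ≤ B₀) (hB2 : ∀ i j, |σ (E' i 0) (E' j 0)| ≤ B₀)
    (hB3 : ∀ i j, |σ (E'' i) (E j 0)| ≤ B₀) (w : V) :
    basisNorm (b 0) w ≤ frameConst m c B₀ * ∑ j, (|σ w (E j 0)| + |σ w (E' j 0)|) ∧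
    ∑ j, (|σ w (E j 0)| + |σ w (E' j 0)|) ≤ frameConst m c B₀ * basisNorm (b 0) w ∧
    ∃ x y : Fin m → ℝ, w = ∑ j, x j • E j 0 + ∑ j, y j • E' j 0 ∧
      ∀ j, |x j| ≤ frameConst m c B₀ * basisNorm (b 0) w ∧
        |y j| ≤ frameConst m c B₀ * basisNorm (b 0) w := by
  choose A B hA hB hAb hBb using
    h.exists_bounded_coefficients hb hE hE' hmem hsp hc hell hB2 hB3
  set K := (1 + 1 / c) + m * (2 * m * (1 + 1 / c) * B₀) / c with hK
  have hinv : 0 < 1 / c := by positivity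
  have hK2 : 0 ≤ m * (2 * m * (1 + 1 / c) * B₀) / c := by positivity
  have hK0 : 0 ≤ K := by positivity
  replace hAb : ∀ k j, |A k j| ≤ K := fun k j => (hAb k j).trans (by linarith)
  replace hBb : ∀ k j, |B k j| ≤ K := fun k j => (hBb k j).trans (by linarith)
  -- `frameConst` contains both constants that occur: `2 m K` for the upper estimate of the norm and
  -- the coordinates, and `4 m³ B₀ K` for the estimate of the pairings by the norm.
  have hC1 : 2 * m * K ≤ frameConst m c B₀ := by
    have : 0 ≤ 4 * (m : ℝ) ^ 3 * B₀ * K := by positivity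
    rw [frameConst, ← hK]
    nlinarith
  have hC2 : 4 * m ^ 3 * B₀ * K ≤ frameConst m c B₀ := by
    have : 0 ≤ 2 * (m : ℝ) * K := by positivity
    rw [frameConst, ← hK]
    nlinarith
  have hm0 := hmem.self_of_nhds
  have hEE : ∀ i j, σ (E i 0) (E j 0) = 0 := fun i j =>
    (h.lagrangian 0).apply_eq_zero (hm0 i) (hm0 j)
  set N := basisNorm (b 0) w with hN
  have hN0 : 0 ≤ N := basisNorm_nonneg _ _
  have hα : ∀ k, |σ (b 0 (Sum.inr k)) w| ≤ N := fun k => by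
    have := abs_repr_le_basisNorm (b 0) w (Sum.inl k)
    rwa [hb.repr_inl] at this
  have hβ : ∀ k, |σ w (b 0 (Sum.inl k))| ≤ N := fun k => by
    have := abs_repr_le_basisNorm (b 0) w (Sum.inr k)
    rwa [hb.repr_inr h.symplectic] at this
  set P := ∑ j, (|σ w (E j 0)| + |σ w (E' j 0)|) with hP
  have hP0 : 0 ≤ P := Finset.sum_nonneg fun j _ => by positivity
  refine ⟨?_, ?_, ?_⟩
  · have h1 : ∀ k, |σ w (b 0 (Sum.inl k))| ≤ K * ∑ j, |σ w (E j 0)| := by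
      intro k
      rw [hA k, map_sum, Finset.mul_sum]
      refine (Finset.abs_sum_le_sum_abs _ _).trans (Finset.sum_le_sum fun j _ => ?_)
      rw [map_smul, smul_eq_mul, abs_mul]
      exact mul_le_mul_of_nonneg_right (hAb k j) (abs_nonneg _)
    have h2 : ∀ k, |σ (b 0 (Sum.inr k)) w| ≤ K * P := by
      intro k
      rw [h.symplectic.skew, abs_neg, hB k, map_add, map_sum, map_sum, ← Finset.sum_add_distrib, hP,
        Finset.mul_sum]
      refine (Finset.abs_sum_le_sum_abs _ _).trans (Finset.sum_le_sum fun j _ => ?_)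
      rw [map_smul, map_smul, smul_eq_mul, smul_eq_mul]
      refine (abs_add_le _ _).trans ?_
      rw [abs_mul, abs_mul]
      have h3 := mul_le_mul_of_nonneg_right (hAb k j) (abs_nonneg (σ w (E' j 0)))
      have h4 := mul_le_mul_of_nonneg_right (hBb k j) (abs_nonneg (σ w (E j 0)))
      linarith
    have h3 : ∑ j, |σ w (E j 0)| ≤ P := Finset.sum_le_sum fun j _ => by
      linarith [abs_nonneg (σ w (E' j 0))]
    calc N ≤ ∑ k, |(b 0).repr w k| := basisNorm_le_sum _ _
      _ = ∑ k, |σ (b 0 (Sum.inr k)) w| + ∑ k, |σ w (b 0 (Sum.inl k))| := by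
          rw [Fintype.sum_sum_type]
          simp only [hb.repr_inl, hb.repr_inr h.symplectic]
      _ ≤ ∑ _k : Fin m, K * P + ∑ _k : Fin m, K * P := by
          refine add_le_add (Finset.sum_le_sum fun k _ => h2 k) (Finset.sum_le_sum fun k _ => ?_)
          exact (h1 k).trans (mul_le_mul_of_nonneg_left h3 hK0)
      _ = 2 * m * K * P := by simp; ring
      _ ≤ frameConst m c B₀ * P := mul_le_mul_of_nonneg_right hC1 hP0
  · have hfE : ∀ k j, |σ (b 0 (Sum.inr k)) (E j 0)| ≤ m * (K * B₀) := by
      intro k j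
      rw [hB k]
      have h1 : σ (∑ i, A k i • E' i 0 + ∑ i, B k i • E i 0) (E j 0)
          = ∑ i, A k i * σ (E' i 0) (E j 0) := by simp [map_sum, hEE]
      rw [h1]
      exact abs_sum_mul_le (hAb k) fun i => hB1 i j
    have heE' : ∀ k j, |σ (b 0 (Sum.inl k)) (E' j 0)| ≤ m * (K * B₀) := by
      intro k j
      rw [hA k]
      have h1 : σ (∑ i, A k i • E i 0) (E' j 0) = ∑ i, A k i * σ (E i 0) (E' j 0) := by
        simp [map_sum]
      rw [h1]
      refine abs_sum_mul_le (hAb k) fun i => ?_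
      rw [h.symplectic.skew, abs_neg]
      exact hB1 j i
    have hfE' : ∀ k j, |σ (b 0 (Sum.inr k)) (E' j 0)| ≤ 2 * (m * (K * B₀)) := by
      intro k j
      rw [hB k]
      have h1 : σ (∑ i, A k i • E' i 0 + ∑ i, B k i • E i 0) (E' j 0)
          = ∑ i, A k i * σ (E' i 0) (E' j 0) + ∑ i, B k i * σ (E i 0) (E' j 0) := by
        simp [map_sum]
      rw [h1]
      have h2 := abs_sum_mul_le (hAb k) fun i => hB2 i j
      have h3 := abs_sum_mul_le (hBb k) (y := fun i => σ (E i 0) (E' j 0)) (c := B₀) fun i => by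
        rw [h.symplectic.skew, abs_neg]
        exact hB1 j i
      exact (abs_add_le _ _).trans (by linarith)
    have hexp := hb.expand h.symplectic 0 w
    have hp : ∀ j, |σ w (E j 0)| ≤ m * (N * (m * (K * B₀))) := by
      intro j
      have h1 : σ w (E j 0) = ∑ k, σ w (b 0 (Sum.inl k)) * σ (b 0 (Sum.inr k)) (E j 0) := by
        have h2 : ∀ k, σ (b 0 (Sum.inl k)) (E j 0) = 0 := fun k =>
          (h.lagrangian 0).apply_eq_zero (hb.mem 0 k) (hm0 j)
        conv_lhs => rw [hexp]
        simp [map_sum, h2]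
      rw [h1]
      exact abs_sum_mul_le hβ fun k => hfE k j
    have hr : ∀ j, |σ w (E' j 0)| ≤ m * (N * (m * (K * B₀))) + m * (N * (2 * (m * (K * B₀)))) := by
      intro j
      have h1 : σ w (E' j 0) = ∑ k, σ (b 0 (Sum.inr k)) w * σ (b 0 (Sum.inl k)) (E' j 0)
          + ∑ k, σ w (b 0 (Sum.inl k)) * σ (b 0 (Sum.inr k)) (E' j 0) := by
        conv_lhs => rw [hexp]
        simp [map_sum]
      rw [h1]
      exact (abs_add_le _ _).trans (add_le_add (abs_sum_mul_le hα fun k => heE' k j)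
        (abs_sum_mul_le hβ fun k => hfE' k j))
    calc P ≤ ∑ _j : Fin m, 4 * (m * (N * (m * (K * B₀)))) := by
          refine Finset.sum_le_sum fun j _ => ?_
          have h1 := hp j
          have h2 := hr j
          linarith
      _ = 4 * m ^ 3 * B₀ * K * N := by simp; ring
      _ ≤ frameConst m c B₀ * N := mul_le_mul_of_nonneg_right hC2 hN0
  · refine ⟨fun j => ∑ k, σ (b 0 (Sum.inr k)) w * A k j + ∑ k, σ w (b 0 (Sum.inl k)) * B k j,
      fun j => ∑ k, σ w (b 0 (Sum.inl k)) * A k j, ?_, fun j => ⟨?_, ?_⟩⟩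
    · conv_lhs => rw [hb.expand h.symplectic 0 w]
      simp only [hA, hB, smul_add, Finset.smul_sum, smul_smul, add_smul, Finset.sum_smul,
        Finset.sum_add_distrib]
      rw [Finset.sum_comm, Finset.sum_comm (f := fun i j => (_ * A i j) • E' j 0),
        Finset.sum_comm (f := fun i j => (_ * B i j) • E j 0)]
      abel
    · have h1 := abs_sum_mul_le hα fun k => hAb k j
      have h2 := abs_sum_mul_le hβ fun k => hBb k j
      refine (abs_add_le _ _).trans ?_
      have h3 := mul_le_mul_of_nonneg_right hC1 hN0
      linarith
    · have h2 := abs_sum_mul_le hβ fun k => hAb k j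
      have h3 := mul_le_mul_of_nonneg_right hC1 hN0
      have h4 : 0 ≤ m * (N * K) := by positivity
      linarith

end FrameComparison

/-! ### Monotone curves in spaces without a norm -/

section MonotoneFamily

/-- `J` is a smooth monotone curve of pairwise transversal Lagrangian subspaces of the symplectic
vector space `(V, σ)` (which does not carry a norm). -/
structure IsMonotoneFamily {V : Type*} [AddCommGroup V] [Module ℝ V]
    (σ : V →ₗ[ℝ] V →ₗ[ℝ] ℝ) (J : ℝ → Submodule ℝ V) : Prop where
  symplectic : IsSymplecticBilin σ
  lagrangian : ∀ t, IsLagrangianSubspace σ (J t)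
  frame : ∀ t₀, ∃ (m : ℕ) (E : Fin m → ℝ → V) (E' : Fin m → V),
    (∀ i (l : Dual ℝ V), ContDiffAt ℝ ∞ (fun t => l (E i t)) t₀) ∧
    (∀ i, HasVelocity (E i) (E' i) t₀) ∧
    (∀ᶠ t in 𝓝 t₀, LinearIndependent ℝ (fun i => E i t) ∧
      Submodule.span ℝ (Set.range fun i => E i t) = J t) ∧
    ∀ c : Fin m → ℝ, c ≠ 0 → 0 < σ (∑ i, c i • E' i) (∑ i, c i • E i t₀)
  transversal : ∀ s t, s ≠ t → J s ⊓ J t = ⊥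

/-- The curve `e` of vectors lies in the curve `J` of subspaces near the time `t`, where it has the
velocity `e'`. -/
def IsVelocityIn {V : Type*} [AddCommGroup V] [Module ℝ V] (J : ℝ → Submodule ℝ V) (t : ℝ)
    (e : ℝ → V) (e' : V) : Prop :=
  HasVelocity e e' t ∧ ∀ᶠ s in 𝓝 t, e s ∈ J s

theorem isVelocityIn_iff {V : Type*} [NormedAddCommGroup V] [NormedSpace ℝ V]
    [FiniteDimensional ℝ V] {J : ℝ → Submodule ℝ V} {t : ℝ} {e : ℝ → V} {e' : V} :
    IsVelocityIn J t e e' ↔ IsCurveIn J t e e' :=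
  and_congr hasVelocity_iff Iff.rfl

theorem IsMonotoneFamily.isMonotoneCurve {V : Type*} [NormedAddCommGroup V] [NormedSpace ℝ V]
    [FiniteDimensional ℝ V] {σ : V →ₗ[ℝ] V →ₗ[ℝ] ℝ} {J : ℝ → Submodule ℝ V}
    (h : IsMonotoneFamily σ J) : IsMonotoneCurve σ J where
  symplectic := h.symplectic
  lagrangian := h.lagrangian
  frame t₀ := by
    obtain ⟨m, E, E', h1, h2, h3, h4⟩ := h.frame t₀
    refine ⟨m, E, fun i => contDiffAt_iff_dual.1 (h1 i), h3, fun c hc => ?_⟩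
    simp only [(hasVelocity_iff.1 (h2 _)).deriv]
    exact h4 c hc
  transversal := h.transversal

namespace IsMonotoneFamily

variable {V : Type*} [AddCommGroup V] [Module ℝ V] {σ : V →ₗ[ℝ] V →ₗ[ℝ] ℝ}
  {J : ℝ → Submodule ℝ V}

theorem reverse (h : IsMonotoneFamily σ J) : IsMonotoneFamily (-σ) (fun t => J (-t)) where
  symplectic := h.symplectic.neg
  lagrangian t := (h.lagrangian (-t)).neg
  frame t₀ := by
    obtain ⟨m, E, E', h1, h2, h3, h4⟩ := h.frame (-t₀)
    refine ⟨m, fun i t => E i (-t), fun i => -E' i, fun i l => ?_, fun i l => ?_, ?_, fun c hc => ?_⟩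
    · exact (h1 i l).comp t₀ contDiff_neg.contDiffAt
    · have := HasDerivAt.scomp t₀ (h2 i l) (hasDerivAt_neg t₀)
      simpa [Function.comp_def] using this
    · exact (continuous_neg.tendsto t₀).eventually h3
    · simpa using h4 c hc
  transversal s t hst := h.transversal (-s) (-t) (by simpa using hst)

variable [FiniteDimensional ℝ V]

theorem exists_canonicalFrame (h : IsMonotoneFamily σ J) {m : ℕ} (hd : finrank ℝ V = 2 * m) :
    ∃ b : ℝ → Basis (Fin m ⊕ Fin m) ℝ V, IsCanonicalFrame σ J b := by
  -- The assertion does not mention a norm, since velocities and smoothness are tested by linear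
  -- functionals. Any norm may therefore be introduced for the proof; the one induced by coordinates
  -- is used here and below.
  let _ : NormedAddCommGroup V := NormedAddCommGroup.induced V (Fin (finrank ℝ V) → ℝ)
    (finBasis ℝ V).equivFun (finBasis ℝ V).equivFun.injective
  let _ : NormedSpace ℝ V := NormedSpace.induced ℝ V (Fin (finrank ℝ V) → ℝ) (finBasis ℝ V).equivFun
  exact h.isMonotoneCurve.exists_canonicalFrame hd

theorem limit_atTop (h : IsMonotoneFamily σ J) :
    SubspaceTendsto J Filter.atTop (limSubspace J Filter.atTop) ∧
      IsLagrangianSubspace σ (limSubspace J Filter.atTop) ∧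
      ∀ s, IsCompl (limSubspace J Filter.atTop) (J s) := by
  let _ : NormedAddCommGroup V := NormedAddCommGroup.induced V (Fin (finrank ℝ V) → ℝ)
    (finBasis ℝ V).equivFun (finBasis ℝ V).equivFun.injective
  let _ : NormedSpace ℝ V := NormedSpace.induced ℝ V (Fin (finrank ℝ V) → ℝ) (finBasis ℝ V).equivFun
  obtain ⟨h1, h2, h3⟩ := h.isMonotoneCurve.limit_spec
  exact ⟨h1, h2, fun s => (h3 s).1⟩

theorem mem_limSubspace_atTop (h : IsMonotoneFamily σ J) {w : V} {t₀ C : ℝ}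
    (hw : ∀ t ≥ t₀, ∀ e e', IsVelocityIn J t e e' → σ w (e t) ^ 2 ≤ C * σ e' (e t)) :
    w ∈ limSubspace J Filter.atTop := by
  let _ : NormedAddCommGroup V := NormedAddCommGroup.induced V (Fin (finrank ℝ V) → ℝ)
    (finBasis ℝ V).equivFun (finBasis ℝ V).equivFun.injective
  let _ : NormedSpace ℝ V := NormedSpace.induced ℝ V (Fin (finrank ℝ V) → ℝ) (finBasis ℝ V).equivFun
  exact h.isMonotoneCurve.mem_limSubspace fun t ht e e' he => hw t ht e e' (isVelocityIn_iff.2 he)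

theorem limSubspace_reverse (h : IsMonotoneFamily σ J) :
    limSubspace (fun t => J (-t)) Filter.atTop = limSubspace J Filter.atBot := by
  let _ : NormedAddCommGroup V := NormedAddCommGroup.induced V (Fin (finrank ℝ V) → ℝ)
    (finBasis ℝ V).equivFun (finBasis ℝ V).equivFun.injective
  let _ : NormedSpace ℝ V := NormedSpace.induced ℝ V (Fin (finrank ℝ V) → ℝ) (finBasis ℝ V).equivFun
  exact h.isMonotoneCurve.limSubspace_reverse

theorem limit_atBot (h : IsMonotoneFamily σ J) :
    SubspaceTendsto J Filter.atBot (limSubspace J Filter.atBot) ∧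
      IsLagrangianSubspace σ (limSubspace J Filter.atBot) ∧
      ∀ s, IsCompl (limSubspace J Filter.atBot) (J s) := by
  obtain ⟨h1, h2, h3⟩ := h.reverse.limit_atTop
  rw [h.limSubspace_reverse] at h1 h2 h3
  refine ⟨?_, fun u => by simpa using h2.neg u, fun s => by simpa using h3 (-s)⟩
  let _ : NormedAddCommGroup V := NormedAddCommGroup.induced V (Fin (finrank ℝ V) → ℝ)
    (finBasis ℝ V).equivFun (finBasis ℝ V).equivFun.injective
  let _ : NormedSpace ℝ V := NormedSpace.induced ℝ V (Fin (finrank ℝ V) → ℝ) (finBasis ℝ V).equivFun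
  exact subspaceTendsto_neg_iff.1 h1

theorem isVelocityIn_neg {t : ℝ} {e : ℝ → V} {e' : V}
    (he : IsVelocityIn (fun t => J (-t)) t e e') : IsVelocityIn J (-t) (fun s => e (-s)) (-e') := by
  refine ⟨fun l => ?_, ?_⟩
  · have h1 : HasDerivAt (fun s => l (e s)) (l e') (- -t) := by rw [neg_neg]; exact he.1 l
    have := HasDerivAt.scomp (-t) h1 (hasDerivAt_neg (-t))
    simpa [Function.comp_def] using this
  · have h1 := he.2
    have h2 : Filter.Tendsto (fun s : ℝ => -s) (𝓝 (-t)) (𝓝 t) := by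
      simpa using (continuous_neg (G := ℝ)).tendsto (-t)
    simpa using h2.eventually h1

theorem mem_limSubspace_atBot (h : IsMonotoneFamily σ J) {w : V} {t₀ C : ℝ}
    (hw : ∀ t ≤ t₀, ∀ e e', IsVelocityIn J t e e' → σ w (e t) ^ 2 ≤ C * σ e' (e t)) :
    w ∈ limSubspace J Filter.atBot := by
  rw [← h.limSubspace_reverse]
  refine h.reverse.mem_limSubspace_atTop (t₀ := -t₀) (C := C) fun t ht e e' he => ?_
  simpa using hw (-t) (by linarith) _ _ (isVelocityIn_neg he)

theorem velocity_eq (h : IsMonotoneFamily σ J) {t : ℝ} {e f : ℝ → V} {e' f' : V}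
    (he : IsVelocityIn J t e e') (hf : IsVelocityIn J t f f') (hef : e t = f t) :
    σ e' (e t) = σ f' (f t) := by
  let _ : NormedAddCommGroup V := NormedAddCommGroup.induced V (Fin (finrank ℝ V) → ℝ)
    (finBasis ℝ V).equivFun (finBasis ℝ V).equivFun.injective
  let _ : NormedSpace ℝ V := NormedSpace.induced ℝ V (Fin (finrank ℝ V) → ℝ) (finBasis ℝ V).equivFun
  exact h.isMonotoneCurve.velocity_eq (isVelocityIn_iff.1 he) (isVelocityIn_iff.1 hf) hef

theorem velocity_pos (h : IsMonotoneFamily σ J) {t : ℝ} {e : ℝ → V} {e' : V}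
    (he : IsVelocityIn J t e e') (h0 : e t ≠ 0) : 0 < σ e' (e t) := by
  let _ : NormedAddCommGroup V := NormedAddCommGroup.induced V (Fin (finrank ℝ V) → ℝ)
    (finBasis ℝ V).equivFun (finBasis ℝ V).equivFun.injective
  let _ : NormedSpace ℝ V := NormedSpace.induced ℝ V (Fin (finrank ℝ V) → ℝ) (finBasis ℝ V).equivFun
  exact h.isMonotoneCurve.velocity_pos (isVelocityIn_iff.1 he) h0

/-- Vectors of the limit are nowhere isotropically decomposed by two members of the curve. -/
theorem apply_ne_zero_of_mem_limSubspace (h : IsMonotoneFamily σ J) {s t : ℝ} (hst : s < t) {v u : V}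
    (hv : v ∈ limSubspace J Filter.atTop) (hv0 : v ≠ 0) (hu : u ∈ J t) (hvu : v - u ∈ J s) :
    σ u v ≠ 0 := by
  let _ : NormedAddCommGroup V := NormedAddCommGroup.induced V (Fin (finrank ℝ V) → ℝ)
    (finBasis ℝ V).equivFun (finBasis ℝ V).equivFun.injective
  let _ : NormedSpace ℝ V := NormedSpace.induced ℝ V (Fin (finrank ℝ V) → ℝ) (finBasis ℝ V).equivFun
  have hc := h.isMonotoneCurve
  obtain ⟨-, -, hlim⟩ := hc.limit_spec
  obtain ⟨hcompl, hproj⟩ := hlim s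
  have hvs : v ∉ J s := fun hvs => hv0 (Submodule.disjoint_def.1 hcompl.disjoint v hv hvs)
  -- The projections of `v` tend to `v` itself and `σ v v = 0`. A strictly increasing function with
  -- limit zero is negative, and its value at `t` is `σ u v`.
  have h1 : Filter.Tendsto (fun r => σ (projAlong (J r) (J s) v) v) Filter.atTop (𝓝 0) := by
    have h2 := ((continuous_bilin_left σ v).tendsto _).comp (hproj v)
    rw [projAlong_of_mem hcompl hv, h.symplectic.self_eq_zero] at h2
    exact h2
  have h3 : projAlong (J t) (J s) v = u := projAlong_eq (hc.isCompl hst.ne') hu hvu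
  have hmono := hc.strictMonoOn hvs
  have h4 : σ (projAlong (J t) (J s) v) v < σ (projAlong (J (t + 1)) (J s) v) v :=
    hmono (Set.mem_Ioi.2 hst) (Set.mem_Ioi.2 (by linarith)) (by linarith)
  have h5 : σ (projAlong (J (t + 1)) (J s) v) v ≤ 0 := by
    refine ge_of_tendsto h1 ?_
    filter_upwards [Filter.eventually_ge_atTop (t + 1)] with r hr
    exact hmono.monotoneOn (Set.mem_Ioi.2 (by linarith)) (Set.mem_Ioi.2 (by linarith)) hr
  rw [h3] at h4
  linarith

theorem basisNorm_comparison (h : IsMonotoneFamily σ J) {m : ℕ}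
    {b : ℝ → Basis (Fin m ⊕ Fin m) ℝ V} {E E' : Fin m → ℝ → V} {E'' : Fin m → V}
    (hb : IsCanonicalFrame σ J b)
    (hE : ∀ᶠ s in 𝓝 (0 : ℝ), ∀ i, HasVelocity (E i) (E' i s) s)
    (hE' : ∀ i, HasVelocity (E' i) (E'' i) 0) (hmem : ∀ᶠ s in 𝓝 (0 : ℝ), ∀ i, E i s ∈ J s)
    (hsp : J 0 ≤ Submodule.span ℝ (Set.range fun i => E i 0)) {c B₀ : ℝ} (hc : 0 < c)
    (hB0 : 0 ≤ B₀)
    (hell : ∀ x : Fin m → ℝ, c * ∑ i, x i ^ 2 ≤ ∑ i, ∑ j, x i * x j * σ (E' i 0) (E j 0))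
    (hB1 : ∀ i j, |σ (E' i 0) (E j 0)| ≤ B₀) (hB2 : ∀ i j, |σ (E' i 0) (E' j 0)| ≤ B₀)
    (hB3 : ∀ i j, |σ (E'' i) (E j 0)| ≤ B₀) (w : V) :
    basisNorm (b 0) w ≤ frameConst m c B₀ * ∑ j, (|σ w (E j 0)| + |σ w (E' j 0)|) ∧
    ∑ j, (|σ w (E j 0)| + |σ w (E' j 0)|) ≤ frameConst m c B₀ * basisNorm (b 0) w ∧
    ∃ x y : Fin m → ℝ, w = ∑ j, x j • E j 0 + ∑ j, y j • E' j 0 ∧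
      ∀ j, |x j| ≤ frameConst m c B₀ * basisNorm (b 0) w ∧
        |y j| ≤ frameConst m c B₀ * basisNorm (b 0) w := by
  let _ : NormedAddCommGroup V := NormedAddCommGroup.induced V (Fin (finrank ℝ V) → ℝ)
    (finBasis ℝ V).equivFun (finBasis ℝ V).equivFun.injective
  let _ : NormedSpace ℝ V := NormedSpace.induced ℝ V (Fin (finrank ℝ V) → ℝ) (finBasis ℝ V).equivFun
  exact h.isMonotoneCurve.basisNorm_comparison hb
    (hE.mono fun s hs i => hasVelocity_iff.1 (hs i)) (fun i => hasVelocity_iff.1 (hE' i)) hmem hsp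
    hc hB0 hell hB1 hB2 hB3 w

end IsMonotoneFamily

section

variable {V : Type*} [AddCommGroup V] [Module ℝ V] {J : ℝ → Submodule ℝ V} {F : Filter ℝ}

theorem limSubspace_eq_of_subspaceTendsto [FiniteDimensional ℝ V] [F.NeBot] {Δ : Submodule ℝ V}
    (h : SubspaceTendsto J F Δ) : limSubspace J F = Δ := by
  let _ : NormedAddCommGroup V := NormedAddCommGroup.induced V (Fin (finrank ℝ V) → ℝ)
    (finBasis ℝ V).equivFun (finBasis ℝ V).equivFun.injective
  let _ : NormedSpace ℝ V := NormedSpace.induced ℝ V (Fin (finrank ℝ V) → ℝ) (finBasis ℝ V).equivFun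
  exact h.limSubspace_eq

theorem SubspaceTendsto.exists_vectorTendsto [FiniteDimensional ℝ V] {Δ : Submodule ℝ V}
    (h : SubspaceTendsto J F Δ) {w : V} (hw : w ∈ Δ) :
    ∃ u : ℝ → V, (∀ᶠ t in F, u t ∈ J t) ∧ VectorTendsto u F w := by
  let _ : NormedAddCommGroup V := NormedAddCommGroup.induced V (Fin (finrank ℝ V) → ℝ)
    (finBasis ℝ V).equivFun (finBasis ℝ V).equivFun.injective
  let _ : NormedSpace ℝ V := NormedSpace.induced ℝ V (Fin (finrank ℝ V) → ℝ) (finBasis ℝ V).equivFun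
  obtain ⟨u, h1, h2⟩ := h.exists_tendsto hw
  exact ⟨u, h1, vectorTendsto_iff.2 h2⟩

theorem SubspaceTendsto.map {W : Type*} [AddCommGroup W] [Module ℝ W] {Δ : Submodule ℝ V}
    (h : SubspaceTendsto J F Δ) (L : V →ₗ[ℝ] W) (hL : Function.Injective L) :
    SubspaceTendsto (fun t => (J t).map L) F (Δ.map L) := by
  obtain ⟨k, u, v, h1, h2, h3, h4⟩ := h
  refine ⟨k, fun t i => L (u t i), fun i => L (v i), h1.map' L (LinearMap.ker_eq_bot.2 hL), ?_, ?_,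
    fun i l => h4 i (l.comp L)⟩
  · rw [← h2, Submodule.map_span, ← Set.range_comp]; rfl
  · filter_upwards [h3] with t ht
    refine ⟨ht.1.map' L (LinearMap.ker_eq_bot.2 hL), ?_⟩
    rw [← ht.2, Submodule.map_span, ← Set.range_comp]; rfl

end

end MonotoneFamily

/-! ### Symplectic reduction of a monotone curve by a vector of its limit -/

section Reduction

variable {V : Type*} [AddCommGroup V] [Module ℝ V] {σ : V →ₗ[ℝ] V →ₗ[ℝ] ℝ}

theorem mem_skewCompl {v w : V} : w ∈ skewCompl σ v ↔ σ v w = 0 := LinearMap.mem_ker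

theorem mkQ_lineIn_eq_zero {v : V} {w : skewCompl σ v} :
    (lineIn σ v).mkQ w = 0 ↔ ∃ r : ℝ, (w : V) = r • v := by
  rw [← LinearMap.mem_ker, Submodule.ker_mkQ, lineIn, Submodule.mem_comap,
    Submodule.mem_span_singleton]
  exact exists_congr fun r => eq_comm

theorem isSymplecticBilin_reduceForm (hσ : IsSymplecticBilin σ) (v : V) :
    IsSymplecticBilin (reduceForm σ hσ.skew v) where
  skew a b := by
    obtain ⟨u, rfl⟩ := (lineIn σ v).mkQ_surjective a
    obtain ⟨w, rfl⟩ := (lineIn σ v).mkQ_surjective b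
    rw [reduceForm_mk, reduceForm_mk]
    exact hσ.skew u w
  nondeg a ha := by
    obtain ⟨u, rfl⟩ := (lineIn σ v).mkQ_surjective a
    rw [mkQ_lineIn_eq_zero]
    have h1 : ∀ w, σ v w = 0 → σ u w = 0 := by
      intro w hw
      have := ha ((lineIn σ v).mkQ ⟨w, hw⟩)
      rwa [reduceForm_mk] at this
    by_cases hv : v = 0
    · refine ⟨0, ?_⟩
      rw [zero_smul]
      exact hσ.nondeg _ fun w => h1 w (by rw [hv]; simp)
    obtain ⟨z, hz⟩ : ∃ z, σ v z ≠ 0 := by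
      by_contra! hcon
      exact hv (hσ.nondeg v hcon)
    -- The functional `σ u` vanishes on the kernel of `σ v`, so it is a multiple of `σ v`; the
    -- factor is read off at `z`.
    refine ⟨σ u z / σ v z, sub_eq_zero.1 (hσ.nondeg _ fun w => ?_)⟩
    have h2 := h1 (w - (σ v w / σ v z) • z) (by simp [hz])
    simp only [map_sub, map_smul, smul_eq_mul, LinearMap.sub_apply, LinearMap.smul_apply] at h2 ⊢
    field_simp at h2 ⊢
    linarith

theorem finrank_reduction [FiniteDimensional ℝ V] (hσ : IsSymplecticBilin σ) {v : V} (hv : v ≠ 0) :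
    finrank ℝ (Reduction σ v) + 2 = finrank ℝ V := by
  have h1 : finrank ℝ (skewCompl σ v) + 1 = finrank ℝ V := by
    have h2 : Function.Surjective (σ v) := by
      rw [← LinearMap.range_eq_top]
      refine (LinearMap.range_eq_top.2 (LinearMap.surjective ?_))
      intro h0
      exact hv (hσ.nondeg v fun w => by rw [h0]; rfl)
    have h3 := LinearMap.finrank_range_add_finrank_ker (σ v)
    rw [LinearMap.range_eq_top.2 h2, finrank_top, finrank_self] at h3
    rw [skewCompl]
    omega
  have h2 : finrank ℝ (lineIn σ v) = 1 := by
    have h3 : Submodule.span ℝ {v} ≤ skewCompl σ v := by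
      rw [Submodule.span_singleton_le_iff_mem, mem_skewCompl, hσ.self_eq_zero]
    rw [lineIn, (Submodule.comapSubtypeEquivOfLe h3).finrank_eq, finrank_span_singleton hv]
  have h3 := (lineIn σ v).finrank_quotient_add_finrank
  change finrank ℝ (skewCompl σ v ⧸ lineIn σ v) + 2 = _
  omega

theorem reduceSubspace_eq_map {v : V} {π : V →ₗ[ℝ] Reduction σ v}
    (hπ : ∀ w : skewCompl σ v, π w = (lineIn σ v).mkQ w) (K : Submodule ℝ V) :
    reduceSubspace σ v K = (K ⊓ skewCompl σ v).map π := by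
  ext a
  rw [reduceSubspace, Submodule.mem_map, Submodule.mem_map]
  constructor
  · rintro ⟨w, hw, rfl⟩
    exact ⟨w, ⟨hw, w.2⟩, hπ w⟩
  · rintro ⟨w, ⟨hw, hw'⟩, rfl⟩
    exact ⟨⟨w, hw'⟩, hw, (hπ ⟨w, hw'⟩).symm⟩

/-- The reduction of a frame of a subspace `K` with respect to a vector `v`, in terms of the
pairings `a i = σ v (E i)`, where `a i₀ ≠ 0`. -/
theorem span_reduced_frame {v : V} {k : ℕ} {E : Fin (k + 1) → V} {i₀ : Fin (k + 1)}
    (hi₀ : σ v (E i₀) ≠ 0) (hli : LinearIndependent ℝ E) :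
    LinearIndependent ℝ (fun j : Fin k =>
      E (i₀.succAbove j) - (σ v (E (i₀.succAbove j)) / σ v (E i₀)) • E i₀) ∧
    Submodule.span ℝ (Set.range fun j : Fin k =>
      E (i₀.succAbove j) - (σ v (E (i₀.succAbove j)) / σ v (E i₀)) • E i₀)
      = Submodule.span ℝ (Set.range E) ⊓ skewCompl σ v := by
  have hsum : ∀ c : Fin k → ℝ, ∑ j, c j •
      (E (i₀.succAbove j) - (σ v (E (i₀.succAbove j)) / σ v (E i₀)) • E i₀)
      = ∑ i, Fin.insertNth (α := fun _ => ℝ) i₀ (-(∑ j, c j * (σ v (E (i₀.succAbove j)) / σ v (E i₀)))) c i • E i := by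
    intro c
    rw [Fin.sum_univ_succAbove _ i₀]
    simp only [Fin.insertNth_apply_same, Fin.insertNth_apply_succAbove, smul_sub, smul_smul,
      Finset.sum_sub_distrib, neg_smul, Finset.sum_smul]
    abel
  refine ⟨?_, le_antisymm ?_ ?_⟩
  · rw [Fintype.linearIndependent_iff]
    intro c hc j
    rw [hsum] at hc
    have := Fintype.linearIndependent_iff.1 hli _ hc (i₀.succAbove j)
    simpa using this
  · rw [Submodule.span_le]
    rintro _ ⟨j, rfl⟩
    refine ⟨Submodule.sub_mem _ (Submodule.subset_span ⟨_, rfl⟩)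
      (Submodule.smul_mem _ _ (Submodule.subset_span ⟨_, rfl⟩)), ?_⟩
    change _ ∈ skewCompl σ v
    rw [mem_skewCompl, map_sub, map_smul, smul_eq_mul]
    field_simp
    ring
  · rintro u ⟨hu, hu'⟩
    obtain ⟨c, rfl⟩ := (Submodule.mem_span_range_iff_exists_fun ℝ).1 hu
    refine (Submodule.mem_span_range_iff_exists_fun ℝ).2 ⟨fun j => c (i₀.succAbove j), ?_⟩
    change _ ∈ skewCompl σ v at hu'
    rw [mem_skewCompl, map_sum, Fin.sum_univ_succAbove _ i₀] at hu'
    simp only [map_smul, smul_eq_mul] at hu'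
    rw [hsum]
    refine Finset.sum_congr rfl fun i _ => ?_
    congr 1
    refine Fin.succAboveCases i₀ ?_ (fun j => ?_) i
    · simp only [Fin.insertNth_apply_same]
      simp only [← mul_div_assoc]
      rw [← Finset.sum_div, ← neg_div, div_eq_iff hi₀]
      linarith
    · simp

theorem mul_apply_contDiffAt {V : Type*} [AddCommGroup V] [Module ℝ V] {e : ℝ → V} {f : ℝ → ℝ}
    {t : ℝ} (hf : ContDiffAt ℝ ∞ f t)
    (he : ∀ l : Dual ℝ V, ContDiffAt ℝ ∞ (fun s => l (e s)) t) (l : Dual ℝ V) :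
    ContDiffAt ℝ ∞ (fun s => l (f s • e s)) t := by
  simp only [map_smul, smul_eq_mul]
  exact hf.mul (he l)

/-- Symplectic reduction of a monotone curve by a vector in its limit. -/
theorem IsMonotoneFamily.reduce [FiniteDimensional ℝ V] {J : ℝ → Submodule ℝ V}
    (h : IsMonotoneFamily σ J) {v : V} (hv0 : v ≠ 0) (hv : v ∈ limSubspace J Filter.atTop) :
    IsMonotoneFamily (reduceForm σ h.symplectic.skew v) (fun t => reduceSubspace σ v (J t)) := by
  have hσ := h.symplectic
  obtain ⟨-, -, hlim⟩ := h.limit_atTop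
  have hvJ : ∀ t, v ∉ J t := fun t ht => hv0 (Submodule.disjoint_def.1 (hlim t).disjoint v hv ht)
  -- An extension of the quotient map to all of `V`. With it curves and velocities can be handled in
  -- `V` instead of the subtype `v^∠`; its values off `v^∠` do not matter.
  obtain ⟨π, hπ'⟩ := LinearMap.exists_extend (lineIn σ v).mkQ
  have hπ : ∀ w : skewCompl σ v, π w = (lineIn σ v).mkQ w := fun w => congrArg (fun f => f w) hπ'
  have hred := reduceSubspace_eq_map hπ
  have hform : ∀ u w, σ v u = 0 → σ v w = 0 → reduceForm σ hσ.skew v (π u) (π w) = σ u w := by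
    intro u w hu hw
    have h1 := hπ ⟨u, hu⟩
    have h2 := hπ ⟨w, hw⟩
    simp only at h1 h2
    rw [h1, h2, reduceForm_mk]
  have hframe : ∀ t₀, ∃ (m : ℕ) (W : Fin m → ℝ → V) (W' : Fin m → V), m + 1 = finrank ℝ (J t₀) ∧
      (∀ i (l : Dual ℝ V), ContDiffAt ℝ ∞ (fun t => l (W i t)) t₀) ∧
      (∀ i, HasVelocity (W i) (W' i) t₀) ∧
      (∀ᶠ t in 𝓝 t₀, LinearIndependent ℝ (fun i => W i t) ∧
        Submodule.span ℝ (Set.range fun i => W i t) = J t ⊓ skewCompl σ v) := by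
    intro t₀
    obtain ⟨m, E, E', h1, h2, h3, -⟩ := h.frame t₀
    obtain ⟨i₀, hi₀⟩ : ∃ i, σ v (E i t₀) ≠ 0 := by
      by_contra! hcon
      refine hvJ t₀ ((h.lagrangian t₀ v).2 fun w hw => ?_)
      rw [← h3.self_of_nhds.2, Submodule.mem_span_range_iff_exists_fun] at hw
      obtain ⟨c, rfl⟩ := hw
      simp [map_sum, hcon]
    obtain ⟨k, rfl⟩ : ∃ k, m = k + 1 := ⟨m - 1, by have := i₀.2; omega⟩
    have hc0 : ∀ᶠ t in 𝓝 t₀, σ v (E i₀ t) ≠ 0 :=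
      (h1 i₀ (σ v)).continuousAt.eventually_ne hi₀
    have hq : ∀ j, ContDiffAt ℝ ∞ (fun t => σ v (E (i₀.succAbove j) t) / σ v (E i₀ t)) t₀ :=
      fun j => (h1 _ (σ v)).div (h1 i₀ (σ v)) hi₀
    refine ⟨k, fun j t => E (i₀.succAbove j) t
        - (σ v (E (i₀.succAbove j) t) / σ v (E i₀ t)) • E i₀ t,
      fun j => E' (i₀.succAbove j) - ((σ v (E (i₀.succAbove j) t₀) / σ v (E i₀ t₀)) • E' i₀
        + deriv (fun t => σ v (E (i₀.succAbove j) t) / σ v (E i₀ t)) t₀ • E i₀ t₀), ?_, ?_, ?_, ?_⟩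
    · have h4 := h3.self_of_nhds
      rw [← h4.2, finrank_span_eq_card h4.1, Fintype.card_fin]
    · intro j l
      have h5 := mul_apply_contDiffAt (hq j) (h1 i₀) l
      have h6 := (h1 (i₀.succAbove j) l).sub h5
      simpa only [map_sub] using h6
    · intro j l
      have h5 := (h2 (i₀.succAbove j) l).sub
        (((hq j).differentiableAt (by simp)).hasDerivAt.mul (h2 i₀ l))
      simp only [map_sub, map_smul, map_add, smul_eq_mul]
      refine h5.congr_deriv ?_
      ring
    · filter_upwards [h3, hc0] with t ht ht0
      have := span_reduced_frame (σ := σ) (v := v) (E := fun i => E i t) ht0 ht.1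
      rw [ht.2] at this
      exact this
  -- The kernel of the quotient map is the line through `v`, and `v` lies in no member of the curve
  -- because the limit is transversal to all of them. So reduction loses no dimension of `J t ⊓
  -- v^∠`.
  have hπinj : ∀ t, ∀ u ∈ J t ⊓ skewCompl σ v, π u = 0 → u = 0 := by
    rintro t u ⟨hu, hu'⟩ h0
    rw [show π u = (lineIn σ v).mkQ ⟨u, hu'⟩ from hπ ⟨u, hu'⟩, mkQ_lineIn_eq_zero] at h0
    obtain ⟨r, hr⟩ := h0
    simp only at hr
    by_cases hr0 : r = 0
    · rw [hr, hr0, zero_smul]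
    · refine absurd ?_ (hvJ t)
      rw [hr] at hu
      exact ((J t).smul_mem_iff hr0).1 hu
  have hredli : ∀ t (m : ℕ) (W : Fin m → V), LinearIndependent ℝ W →
      Submodule.span ℝ (Set.range W) = J t ⊓ skewCompl σ v →
      LinearIndependent ℝ (fun i => π (W i)) ∧
        Submodule.span ℝ (Set.range fun i => π (W i)) = reduceSubspace σ v (J t) := by
    intro t m W hW hsp
    constructor
    · rw [Fintype.linearIndependent_iff] at hW ⊢
      intro c hc
      refine hW c (hπinj t _ ?_ ?_)
      · rw [← hsp]
        exact Submodule.sum_mem _ fun i _ => Submodule.smul_mem _ _ (Submodule.subset_span ⟨i, rfl⟩)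
      · rw [map_sum]
        simpa using hc
    · rw [hred, ← hsp, Submodule.map_span, ← Set.range_comp]
      rfl
  refine ⟨isSymplecticBilin_reduceForm hσ v, fun t => ?_, fun t₀ => ?_, fun s t hst => ?_⟩
  · refine isLagrangianSubspace_of_finrank (isSymplecticBilin_reduceForm hσ v) ?_ ?_
    · intro a ha b hb
      rw [hred] at ha hb
      obtain ⟨u, ⟨hu, hu'⟩, rfl⟩ := ha
      obtain ⟨w, ⟨hw, hw'⟩, rfl⟩ := hb
      rw [hform u w hu' hw']
      exact (h.lagrangian t).apply_eq_zero hu hw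
    · obtain ⟨m, W, W', hm, -, -, hsp⟩ := hframe t
      obtain ⟨h1, h2⟩ := hredli t m _ hsp.self_of_nhds.1 hsp.self_of_nhds.2
      rw [← h2, finrank_span_eq_card h1, Fintype.card_fin]
      have h3 := finrank_reduction hσ hv0
      have h4 := (h.lagrangian t).two_mul_finrank hσ
      omega
  · obtain ⟨m, W, W', hm, h1, h2, h3⟩ := hframe t₀
    refine ⟨m, fun i t => π (W i t), fun i => π (W' i), fun i l => h1 i (l.comp π),
      fun i l => h2 i (l.comp π), ?_, fun c hc => ?_⟩
    · filter_upwards [h3] with t ht using hredli t m _ ht.1 ht.2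
    · have hWmem : ∀ i, ∀ᶠ t in 𝓝 t₀, W i t ∈ J t ⊓ skewCompl σ v := by
        intro i
        filter_upwards [h3] with t ht
        rw [← ht.2]
        exact Submodule.subset_span ⟨i, rfl⟩
      have hcurve : IsVelocityIn J t₀ (fun t => ∑ i, c i • W i t) (∑ i, c i • W' i) := by
        constructor
        · intro l
          simp only [map_sum, map_smul, smul_eq_mul]
          exact HasDerivAt.fun_sum fun i _ => (h2 i l).const_mul (c i)
        · filter_upwards [Filter.eventually_all.2 hWmem] with t ht
          exact Submodule.sum_mem _ fun i _ => Submodule.smul_mem _ _ (ht i).1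
      have hpos := h.velocity_pos hcurve
        (fun h0 => hc (funext (Fintype.linearIndependent_iff.1 h3.self_of_nhds.1 c h0)))
      have hW0 : ∀ i, σ v (W i t₀) = 0 := fun i => (hWmem i).self_of_nhds.2
      have hW'0 : ∀ i, σ v (W' i) = 0 := fun i =>
        (h2 i (σ v)).unique ((hasDerivAt_const t₀ (0 : ℝ)).congr_of_eventuallyEq
          ((hWmem i).mono fun t ht => ht.2))
      have h4 := hform (∑ i, c i • W' i) (∑ i, c i • W i t₀) (by simp [map_sum, hW'0])
        (by simp [map_sum, hW0])
      rw [← h4] at hpos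
      simpa only [map_sum, map_smul] using hpos
  · wlog hlt : s < t generalizing s t
    · rw [inf_comm]
      exact this t s hst.symm (lt_of_le_of_ne (not_lt.1 hlt) hst.symm)
    rw [Submodule.eq_bot_iff]
    rintro a ⟨ha, hb⟩
    change a ∈ reduceSubspace σ v (J s) at ha
    change a ∈ reduceSubspace σ v (J t) at hb
    rw [hred] at ha hb
    obtain ⟨u, ⟨hu, hu'⟩, rfl⟩ := ha
    obtain ⟨w, ⟨hw, hw'⟩, hwu⟩ := hb
    change σ v u = 0 at hu'
    change σ v w = 0 at hw'
    have h1 : π (u - w) = 0 := by rw [map_sub, hwu, sub_self]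
    have h2 : u - w ∈ skewCompl σ v := by rw [mem_skewCompl, map_sub, hu', hw', sub_self]
    rw [show π (u - w) = (lineIn σ v).mkQ ⟨u - w, h2⟩ from hπ ⟨u - w, h2⟩,
      mkQ_lineIn_eq_zero] at h1
    obtain ⟨r, hr⟩ := h1
    simp only at hr
    by_cases hr0 : r = 0
    · rw [hr0, zero_smul, sub_eq_zero] at hr
      have h3 : u ∈ J s ⊓ J t := ⟨hu, hr ▸ hw⟩
      rw [h.transversal s t hst, Submodule.mem_bot] at h3
      rw [h3, map_zero]
    -- Here `v` would be the sum of a vector of `J s` and a vector of `J t`, the latter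
    -- skew-orthogonal to `v`. A nonzero vector of the limit admits no such decomposition.
    · exfalso
      have hvr : v = r⁻¹ • (u - w) := by rw [hr, smul_smul, inv_mul_cancel₀ hr0, one_smul]
      refine h.apply_ne_zero_of_mem_limSubspace hlt hv hv0 (u := -(r⁻¹ • w))
        ((J t).neg_mem ((J t).smul_mem _ hw)) ?_ ?_
      · have : v - -(r⁻¹ • w) = r⁻¹ • u := by
          conv_lhs => rw [hvr]
          rw [smul_sub]; abel
        rw [this]
        exact (J s).smul_mem _ hu
      · rw [hσ.skew]
        simp [hw']

end Reduction

/-! ### Lie derivatives of fields and forms, in a chart -/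

section FlowCalculus

variable {E : Type*} [NormedAddCommGroup E] [NormedSpace ℝ E]

/-- The derivative in the space variable of the flow `u` of the vector field `X`, in a chart. -/
theorem hasDerivAt_fderiv_flow {u : ℝ × E → E} {X : E → E} {y₀ : E}
    (hu : ContDiffAt ℝ ∞ u (0, y₀)) (h0 : ∀ᶠ y in 𝓝 y₀, u (0, y) = y)
    (hX : ∀ᶠ y in 𝓝 y₀, fderiv ℝ u (0, y) (1, 0) = X y) :
    ContDiffAt ℝ ∞ X y₀ ∧
    HasDerivAt (fun h : ℝ => (fderiv ℝ u (h, y₀)).comp (ContinuousLinearMap.inr ℝ ℝ E))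
      (fderiv ℝ X y₀) 0 ∧
    (fderiv ℝ u (0, y₀)).comp (ContinuousLinearMap.inr ℝ ℝ E) = ContinuousLinearMap.id ℝ E ∧
    HasDerivAt (fun h : ℝ => u (h, y₀)) (X y₀) 0 := by
  have hDu : ContDiffAt ℝ ∞ (fderiv ℝ u) (0, y₀) := hu.fderiv_right (by norm_cast)
  have hD2 : HasFDerivAt (fderiv ℝ u) (fderiv ℝ (fderiv ℝ u) (0, y₀)) (0, y₀) :=
    (hDu.differentiableAt (by simp)).hasFDerivAt
  have hu1 : HasFDerivAt u (fderiv ℝ u (0, y₀)) (0, y₀) :=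
    (hu.differentiableAt (by simp)).hasFDerivAt
  have hi : HasFDerivAt (fun y : E => ((0 : ℝ), y)) (ContinuousLinearMap.inr ℝ ℝ E) y₀ :=
    hasFDerivAt_prodMk_right 0 y₀
  have hj : HasDerivAt (fun h : ℝ => (h, y₀)) ((1 : ℝ), (0 : E)) 0 :=
    (hasDerivAt_id _).prodMk (hasDerivAt_const _ _)
  have hXeq : X =ᶠ[𝓝 y₀] fun y => fderiv ℝ u (0, y) (1, 0) := hX.mono fun y hy => hy.symm
  have hXf : HasFDerivAt X (((fderiv ℝ (fderiv ℝ u) (0, y₀)).comp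
      (ContinuousLinearMap.inr ℝ ℝ E)).flip (1, 0)) y₀ := by
    refine HasFDerivAt.congr_of_eventuallyEq ?_ hXeq
    have h1 := HasFDerivAt.comp y₀ (f := fun y : E => ((0 : ℝ), y)) hD2 hi
    have h2 := h1.clm_apply (hasFDerivAt_const ((1 : ℝ), (0 : E)) y₀)
    refine h2.congr_fderiv ?_
    ext v
    simp
  -- Time and space derivatives commute, so the time derivative of the differential of the flow is
  -- the space derivative of its velocity `X`.
  have hsym : IsSymmSndFDerivAt ℝ u (0, y₀) := hu.isSymmSndFDerivAt (by simp; norm_cast)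
  refine ⟨?_, ?_, ?_, ?_⟩
  · refine ContDiffAt.congr_of_eventuallyEq ?_ hXeq
    refine ContDiffAt.clm_apply (ContDiffAt.comp y₀ (f := fun y : E => ((0 : ℝ), y)) hDu ?_)
      contDiffAt_const
    exact (contDiff_const.prodMk contDiff_id).contDiffAt
  · have h1 := HasFDerivAt.comp_hasDerivAt (0 : ℝ) (f := fun h : ℝ => (h, y₀)) hD2 hj
    have h2 := h1.clm_comp (hasDerivAt_const (0 : ℝ) (ContinuousLinearMap.inr ℝ ℝ E))
    refine h2.congr_deriv ?_
    rw [hXf.fderiv]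
    ext v
    simpa using hsym (1, 0) (0, v)
  · have h1 := HasFDerivAt.comp y₀ (f := fun y : E => ((0 : ℝ), y)) hu1 hi
    have h2 : HasFDerivAt (u ∘ fun y : E => ((0 : ℝ), y)) (ContinuousLinearMap.id ℝ E) y₀ :=
      (hasFDerivAt_id y₀).congr_of_eventuallyEq h0
    exact h1.unique h2
  · have h1 := HasFDerivAt.comp_hasDerivAt (0 : ℝ) (f := fun h : ℝ => (h, y₀)) hu1 hj
    refine h1.congr_deriv hX.self_of_nhds

/-- The Lie bracket as the derivative of the pullbacks by the flow, in a chart. -/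
theorem hasDerivAt_pullback_flow [CompleteSpace E] {A : ℝ → E →L[ℝ] E} {A' : E →L[ℝ] E} {y : ℝ → E}
    {y' : E} {V : E → E} {e : ℝ → E} (hA : HasDerivAt A A' 0) (hA0 : A 0 = ContinuousLinearMap.id ℝ E)
    (hy : HasDerivAt y y' 0) (hV : DifferentiableAt ℝ V (y 0))
    (he : ∀ᶠ h in 𝓝 0, A h (e h) = V (y h)) :
    HasDerivAt e (fderiv ℝ V (y 0) y' - A' (V (y 0))) 0 := by
  have he0 : e 0 = V (y 0) := by simpa [hA0] using he.self_of_nhds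
  have hVy : HasDerivAt (fun h => V (y h)) (fderiv ℝ V (y 0) y') 0 :=
    hV.hasFDerivAt.comp_hasDerivAt 0 hy
  -- The relation `A h (e h) = V (y h)` is solved for `e` near `h = 0`, where `A` is the identity
  -- and the derivative of inversion is minus the identity.
  have hinv : HasFDerivAt Ring.inverse (-ContinuousLinearMap.mulLeftRight ℝ (E →L[ℝ] E)
      ↑(1 : (E →L[ℝ] E)ˣ)⁻¹ ↑(1 : (E →L[ℝ] E)ˣ)⁻¹) (A 0) := by
    rw [hA0]
    exact hasFDerivAt_ringInverse (𝕜 := ℝ) (1 : (E →L[ℝ] E)ˣ)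
  have h1 := hinv.comp_hasDerivAt (0 : ℝ) hA
  have h2 := h1.clm_apply hVy
  have hunit : ∀ᶠ h in 𝓝 0, IsUnit (A h) := by
    have h3 : {B : E →L[ℝ] E | IsUnit B} ∈ 𝓝 (A 0) := by
      rw [hA0]; exact Units.nhds (1 : (E →L[ℝ] E)ˣ)
    exact hA.continuousAt.eventually h3
  have heq : e =ᶠ[𝓝 0] fun h => (Ring.inverse ∘ A) h (V (y h)) := by
    filter_upwards [he, hunit] with h hh hh'
    have h4 : Ring.inverse (A h) * A h = 1 := Ring.inverse_mul_cancel _ hh'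
    have h5 := congrArg (fun B : E →L[ℝ] E => B (e h)) h4
    simp only [mul_apply_eq_comp, one_apply_eq_self] at h5
    rw [hh] at h5
    exact h5.symm
  refine (h2.congr_of_eventuallyEq heq).congr_deriv ?_
  have h6 : (Ring.inverse ∘ A) 0 = ContinuousLinearMap.id ℝ E := by
    simp only [Function.comp, hA0]
    exact Ring.inverse_one _
  rw [h6]
  simp
  abel

/-- The derivative of a two-form at two vectors, all depending on a parameter. -/
theorem HasFDerivAt.form_apply {P : Type*} [NormedAddCommGroup P] [NormedSpace ℝ P]
    {f : P → E [⋀^Fin 2]→L[ℝ] ℝ} {f' : P →L[ℝ] E [⋀^Fin 2]→L[ℝ] ℝ} {a b : P → E}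
    {a' b' : P →L[ℝ] E} {p : P} (hf : HasFDerivAt f f' p) (ha : HasFDerivAt a a' p)
    (hb : HasFDerivAt b b' p) :
    ∃ L : P →L[ℝ] ℝ, HasFDerivAt (fun q => f q ![a q, b q]) L p ∧
      ∀ q, L q = f' q ![a p, b p] + f p ![a' q, b p] + f p ![a p, b' q] := by
  have hg : ∀ i : Fin 2, HasFDerivAt ((![a, b] : Fin 2 → P → E) i)
      ((![a', b'] : Fin 2 → P →L[ℝ] E) i) p := by
    intro i
    fin_cases i
    · exact ha
    · exact hb
  have he : ∀ q, (fun i => (![a, b] : Fin 2 → P → E) i q) = ![a q, b q] := by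
    intro q; ext i; fin_cases i <;> rfl
  have h1 := hf.continuousAlternatingMap_apply hg
  simp only [he] at h1
  refine ⟨_, h1, fun q => ?_⟩
  have e0 : Function.update ![a p, b p] 0 (a' q) = ![a' q, b p] := by
    ext i; fin_cases i <;> simp
  have e1 : Function.update ![a p, b p] 1 (b' q) = ![a p, b' q] := by
    ext i; fin_cases i <;> simp
  simp [Fin.sum_univ_two, e0, e1, add_assoc]

/-- The derivative at time zero of the pullback of a two-form, in a chart. -/
theorem hasDerivAt_form_flow {η : E → E [⋀^Fin 2]→L[ℝ] ℝ} {A : ℝ → E →L[ℝ] E} {A' : E →L[ℝ] E}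
    {y : ℝ → E} {y' : E} (hA : HasDerivAt A A' 0) (hA0 : A 0 = ContinuousLinearMap.id ℝ E)
    (hy : HasDerivAt y y' 0) (hη : DifferentiableAt ℝ η (y 0)) (v w : E) :
    HasDerivAt (fun h => η (y h) ![A h v, A h w])
      (fderiv ℝ η (y 0) y' ![v, w] + η (y 0) ![A' v, w] + η (y 0) ![v, A' w]) 0 := by
  obtain ⟨L, hL, hL'⟩ := HasFDerivAt.form_apply
    (hη.hasFDerivAt.comp_hasDerivAt 0 hy).hasFDerivAt
    (hA.clm_apply (hasDerivAt_const 0 v)).hasFDerivAt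
    (hA.clm_apply (hasDerivAt_const 0 w)).hasFDerivAt
  refine hL.hasDerivAt.congr_deriv ?_
  rw [hL']
  simp [hA0]

/-- A Hamiltonian vector field of a closed two-form preserves it infinitesimally. -/
theorem lieDerivative_form_eq_zero {η : E → E [⋀^Fin 2]→L[ℝ] ℝ} {X : E → E} {H : E → ℝ} {y₀ : E}
    (hη : DifferentiableAt ℝ η y₀) (hd : extDeriv η y₀ = 0) (hX : DifferentiableAt ℝ X y₀)
    (hH : ContDiffAt ℝ 2 H y₀) (hXH : ∀ᶠ y in 𝓝 y₀, ∀ w, η y ![X y, w] = - fderiv ℝ H y w)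
    (v w : E) :
    fderiv ℝ η y₀ (X y₀) ![v, w] + η y₀ ![fderiv ℝ X y₀ v, w] + η y₀ ![v, fderiv ℝ X y₀ w] = 0 := by
  have hH2 : DifferentiableAt ℝ (fderiv ℝ H) y₀ :=
    (hH.fderiv_right (m := 1) (by norm_num)).differentiableAt (by simp)
  have hsym : IsSymmSndFDerivAt ℝ H y₀ := hH.isSymmSndFDerivAt (by simp)
  have hswap : ∀ (θ : E [⋀^Fin 2]→L[ℝ] ℝ) (a b : E), θ ![a, b] = - θ ![b, a] := by
    intro θ a b
    have h := θ.toAlternatingMap.map_swap ![b, a] (i := 0) (j := 1) (by decide)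
    have e : (![b, a] ∘ (Equiv.swap (0 : Fin 2) 1)) = ![a, b] := by
      ext i; fin_cases i <;> simp
    rw [e] at h
    exact h
  -- The derivative of the Hamiltonian equation in the direction `a`. Its right side is symmetric in
  -- `a` and `b`.
  have hdiff : ∀ a b : E, fderiv ℝ η y₀ a ![X y₀, b] + η y₀ ![fderiv ℝ X y₀ a, b]
      = - fderiv ℝ (fderiv ℝ H) y₀ a b := by
    intro a b
    obtain ⟨L, hL, hL'⟩ := HasFDerivAt.form_apply hη.hasFDerivAt hX.hasFDerivAt
      (hasFDerivAt_const b y₀)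
    have h1 : HasFDerivAt (fun y => - fderiv ℝ H y b) L y₀ :=
      hL.congr_of_eventuallyEq (hXH.mono fun y hy => (hy b).symm)
    have h2 := (hH2.hasFDerivAt.clm_apply (hasFDerivAt_const b y₀)).neg
    have h3 := congrArg (fun B : E →L[ℝ] ℝ => B a) (h1.unique h2)
    simp only [hL'] at h3
    have hz : η y₀ ![X y₀, 0] = 0 := (η y₀).map_coord_zero 1 rfl
    simpa [hz] using h3
  -- Cartan's formula: closedness, evaluated on `X, v, w`, expresses the derivative of `η` along `X`
  -- by the two derivatives in `hdiff`, and the second derivatives of `H` cancel by symmetry.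
  have h1 := congrArg (fun B : E [⋀^Fin 3]→L[ℝ] ℝ => B ![X y₀, v, w]) hd
  simp only [extDeriv_apply hη] at h1
  replace h1 := (Fin.sum_univ_three _).symm.trans h1
  have e0 : (0 : Fin 3).removeNth ![X y₀, v, w] = ![v, w] := by
    ext i; fin_cases i <;> rfl
  have e1 : (1 : Fin 3).removeNth ![X y₀, v, w] = ![X y₀, w] := by
    ext i; fin_cases i <;> rfl
  have e2 : (2 : Fin 3).removeNth ![X y₀, v, w] = ![X y₀, v] := by
    ext i; fin_cases i <;> rfl
  simp [e0, e1, e2, fderiv_continuousAlternatingMap_apply_const hη] at h1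
  have h2 := hdiff v w
  have h3 := hdiff w v
  have h4 := hsym v w
  have h5 := hswap (η y₀) v (fderiv ℝ X y₀ w)
  linarith

end FlowCalculus

/-! ### Fields, forms, brackets and flows in charts -/

section Charts

variable {E : Type*} [NormedAddCommGroup E] [NormedSpace ℝ E]
  {M : Type*} [TopologicalSpace M] [ChartedSpace E M] [IsManifold 𝓘(ℝ, E) ∞ M]

variable (E) in
/-- The differential at `x` of the chart at `x₀`, as an endomorphism of the model space. -/
noncomputable def chartDeriv (x₀ x : M) : E →L[ℝ] E :=
  mfderiv 𝓘(ℝ, E) 𝓘(ℝ, E) (extChartAt 𝓘(ℝ, E) x₀) x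

/-- The expression of the vector field `V` in the chart at `x₀`. -/
noncomputable def fieldInChart (V : M → E) (x₀ : M) (y : E) : E :=
  chartDeriv E x₀ ((extChartAt 𝓘(ℝ, E) x₀).symm y) (V ((extChartAt 𝓘(ℝ, E) x₀).symm y))

variable (E M) in
theorem isManifold_one : IsManifold 𝓘(ℝ, E) 1 M := IsManifold.of_le (n := ∞) (by simp)

theorem chartDeriv_self (x : M) : chartDeriv E x x = ContinuousLinearMap.id ℝ E := by
  have := isManifold_one E M
  exact mfderiv_extChartAt_self

theorem fieldInChart_extChartAt {V : M → E} {x₀ x : M}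
    (hx : x ∈ (extChartAt 𝓘(ℝ, E) x₀).source) :
    fieldInChart V x₀ (extChartAt 𝓘(ℝ, E) x₀ x) = chartDeriv E x₀ x (V x) := by
  rw [fieldInChart, (extChartAt 𝓘(ℝ, E) x₀).left_inv hx]

theorem fieldInChart_self (V : M → E) (x : M) :
    fieldInChart V x (extChartAt 𝓘(ℝ, E) x x) = V x := by
  rw [fieldInChart_extChartAt (mem_extChartAt_source x), chartDeriv_self]
  rfl

theorem contMDiffAt_extChartAt_symm_self (x₀ : M) :
    ContMDiffAt 𝓘(ℝ, E) 𝓘(ℝ, E) ∞ (extChartAt 𝓘(ℝ, E) x₀).symm (extChartAt 𝓘(ℝ, E) x₀ x₀) :=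
  (contMDiffOn_extChartAt_symm x₀).contMDiffAt
    ((isOpen_extChartAt_target x₀).mem_nhds (mem_extChartAt_target x₀))

/-- On the chart domain the trivialisation of the tangent bundle at `x₀` acts on fibres as the
differential of the chart. So smoothness of the section is smoothness of the chart expression, up to
composition with the chart. -/
theorem contDiffAt_fieldInChart_iff {V : M → E} {x₀ : M} :
    ContDiffAt ℝ ∞ (fieldInChart V x₀) (extChartAt 𝓘(ℝ, E) x₀ x₀) ↔
      ContMDiffAt 𝓘(ℝ, E) 𝓘(ℝ, E).tangent ∞
        (fun x => (⟨x, V x⟩ : TangentBundle 𝓘(ℝ, E) M)) x₀ := by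
  have := isManifold_one E M
  have h1 : ContMDiffAt 𝓘(ℝ, E) 𝓘(ℝ, E).tangent ∞
        (fun x => (⟨x, V x⟩ : TangentBundle 𝓘(ℝ, E) M)) x₀ ↔
      ContMDiffAt 𝓘(ℝ, E) 𝓘(ℝ, E) ∞ (fun x => chartDeriv E x₀ x (V x)) x₀ := by
    refine (Bundle.contMDiffAt_section (IB := 𝓘(ℝ, E)) (F := E)
      (E := (TangentSpace 𝓘(ℝ, E) : M → Type _)) x₀).trans ?_
    refine Filter.EventuallyEq.contMDiffAt_iff ?_
    filter_upwards [chart_source_mem_nhds E x₀] with x hx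
    have h2 := TangentBundle.continuousLinearMapAt_trivializationAt (I := 𝓘(ℝ, E)) hx
    rw [chartDeriv, ← h2]
    symm
    exact Bundle.Trivialization.continuousLinearMapAt_apply_of_mem ℝ _ hx _
  rw [h1]
  constructor
  · intro h
    have h2 := ContMDiffAt.comp x₀ h.contMDiffAt (contMDiffAt_extChartAt (n := ∞))
    refine h2.congr_of_eventuallyEq ?_
    filter_upwards [extChartAt_source_mem_nhds (I := 𝓘(ℝ, E)) x₀] with x hx
    exact (fieldInChart_extChartAt hx).symm
  · intro h
    rw [← contMDiffAt_iff_contDiffAt]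
    have h2 : ContMDiffAt 𝓘(ℝ, E) 𝓘(ℝ, E) ∞ (fun x => chartDeriv E x₀ x (V x))
        ((extChartAt 𝓘(ℝ, E) x₀).symm (extChartAt 𝓘(ℝ, E) x₀ x₀)) := by
      rwa [extChartAt_to_inv]
    exact h2.comp _ (contMDiffAt_extChartAt_symm_self x₀)

theorem symm_chartDeriv {x₀ x : M} (hx : x ∈ (extChartAt 𝓘(ℝ, E) x₀).source) (v : E) :
    mfderiv 𝓘(ℝ, E) 𝓘(ℝ, E) (extChartAt 𝓘(ℝ, E) x₀).symm
      (extChartAt 𝓘(ℝ, E) x₀ x) (chartDeriv E x₀ x v : E) = v := by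
  have := isManifold_one E M
  have h1 := mfderivWithin_extChartAt_symm_comp_mfderiv_extChartAt' (I := 𝓘(ℝ, E)) hx
  rw [modelWithCornersSelf_coe, Set.range_id, mfderivWithin_univ] at h1
  exact congrArg (fun B : E →L[ℝ] E => B v) h1

theorem formAt_eq_formInChart (Ω : (x : M) → TangentSpace 𝓘(ℝ, E) x [⋀^Fin 2]→L[ℝ] ℝ) {x₀ x : M}
    (hx : x ∈ (extChartAt 𝓘(ℝ, E) x₀).source) (v w : E) :
    Ω x ![(v : TangentSpace 𝓘(ℝ, E) x), w] = formInChart Ω x₀ (extChartAt 𝓘(ℝ, E) x₀ x)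
      ![chartDeriv E x₀ x v, chartDeriv E x₀ x w] := by
  -- The form on the chart side is based at the point obtained by going through the chart and back.
  -- This point equals `x` only propositionally, hence the transport along an equation of base
  -- points.
  have h1 : ∀ x' : M, x' = x → ∀ u u' : Fin 2 → E, u = u' →
      (Ω x : (Fin 2 → E) → ℝ) u = (Ω x' : (Fin 2 → E) → ℝ) u' := by
    rintro _ rfl _ _ rfl; rfl
  refine h1 _ ((extChartAt 𝓘(ℝ, E) x₀).left_inv hx) _ _ ?_
  ext i
  fin_cases i
  · exact (symm_chartDeriv hx v).symm
  · exact (symm_chartDeriv hx w).symm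

/-- At the centre of a chart its differential is the identity, so the bracket there is the
coordinate bracket of the chart expressions, with no correction by the chart. -/
theorem mlieBracket_eq_fieldInChart (X V : (x : M) → TangentSpace 𝓘(ℝ, E) x) (x : M) :
    VectorField.mlieBracket 𝓘(ℝ, E) X V x
      = fderiv ℝ (fieldInChart V x) (extChartAt 𝓘(ℝ, E) x x) (X x)
        - fderiv ℝ (fieldInChart X x) (extChartAt 𝓘(ℝ, E) x x) (V x) := by
  have := isManifold_one E M
  have h1 : ∀ W : (x : M) → TangentSpace 𝓘(ℝ, E) x,
      VectorField.mpullbackWithin 𝓘(ℝ, E) 𝓘(ℝ, E) (extChartAt 𝓘(ℝ, E) x).symm W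
        (Set.range 𝓘(ℝ, E)) =ᶠ[𝓝 (extChartAt 𝓘(ℝ, E) x x)] fieldInChart W x := by
    intro W
    filter_upwards [(isOpen_extChartAt_target (I := 𝓘(ℝ, E)) x).mem_nhds
      (mem_extChartAt_target x)] with y hy
    have h2 := ContinuousLinearMap.inverse_eq
      (mfderivWithin_extChartAt_symm_comp_mfderiv_extChartAt (I := 𝓘(ℝ, E)) hy)
      (mfderiv_extChartAt_comp_mfderivWithin_extChartAt_symm (I := 𝓘(ℝ, E)) hy)
    rw [VectorField.mpullbackWithin_apply, h2]
    rfl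
  have h3 : (mfderiv 𝓘(ℝ, E) 𝓘(ℝ, E) (extChartAt 𝓘(ℝ, E) x) x).inverse
      = ContinuousLinearMap.id ℝ E := by
    rw [mfderiv_extChartAt_self]
    exact ContinuousLinearMap.inverse_id
  have h4 : ∀ A B : E → E, A =ᶠ[𝓝 (extChartAt 𝓘(ℝ, E) x x)] fieldInChart X x →
      B =ᶠ[𝓝 (extChartAt 𝓘(ℝ, E) x x)] fieldInChart V x →
      VectorField.lieBracketWithin ℝ A B
        ((extChartAt 𝓘(ℝ, E) x).symm ⁻¹' Set.univ ∩ Set.range 𝓘(ℝ, E)) (extChartAt 𝓘(ℝ, E) x x)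
      = fderiv ℝ (fieldInChart V x) (extChartAt 𝓘(ℝ, E) x x) (X x)
        - fderiv ℝ (fieldInChart X x) (extChartAt 𝓘(ℝ, E) x x) (V x) := by
    intro A B hA hB
    rw [Set.preimage_univ, modelWithCornersSelf_coe, Set.range_id, Set.univ_inter,
      VectorField.lieBracketWithin_univ, hA.lieBracket_vectorField_eq hB, VectorField.lieBracket_eq]
    exact congrArg₂ (fun a b : E => fderiv ℝ (fieldInChart V x) (extChartAt 𝓘(ℝ, E) x x) a
      - fderiv ℝ (fieldInChart X x) (extChartAt 𝓘(ℝ, E) x x) b)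
      (fieldInChart_self X x) (fieldInChart_self V x)
  rw [VectorField.mlieBracket, VectorField.mlieBracketWithin_apply, h3]
  exact h4 _ _ (h1 X) (h1 V)

/-- The expression of a map of `M` that depends on a parameter in the charts at `x₀` and `z₀`. -/
noncomputable def flowInChart (φ : ℝ → M → M) (x₀ z₀ : M) (p : ℝ × E) : E :=
  extChartAt 𝓘(ℝ, E) z₀ (φ p.1 ((extChartAt 𝓘(ℝ, E) x₀).symm p.2))

theorem contDiffAt_flowInChart {φ : ℝ → M → M} {s : ℝ} {x : M}
    (hφ : ContMDiffAt (𝓘(ℝ, ℝ).prod 𝓘(ℝ, E)) 𝓘(ℝ, E) ∞ (fun p : ℝ × M => φ p.1 p.2) (s, x)) :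
    ContDiffAt ℝ ∞ (flowInChart φ x (φ s x)) (s, extChartAt 𝓘(ℝ, E) x x) := by
  rw [← contMDiffAt_iff_contDiffAt]
  have h1 : ContMDiffAt 𝓘(ℝ, ℝ × E) (𝓘(ℝ, ℝ).prod 𝓘(ℝ, E)) ∞
      (fun p : ℝ × E => (p.1, (extChartAt 𝓘(ℝ, E) x).symm p.2))
      (s, extChartAt 𝓘(ℝ, E) x x) := by
    refine ContMDiffAt.prodMk contDiff_fst.contDiffAt.contMDiffAt ?_
    exact ContMDiffAt.comp (I' := 𝓘(ℝ, E)) _ (contMDiffAt_extChartAt_symm_self x)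
      contDiff_snd.contDiffAt.contMDiffAt
  have h2 : ContMDiffAt (𝓘(ℝ, ℝ).prod 𝓘(ℝ, E)) 𝓘(ℝ, E) ∞ (fun p : ℝ × M => φ p.1 p.2)
      (s, (extChartAt 𝓘(ℝ, E) x).symm (extChartAt 𝓘(ℝ, E) x x)) := by
    rwa [extChartAt_to_inv]
  have h3 := ContMDiffAt.comp (g := fun p : ℝ × M => φ p.1 p.2)
    (f := fun p : ℝ × E => (p.1, (extChartAt 𝓘(ℝ, E) x).symm p.2)) _ h2 h1
  have h4 : ContMDiffAt 𝓘(ℝ, E) 𝓘(ℝ, E) ∞ (extChartAt 𝓘(ℝ, E) (φ s x))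
      (φ s ((extChartAt 𝓘(ℝ, E) x).symm (extChartAt 𝓘(ℝ, E) x x))) := by
    rw [extChartAt_to_inv]
    exact contMDiffAt_extChartAt
  exact ContMDiffAt.comp _ h4 h3

/-- The chain rule for the two factorisations of `extChartAt z₀ ∘ φ s` near `x`: through `φ s` on
the manifold, and through the chart expression of the flow. -/
theorem fderiv_flowInChart {φ : ℝ → M → M} {x₀ z₀ : M} {s : ℝ} {x : M}
    (hφ : MDifferentiableAt 𝓘(ℝ, E) 𝓘(ℝ, E) (φ s) x)
    (hx : x ∈ (extChartAt 𝓘(ℝ, E) x₀).source) (hz : φ s x ∈ (extChartAt 𝓘(ℝ, E) z₀).source)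
    (hu : DifferentiableAt ℝ (flowInChart φ x₀ z₀) (s, extChartAt 𝓘(ℝ, E) x₀ x)) (v : E) :
    chartDeriv E z₀ (φ s x) (mfderiv 𝓘(ℝ, E) 𝓘(ℝ, E) (φ s) x (v : E) : E) =
      fderiv ℝ (flowInChart φ x₀ z₀) (s, extChartAt 𝓘(ℝ, E) x₀ x) (0, chartDeriv E x₀ x v) := by
  have := isManifold_one E M
  have hx' : x ∈ (chartAt E x₀).source := by rwa [extChartAt_source] at hx
  have hz' : φ s x ∈ (chartAt E z₀).source := by rwa [extChartAt_source] at hz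
  have h1 : HasMFDerivAt 𝓘(ℝ, E) 𝓘(ℝ, E) (extChartAt 𝓘(ℝ, E) x₀) x (chartDeriv E x₀ x) :=
    (mdifferentiableAt_extChartAt hx').hasMFDerivAt
  have h2 : HasMFDerivAt 𝓘(ℝ, E) 𝓘(ℝ, E) (extChartAt 𝓘(ℝ, E) z₀) (φ s x)
      (chartDeriv E z₀ (φ s x)) := (mdifferentiableAt_extChartAt hz').hasMFDerivAt
  have h3 := h2.comp x hφ.hasMFDerivAt
  have h4 : HasFDerivAt (fun y : E => flowInChart φ x₀ z₀ (s, y))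
      ((fderiv ℝ (flowInChart φ x₀ z₀) (s, extChartAt 𝓘(ℝ, E) x₀ x)).comp
        (ContinuousLinearMap.inr ℝ ℝ E)) (extChartAt 𝓘(ℝ, E) x₀ x) :=
    hu.hasFDerivAt.comp _ (hasFDerivAt_prodMk_right s _)
  have h5 := HasMFDerivAt.comp x h4.hasMFDerivAt h1
  have h6 : (extChartAt 𝓘(ℝ, E) z₀ ∘ φ s) =ᶠ[𝓝 x]
      ((fun y : E => flowInChart φ x₀ z₀ (s, y)) ∘ extChartAt 𝓘(ℝ, E) x₀) := by
    filter_upwards [(isOpen_extChartAt_source (I := 𝓘(ℝ, E)) x₀).mem_nhds hx] with x' hx'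
    simp only [Function.comp, flowInChart]
    rw [(extChartAt 𝓘(ℝ, E) x₀).left_inv hx']
  have h7 := hasMFDerivAt_unique h3 (h5.congr_of_eventuallyEq h6)
  exact congrArg (fun B : E →L[ℝ] E => B v) h7

end Charts

/-! ### Smoothness of the field of a flow and continuity of transported pairings -/

section Flows

theorem continuous_form_apply {F : Type*} [NormedAddCommGroup F] [NormedSpace ℝ F] :
    Continuous fun q : (F [⋀^Fin 2]→L[ℝ] ℝ) × F × F => q.1 ![q.2.1, q.2.2] := by
  refine continuous_iff_continuousAt.2 fun q => ?_
  obtain ⟨L, hL, -⟩ := HasFDerivAt.form_apply (p := q) hasFDerivAt_fst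
    (hasFDerivAt_snd (𝕜 := ℝ) (E := F [⋀^Fin 2]→L[ℝ] ℝ) (F := F × F)).fst
    (hasFDerivAt_snd (𝕜 := ℝ) (E := F [⋀^Fin 2]→L[ℝ] ℝ) (F := F × F)).snd
  exact hL.continuousAt

variable {E : Type*} [NormedAddCommGroup E] [NormedSpace ℝ E]
  {M : Type*} [TopologicalSpace M] [ChartedSpace E M] [IsManifold 𝓘(ℝ, E) ∞ M]
  {X : (x : M) → TangentSpace 𝓘(ℝ, E) x} {D : Set (ℝ × M)} {φ : ℝ → M → M}

variable (E) in
/-- The differential at `x` of the time `t` map of a flow, as an endomorphism of the model space. -/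
noncomputable def flowDeriv (φ : ℝ → M → M) (t : ℝ) (x : M) : E →L[ℝ] E :=
  mfderiv 𝓘(ℝ, E) 𝓘(ℝ, E) (φ t) x

theorem IsFlow.contMDiffAt (h : IsFlow X D φ) {t : ℝ} {x : M} (hx : (t, x) ∈ D) :
    ContMDiffAt (𝓘(ℝ, ℝ).prod 𝓘(ℝ, E)) 𝓘(ℝ, E) ∞ (fun p : ℝ × M => φ p.1 p.2) (t, x) :=
  h.smooth.contMDiffAt (h.isOpen.mem_nhds hx)

theorem IsFlow.mdifferentiableAt (h : IsFlow X D φ) {t : ℝ} {x : M} (hx : (t, x) ∈ D) :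
    MDifferentiableAt 𝓘(ℝ, E) 𝓘(ℝ, E) (φ t) x := by
  have h1 := (h.contMDiffAt hx).mdifferentiableAt (by simp)
  have h2 : MDifferentiableAt 𝓘(ℝ, E) (𝓘(ℝ, ℝ).prod 𝓘(ℝ, E)) (fun y : M => (t, y)) x :=
    mdifferentiableAt_const.prodMk mdifferentiableAt_id
  exact h1.comp x h2

theorem eventually_differentiableAt_of_contDiffAt {F G : Type*} [NormedAddCommGroup F]
    [NormedSpace ℝ F] [NormedAddCommGroup G] [NormedSpace ℝ G] {f : F → G} {x : F}
    (hf : ContDiffAt ℝ ∞ f x) : ∀ᶠ y in 𝓝 x, DifferentiableAt ℝ f y := by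
  have h1 : ContDiffAt ℝ 1 f x := hf.of_le (by norm_cast)
  exact (h1.eventually (by simp)).mono fun y hy => hy.differentiableAt (by simp)

/-- The flow near time zero, in a chart. -/
theorem IsFlow.flowInChart_spec (h : IsFlow X D φ) (x : M) :
    ContDiffAt ℝ ∞ (flowInChart φ x x) (0, extChartAt 𝓘(ℝ, E) x x) ∧
    (∀ᶠ y in 𝓝 (extChartAt 𝓘(ℝ, E) x x), flowInChart φ x x (0, y) = y) ∧
    ∀ᶠ y in 𝓝 (extChartAt 𝓘(ℝ, E) x x),
      fderiv ℝ (flowInChart φ x x) (0, y) (1, 0) = fieldInChart X x y := by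
  have := isManifold_one E M
  have h1 : ContDiffAt ℝ ∞ (flowInChart φ x x) (0, extChartAt 𝓘(ℝ, E) x x) := by
    have := contDiffAt_flowInChart (h.contMDiffAt (h.zero_mem x))
    rwa [h.zero] at this
  have ht : ∀ᶠ y in 𝓝 (extChartAt 𝓘(ℝ, E) x x), y ∈ (extChartAt 𝓘(ℝ, E) x).target :=
    (isOpen_extChartAt_target (I := 𝓘(ℝ, E)) x).mem_nhds (mem_extChartAt_target x)
  refine ⟨h1, ?_, ?_⟩
  · filter_upwards [ht] with y hy
    simp only [flowInChart, h.zero]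
    exact (extChartAt 𝓘(ℝ, E) x).right_inv hy
  · have hd : ∀ᶠ y in 𝓝 (extChartAt 𝓘(ℝ, E) x x),
        DifferentiableAt ℝ (flowInChart φ x x) (0, y) := by
      have hc : Filter.Tendsto (fun y : E => ((0 : ℝ), y)) (𝓝 (extChartAt 𝓘(ℝ, E) x x))
          (𝓝 (0, extChartAt 𝓘(ℝ, E) x x)) := (Continuous.prodMk_right 0).tendsto _
      exact hc.eventually (eventually_differentiableAt_of_contDiffAt h1)
    filter_upwards [ht, hd] with y hy hyd
    set x' := (extChartAt 𝓘(ℝ, E) x).symm y with hx'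
    have hx's : x' ∈ (extChartAt 𝓘(ℝ, E) x).source := (extChartAt 𝓘(ℝ, E) x).map_target hy
    have hI : {t : ℝ | (t, x') ∈ D} ∈ 𝓝 (0 : ℝ) :=
      (h.isOpen.preimage (by fun_prop : Continuous fun t : ℝ => (t, x'))).mem_nhds (h.zero_mem x')
    have h2 := (h.integralCurve x' 0 (h.zero_mem x')).hasMFDerivAt hI
    have h3 : HasMFDerivAt 𝓘(ℝ, E) 𝓘(ℝ, E) (extChartAt 𝓘(ℝ, E) x) (φ 0 x')
        (chartDeriv E x (φ 0 x')) := by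
      refine (mdifferentiableAt_extChartAt ?_).hasMFDerivAt
      rw [h.zero]
      rwa [extChartAt_source] at hx's
    have h4 := h3.comp (0 : ℝ) h2
    have h5 : HasDerivAt (fun t : ℝ => flowInChart φ x x (t, y))
        (fderiv ℝ (flowInChart φ x x) (0, y) (1, 0)) 0 :=
      HasFDerivAt.comp_hasDerivAt (f := fun t : ℝ => (t, y)) (0 : ℝ) hyd.hasFDerivAt
        ((hasDerivAt_id _).prodMk (hasDerivAt_const _ _))
    have h6 := congrArg (fun B : ℝ →L[ℝ] E => B 1) (hasMFDerivAt_unique h5.hasFDerivAt.hasMFDerivAt h4)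
    have h7 : fderiv ℝ (flowInChart φ x x) (0, y) (1, 0)
        = chartDeriv E x (φ 0 x') ((1 : ℝ) • (X (φ 0 x') : E)) := by
      refine Eq.trans ?_ h6
      exact (one_smul ℝ _).symm
    rw [h7, one_smul, h.zero]
    rfl

/-- The field inherits its smoothness from the flow, being the time derivative of the flow at zero.
-/
theorem IsFlow.smooth_field (h : IsFlow X D φ) (x : M) :
    ContMDiffAt 𝓘(ℝ, E) 𝓘(ℝ, E).tangent ∞ (fun x => (⟨x, X x⟩ : TangentBundle 𝓘(ℝ, E) M)) x := by
  obtain ⟨h1, h2, h3⟩ := h.flowInChart_spec x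
  exact contDiffAt_fieldInChart_iff.1 (hasDerivAt_fderiv_flow h1 h2 h3).1

/-- The flow of nearby points, in charts. -/
theorem IsFlow.eventually_fderiv_flowInChart (h : IsFlow X D φ) {s₀ : ℝ} {x₀ : M}
    (hx : (s₀, x₀) ∈ D) :
    ∀ᶠ p in 𝓝 (s₀, x₀), p.2 ∈ (extChartAt 𝓘(ℝ, E) x₀).source ∧
      φ p.1 p.2 ∈ (extChartAt 𝓘(ℝ, E) (φ s₀ x₀)).source ∧
      ∀ v : E, chartDeriv E (φ s₀ x₀) (φ p.1 p.2) (flowDeriv E φ p.1 p.2 v) =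
        fderiv ℝ (flowInChart φ x₀ (φ s₀ x₀)) (p.1, extChartAt 𝓘(ℝ, E) x₀ p.2)
          (0, chartDeriv E x₀ p.2 v) := by
  have h1 : ∀ᶠ p : ℝ × M in 𝓝 (s₀, x₀), p.2 ∈ (extChartAt 𝓘(ℝ, E) x₀).source :=
    continuous_snd.continuousAt.eventually (extChartAt_source_mem_nhds (I := 𝓘(ℝ, E)) x₀)
  have hc : ContinuousAt (fun p : ℝ × M => φ p.1 p.2) (s₀, x₀) := (h.contMDiffAt hx).continuousAt
  have h2 : ∀ᶠ p : ℝ × M in 𝓝 (s₀, x₀), φ p.1 p.2 ∈ (extChartAt 𝓘(ℝ, E) (φ s₀ x₀)).source :=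
    hc.eventually (extChartAt_source_mem_nhds (I := 𝓘(ℝ, E)) (φ s₀ x₀))
  have hc' : ContinuousAt (fun p : ℝ × M => (p.1, extChartAt 𝓘(ℝ, E) x₀ p.2)) (s₀, x₀) :=
    continuousAt_fst.prodMk
      (ContinuousAt.comp (g := extChartAt 𝓘(ℝ, E) x₀) (continuousAt_extChartAt x₀) continuousAt_snd)
  have h3 : ∀ᶠ p : ℝ × M in 𝓝 (s₀, x₀), DifferentiableAt ℝ (flowInChart φ x₀ (φ s₀ x₀))
      (p.1, extChartAt 𝓘(ℝ, E) x₀ p.2) :=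
    hc'.eventually (eventually_differentiableAt_of_contDiffAt
      (contDiffAt_flowInChart (h.contMDiffAt hx)))
  filter_upwards [h1, h2, h3, h.isOpen.mem_nhds hx] with p hp1 hp2 hp3 hp4
  exact ⟨hp1, hp2, fun v => fderiv_flowInChart (h.mdifferentiableAt hp4) hp1 hp2 hp3 v⟩

/-- The pairings of transported vector fields are continuous. -/
theorem IsFlow.continuousAt_form (h : IsFlow X D φ)
    {Ω : (x : M) → TangentSpace 𝓘(ℝ, E) x [⋀^Fin 2]→L[ℝ] ℝ} (hΩ : IsSymplecticForm Ω)
    {V W : M → E} {s₀ : ℝ} {x₀ : M} (hx : (s₀, x₀) ∈ D)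
    (hV : ContMDiffAt 𝓘(ℝ, E) 𝓘(ℝ, E).tangent ∞
      (fun x => (⟨x, V x⟩ : TangentBundle 𝓘(ℝ, E) M)) x₀)
    (hW : ContMDiffAt 𝓘(ℝ, E) 𝓘(ℝ, E).tangent ∞
      (fun x => (⟨x, W x⟩ : TangentBundle 𝓘(ℝ, E) M)) (φ s₀ x₀)) :
    ContinuousAt (fun p : ℝ × M => Ω (φ p.1 p.2)
      ![(flowDeriv E φ p.1 p.2 (V p.2) : TangentSpace 𝓘(ℝ, E) (φ p.1 p.2)), W (φ p.1 p.2)])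
      (s₀, x₀) := by
  have hc : ContinuousAt (fun p : ℝ × M => φ p.1 p.2) (s₀, x₀) := (h.contMDiffAt hx).continuousAt
  have hz : ContinuousAt (fun p : ℝ × M => extChartAt 𝓘(ℝ, E) (φ s₀ x₀) (φ p.1 p.2)) (s₀, x₀) :=
    ContinuousAt.comp (g := extChartAt 𝓘(ℝ, E) (φ s₀ x₀)) (continuousAt_extChartAt _) hc
  have hy : ContinuousAt (fun p : ℝ × M => extChartAt 𝓘(ℝ, E) x₀ p.2) (s₀, x₀) :=
    ContinuousAt.comp (g := extChartAt 𝓘(ℝ, E) x₀) (continuousAt_extChartAt x₀) continuousAt_snd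
  have hform : ContinuousAt (formInChart Ω (φ s₀ x₀)) (extChartAt 𝓘(ℝ, E) (φ s₀ x₀) (φ s₀ x₀)) :=
    (hΩ.smooth _).continuousOn.continuousAt
      ((isOpen_extChartAt_target _).mem_nhds (mem_extChartAt_target _))
  have hu : ContinuousAt (fderiv ℝ (flowInChart φ x₀ (φ s₀ x₀))) (s₀, extChartAt 𝓘(ℝ, E) x₀ x₀) :=
    ((contDiffAt_flowInChart (h.contMDiffAt hx)).fderiv_right (m := ∞) (by norm_cast)).continuousAt
  have hV' := (contDiffAt_fieldInChart_iff.2 hV).continuousAt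
  have hW' := (contDiffAt_fieldInChart_iff.2 hW).continuousAt
  have h1 : ContinuousAt (fun p : ℝ × M => formInChart Ω (φ s₀ x₀)
      (extChartAt 𝓘(ℝ, E) (φ s₀ x₀) (φ p.1 p.2))) (s₀, x₀) :=
    ContinuousAt.comp (g := formInChart Ω (φ s₀ x₀)) hform hz
  have h2 : ContinuousAt (fun p : ℝ × M => fderiv ℝ (flowInChart φ x₀ (φ s₀ x₀))
      (p.1, extChartAt 𝓘(ℝ, E) x₀ p.2)) (s₀, x₀) :=
    ContinuousAt.comp (g := fderiv ℝ (flowInChart φ x₀ (φ s₀ x₀)))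
      (f := fun p : ℝ × M => (p.1, extChartAt 𝓘(ℝ, E) x₀ p.2)) hu (continuousAt_fst.prodMk hy)
  have h3 : ContinuousAt (fun p : ℝ × M => fieldInChart V x₀ (extChartAt 𝓘(ℝ, E) x₀ p.2))
      (s₀, x₀) := ContinuousAt.comp (g := fieldInChart V x₀) hV' hy
  have h4 : ContinuousAt (fun p : ℝ × M => fieldInChart W (φ s₀ x₀)
      (extChartAt 𝓘(ℝ, E) (φ s₀ x₀) (φ p.1 p.2))) (s₀, x₀) :=
    ContinuousAt.comp (g := fieldInChart W (φ s₀ x₀)) hW' hz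
  have h5 : ContinuousAt (fun p : ℝ × M => (formInChart Ω (φ s₀ x₀)
      (extChartAt 𝓘(ℝ, E) (φ s₀ x₀) (φ p.1 p.2)))
      ![fderiv ℝ (flowInChart φ x₀ (φ s₀ x₀)) (p.1, extChartAt 𝓘(ℝ, E) x₀ p.2)
          (0, fieldInChart V x₀ (extChartAt 𝓘(ℝ, E) x₀ p.2)),
        fieldInChart W (φ s₀ x₀) (extChartAt 𝓘(ℝ, E) (φ s₀ x₀) (φ p.1 p.2))]) (s₀, x₀) := by
    exact continuous_form_apply.continuousAt.comp
      (h1.prodMk ((h2.clm_apply (continuousAt_const.prodMk h3)).prodMk h4))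
  refine h5.congr ?_
  filter_upwards [h.eventually_fderiv_flowInChart hx] with p ⟨hp1, hp2, hp3⟩
  refine (congrArg₂ (fun a b : E => formInChart Ω (φ s₀ x₀)
    (extChartAt 𝓘(ℝ, E) (φ s₀ x₀) (φ p.1 p.2)) ![fderiv ℝ (flowInChart φ x₀ (φ s₀ x₀))
      (p.1, extChartAt 𝓘(ℝ, E) x₀ p.2) (0, a), b]) (fieldInChart_extChartAt (V := V) hp1)
    (fieldInChart_extChartAt (V := W) hp2)).trans ?_
  exact (congrArg (fun a : E => formInChart Ω (φ s₀ x₀)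
    (extChartAt 𝓘(ℝ, E) (φ s₀ x₀) (φ p.1 p.2)) ![a, chartDeriv E (φ s₀ x₀) (φ p.1 p.2)
      (W (φ p.1 p.2))]) (hp3 (V p.2))).symm.trans (formAt_eq_formInChart Ω hp2 _ _).symm

end Flows

/-! ### Invariance of the symplectic form and derivatives of pulled back fields -/

namespace HamiltonianLevel

variable {E : Type*} [NormedAddCommGroup E] [NormedSpace ℝ E]
  {M : Type*} [TopologicalSpace M] [ChartedSpace E M] [IsManifold 𝓘(ℝ, E) ∞ M]
  (S : HamiltonianLevel E M)

/-- The vector field `V` is smooth at the point `x`. -/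
def SmoothFieldAt (V : M → E) (x : M) : Prop :=
  ContMDiffAt 𝓘(ℝ, E) 𝓘(ℝ, E).tangent ∞ (fun x => (⟨x, V x⟩ : TangentBundle 𝓘(ℝ, E) M)) x

/-- The Hamiltonian vector field, with values in the model space. -/
def ham (x : M) : E := S.X x

/-- The Lie bracket with the Hamiltonian vector field. -/
noncomputable def lieX (V : M → E) (x : M) : E := VectorField.mlieBracket 𝓘(ℝ, E) S.X V x

theorem smoothFieldAt_ham (x : M) : SmoothFieldAt S.ham x := S.flow.smooth_field x

theorem SmoothFieldAt.lieX [CompleteSpace E] {V : M → E} {x : M}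
    (hV : SmoothFieldAt V x) : SmoothFieldAt (S.lieX V) x := by
  have : IsManifold 𝓘(ℝ, E) (minSmoothness ℝ 2) M := by
    rw [minSmoothness_of_isRCLikeNormedField]
    exact IsManifold.of_le (n := ∞) (by norm_cast)
  have : IsManifold 𝓘(ℝ, E) (((⊤ : ℕ∞) : WithTop ℕ∞) + 1) M := by
    have e : (((⊤ : ℕ∞) : WithTop ℕ∞) + 1) = ∞ := by norm_cast
    rw [e]; infer_instance
  exact ContMDiffAt.mlieBracket_vectorField (m := ⊤) (n := ⊤) (S.smoothFieldAt_ham x) hV (by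
    rw [minSmoothness_of_isRCLikeNormedField]; norm_cast)

/-- The symplectic form at `x`, as a bilinear form on the model space. -/
noncomputable def form (x : M) : E →ₗ[ℝ] E →ₗ[ℝ] ℝ := formAt S.Ω x

theorem isSymplecticBilin_form (x : M) : IsSymplecticBilin (S.form x) where
  skew := formAt_skew S.Ω x
  nondeg := S.symplectic.nondegenerate x

variable {S} {x : M}

theorem φ_mem (hx : x ∈ S.level) (t : ℝ) : S.φ t x ∈ S.level :=
  (S.H_φ (S.complete t x hx)).trans hx

theorem φ_φ (hx : x ∈ S.level) (s t : ℝ) : S.φ s (S.φ t x) = S.φ (s + t) x :=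
  S.flow.comp s t x (S.complete t x hx) (S.complete s _ (φ_mem hx t)) (S.complete (s + t) x hx)

variable (S) in
theorem continuous_φ (hx : x ∈ S.level) : Continuous fun s => S.φ s x := by
  refine continuous_iff_continuousAt.2 fun s => ?_
  exact ContinuousAt.comp (g := fun p : ℝ × M => S.φ p.1 p.2) (f := fun s : ℝ => (s, x))
    (S.flow.contMDiffAt (S.complete s x hx)).continuousAt (by fun_prop)

theorem φ_neg_φ (hx : x ∈ S.level) (t : ℝ) : S.φ (-t) (S.φ t x) = x := by
  rw [φ_φ hx, neg_add_cancel, S.flow.zero]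

variable (S) in
/-- The differential `dφ_t` at `x` as an endomorphism of the model space. -/
noncomputable def T (t : ℝ) (x : M) : E →L[ℝ] E := flowDeriv E S.φ t x

theorem T_zero (x : M) (v : E) : S.T 0 x v = v := by
  have h1 : S.φ 0 = id := funext S.flow.zero
  have h2 : HasMFDerivAt 𝓘(ℝ, E) 𝓘(ℝ, E) (S.φ 0) x (ContinuousLinearMap.id ℝ E) := by
    rw [h1]; exact hasMFDerivAt_id x
  exact congrArg (fun B : E →L[ℝ] E => B v) h2.mfderiv

theorem T_T (hx : x ∈ S.level) (s t : ℝ) (v : E) :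
    S.T s (S.φ t x) (S.T t x v) = S.T (s + t) x v := by
  have hD := S.complete t x hx
  have hD' := S.complete s _ (φ_mem hx t)
  have h1 := (S.flow.mdifferentiableAt hD').hasMFDerivAt.comp x
    (S.flow.mdifferentiableAt hD).hasMFDerivAt
  have hc : ContinuousAt (fun y => (s, S.φ t y)) x :=
    continuousAt_const.prodMk (S.flow.mdifferentiableAt hD).continuousAt
  have ho : ∀ t : ℝ, IsOpen {y : M | (t, y) ∈ S.D} := fun t =>
    S.flow.isOpen.preimage (by fun_prop : Continuous fun y : M => (t, y))
  have h2 : S.φ (s + t) =ᶠ[𝓝 x] S.φ s ∘ S.φ t := by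
    filter_upwards [(ho t).mem_nhds hD, (ho (s + t)).mem_nhds (S.complete (s + t) x hx),
      hc.eventually (S.flow.isOpen.mem_nhds hD')] with y h1 h2 h3
    exact (S.flow.comp s t y h1 h3 h2).symm
  exact (congrArg (fun B : E →L[ℝ] E => B v) (h1.congr_of_eventuallyEq h2).mfderiv).symm

theorem T_neg_T (hx : x ∈ S.level) (t : ℝ) (v : E) : S.T (-t) (S.φ t x) (S.T t x v) = v := by
  rw [T_T hx, neg_add_cancel, T_zero]

theorem T_T_neg (hx : x ∈ S.level) (t : ℝ) (v : E) : S.T t x (S.T (-t) (S.φ t x) v) = v := by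
  have h := T_neg_T (φ_mem hx t) (-t) v
  rwa [neg_neg, φ_neg_φ hx] at h

theorem T_ham (hx : x ∈ S.level) (t : ℝ) : S.T t x (S.ham x) = S.ham (S.φ t x) := S.dφ_X t ⟨x, hx⟩

variable (S) in
/-- Short-time behaviour of the flow in the chart at the initial point. -/
theorem chart_T_spec (x : M) :
    ContDiffAt ℝ ∞ (fieldInChart S.X x) (extChartAt 𝓘(ℝ, E) x x) ∧
    ∃ (A : ℝ → E →L[ℝ] E) (y : ℝ → E), y 0 = extChartAt 𝓘(ℝ, E) x x ∧
      HasDerivAt A (fderiv ℝ (fieldInChart S.X x) (y 0)) 0 ∧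
      A 0 = ContinuousLinearMap.id ℝ E ∧ HasDerivAt y (S.X x) 0 ∧
      ∀ᶠ h in 𝓝 (0 : ℝ), S.φ h x ∈ (extChartAt 𝓘(ℝ, E) x).source ∧
        y h = extChartAt 𝓘(ℝ, E) x (S.φ h x) ∧
        ∀ v : E, chartDeriv E x (S.φ h x) (S.T h x v) = A h v := by
  obtain ⟨h1, h2, h3⟩ := S.flow.flowInChart_spec x
  obtain ⟨h4, h5, h6, h7⟩ := hasDerivAt_fderiv_flow h1 h2 h3
  have hy : ∀ h, flowInChart S.φ x x (h, extChartAt 𝓘(ℝ, E) x x)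
      = extChartAt 𝓘(ℝ, E) x (S.φ h x) := fun h => by
    simp only [flowInChart, extChartAt_to_inv]
  have hy0 : flowInChart S.φ x x (0, extChartAt 𝓘(ℝ, E) x x) = extChartAt 𝓘(ℝ, E) x x := by
    rw [hy, S.flow.zero]
  refine ⟨h4, fun h => (fderiv ℝ (flowInChart S.φ x x) (h, extChartAt 𝓘(ℝ, E) x x)).comp
    (ContinuousLinearMap.inr ℝ ℝ E), fun h => flowInChart S.φ x x (h, extChartAt 𝓘(ℝ, E) x x),
    hy0, ?_, h6, h7.congr_deriv (fieldInChart_self S.X x), ?_⟩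
  · simp only [hy0]; exact h5
  · have hc : Filter.Tendsto (fun h : ℝ => (h, x)) (𝓝 0) (𝓝 (0, x)) :=
      (Continuous.prodMk_left x).tendsto 0
    have h8 := S.flow.eventually_fderiv_flowInChart (S.flow.zero_mem x)
    rw [S.flow.zero] at h8
    filter_upwards [hc.eventually h8] with h ⟨hh1, hh2, hh3⟩
    refine ⟨hh2, hy h, fun v => (hh3 v).trans ?_⟩
    rw [chartDeriv_self]
    rfl

/-- The derivative is the Lie derivative of the form along `X` in the chart at `x`; it vanishes
because the form is closed and `X` is Hamiltonian. -/
theorem hasDerivAt_form_T_zero (x : M) (v w : E) :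
    HasDerivAt (fun h => S.form (S.φ h x) (S.T h x v) (S.T h x w)) 0 0 := by
  obtain ⟨hX, A, y, hy0, hA, hA0, hy, hev⟩ := chart_T_spec S x
  have hΩ : DifferentiableAt ℝ (formInChart S.Ω x) (y 0) := by
    rw [hy0]
    exact ((S.symplectic.smooth x).contDiffAt ((isOpen_extChartAt_target x).mem_nhds
      (mem_extChartAt_target x))).differentiableAt (by simp)
  have h1 := hasDerivAt_form_flow hA hA0 hy hΩ v w
  have h2 : fderiv ℝ (formInChart S.Ω x) (y 0) (S.X x) ![v, w]
      + formInChart S.Ω x (y 0) ![fderiv ℝ (fieldInChart S.X x) (y 0) v, w]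
      + formInChart S.Ω x (y 0) ![v, fderiv ℝ (fieldInChart S.X x) (y 0) w] = 0 := by
    rw [hy0] at hΩ ⊢
    have hXx : fieldInChart S.X x (extChartAt 𝓘(ℝ, E) x x) = S.X x := fieldInChart_self S.X x
    have h3 := lieDerivative_form_eq_zero (H := S.H ∘ (extChartAt 𝓘(ℝ, E) x).symm) hΩ
      (S.symplectic.closed x _ (mem_extChartAt_target x)) (hX.differentiableAt (by simp)) ?_ ?_ v w
    · exact (congrArg (fun a : E => fderiv ℝ (formInChart S.Ω x) (extChartAt 𝓘(ℝ, E) x x) a ![v, w]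
        + formInChart S.Ω x (extChartAt 𝓘(ℝ, E) x x)
          ![fderiv ℝ (fieldInChart S.X x) (extChartAt 𝓘(ℝ, E) x x) v, w]
        + formInChart S.Ω x (extChartAt 𝓘(ℝ, E) x x)
          ![v, fderiv ℝ (fieldInChart S.X x) (extChartAt 𝓘(ℝ, E) x x) w]) hXx).symm.trans h3
    · have h4 : ContMDiffAt 𝓘(ℝ, E) 𝓘(ℝ, ℝ) ∞ (S.H ∘ (extChartAt 𝓘(ℝ, E) x).symm)
          (extChartAt 𝓘(ℝ, E) x x) :=
        (S.smooth_H _).comp _ (contMDiffAt_extChartAt_symm_self x)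
      exact (contMDiffAt_iff_contDiffAt.1 h4).of_le (by norm_cast)
    · filter_upwards [(isOpen_extChartAt_target (I := 𝓘(ℝ, E)) x).mem_nhds
        (mem_extChartAt_target x)] with z hz w
      have hzs := (extChartAt 𝓘(ℝ, E) x).map_target hz
      have h4 : HasMFDerivAt 𝓘(ℝ, E) 𝓘(ℝ, E) (extChartAt 𝓘(ℝ, E) x).symm z
          (mfderiv 𝓘(ℝ, E) 𝓘(ℝ, E) (extChartAt 𝓘(ℝ, E) x).symm z) :=
        (((contMDiffOn_extChartAt_symm x).contMDiffAt
          ((isOpen_extChartAt_target x).mem_nhds hz)).mdifferentiableAt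
            (n := ∞) (by simp)).hasMFDerivAt
      have h5 : HasMFDerivAt 𝓘(ℝ, E) 𝓘(ℝ, ℝ) S.H ((extChartAt 𝓘(ℝ, E) x).symm z)
          (mfderiv 𝓘(ℝ, E) 𝓘(ℝ, ℝ) S.H ((extChartAt 𝓘(ℝ, E) x).symm z)) :=
        ((S.smooth_H _).mdifferentiableAt (by simp)).hasMFDerivAt
      have h6 : ∀ (B : E →L[ℝ] E) (B' : E →L[ℝ] ℝ),
          HasMFDerivAt 𝓘(ℝ, E) 𝓘(ℝ, E) (extChartAt 𝓘(ℝ, E) x).symm z B →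
          HasMFDerivAt 𝓘(ℝ, E) 𝓘(ℝ, ℝ) S.H ((extChartAt 𝓘(ℝ, E) x).symm z) B' →
          fderiv ℝ (S.H ∘ (extChartAt 𝓘(ℝ, E) x).symm) z = B'.comp B := by
        intro B B' hB hB'
        have h : HasMFDerivAt 𝓘(ℝ, E) 𝓘(ℝ, ℝ) (S.H ∘ (extChartAt 𝓘(ℝ, E) x).symm) z
          (B'.comp B : E →L[ℝ] ℝ) := HasMFDerivAt.comp z hB' hB
        have h' : HasFDerivAt (S.H ∘ (extChartAt 𝓘(ℝ, E) x).symm) (B'.comp B : E →L[ℝ] ℝ) z :=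
          hasMFDerivAt_iff_hasFDerivAt.1 h
        exact h'.fderiv
      have h7 := S.hamiltonian ((extChartAt 𝓘(ℝ, E) x).symm z)
        (mfderiv 𝓘(ℝ, E) 𝓘(ℝ, E) (extChartAt 𝓘(ℝ, E) x).symm z w)
      have h8 := symm_chartDeriv hzs (S.X ((extChartAt 𝓘(ℝ, E) x).symm z))
      rw [(extChartAt 𝓘(ℝ, E) x).right_inv hz] at h8
      refine Eq.trans ?_ (h7.trans (congrArg Neg.neg
        (congrArg (fun B : E →L[ℝ] ℝ => B w) (h6 _ _ h4 h5)).symm))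
      refine congrArg (S.Ω ((extChartAt 𝓘(ℝ, E) x).symm z) : (Fin 2 → E) → ℝ) ?_
      ext i
      fin_cases i
      · exact h8
      · rfl
  refine (h1.congr_deriv h2).congr_of_eventuallyEq ?_
  filter_upwards [hev] with h ⟨hh1, hh2, hh3⟩
  rw [← hh3, ← hh3, hh2]
  exact formAt_eq_formInChart S.Ω hh1 _ _

/-- The group law moves the vanishing of the derivative from time zero to every time, so the pulled
back form is constant. -/
theorem form_T (hx : x ∈ S.level) (t : ℝ) (v w : E) :
    S.form (S.φ t x) (S.T t x v) (S.T t x w) = S.form x v w := by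
  have h1 : ∀ s, HasDerivAt (fun h => S.form (S.φ h x) (S.T h x v) (S.T h x w)) 0 s := by
    intro s
    have h2 := hasDerivAt_form_T_zero (S := S) (S.φ s x) (S.T s x v) (S.T s x w)
    simp only [T_T hx, φ_φ hx] at h2
    have h4 : HasDerivAt (fun h => S.form (S.φ (h + s) x) (S.T (h + s) x v) (S.T (h + s) x w)) 0
      (s - s) := by rwa [sub_self]
    simpa using h4.comp_sub_const s s
  have h2 := is_const_of_deriv_eq_zero (fun s => (h1 s).differentiableAt)
    (fun s => (h1 s).deriv) t 0
  simpa only [T_zero, S.flow.zero] using h2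

variable (S) in
/-- The pullback to `x` of the value of the vector field `V` at `φ_s(x)`. -/
noncomputable def pull (V : M → E) (x : M) (s : ℝ) : E :=
  S.T (-s) (S.φ s x) (V (S.φ s x))

theorem pull_zero (V : M → E) (x : M) : S.pull V x 0 = V x := by
  rw [pull, neg_zero, S.flow.zero]
  exact T_zero x (V x)

theorem pull_add (hx : x ∈ S.level) (V : M → E) (s h : ℝ) :
    S.pull V x (h + s) = S.T (-s) (S.φ s x) (S.pull V (S.φ s x) h) := by
  have h1 := φ_neg_φ (φ_mem hx s) h
  have h2 := T_T (φ_mem (φ_mem hx s) h) (-s) (-h) (V (S.φ h (S.φ s x)))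
  rw [h1] at h2
  rw [pull, pull, h2, φ_φ hx, neg_add_rev]

theorem T_pull (hx : x ∈ S.level) (V : M → E) (s : ℝ) :
    S.T s x (S.pull V x s) = V (S.φ s x) := T_T_neg hx s _

variable [CompleteSpace E]

theorem hasDerivAt_pull_zero (hx : x ∈ S.level) {V : M → E}
    (hV : SmoothFieldAt V x) :
    HasDerivAt (S.pull V x) (S.lieX V x) 0 := by
  obtain ⟨hX, A, y, hy0, hA, hA0, hy, hev⟩ := chart_T_spec S x
  have hV' : DifferentiableAt ℝ (fieldInChart V x) (y 0) := by
    rw [hy0]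
    exact (contDiffAt_fieldInChart_iff.2 hV).differentiableAt (by simp)
  have h1 := hasDerivAt_pullback_flow (e := S.pull V x) hA hA0 hy hV' ?_
  · refine h1.congr_deriv ?_
    rw [hy0, fieldInChart_self]
    exact (mlieBracket_eq_fieldInChart S.X V x).symm
  · filter_upwards [hev] with h ⟨hh1, hh2, hh3⟩
    refine (hh3 _).symm.trans ?_
    rw [hh2, fieldInChart_extChartAt hh1, T_pull hx]

/-- By the group law the pullback near time `s` is a fixed linear map applied to the pullback near
time zero at the point `φ_s(x)`, where the derivative is the Lie bracket. -/
theorem hasDerivAt_pull (hx : x ∈ S.level) {V : M → E} {s : ℝ}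
    (hV : SmoothFieldAt V (S.φ s x)) :
    HasDerivAt (S.pull V x) (S.pull (S.lieX V) x s) s := by
  have h1 := hasDerivAt_pull_zero (φ_mem hx s) hV
  have h2 : HasDerivAt (S.pull V (S.φ s x)) (S.lieX V (S.φ s x))
    (s - s) := by rwa [sub_self]
  have h3 := h2.comp_sub_const s s
  have h4 := (S.T (-s) (S.φ s x)).hasFDerivAt.comp_hasDerivAt s h3
  have h5 : S.pull V x = S.T (-s) (S.φ s x) ∘ S.pull V (S.φ s x) ∘ fun r => r - s := by
    funext r
    simp only [Function.comp]
    rw [← pull_add hx, sub_add_cancel]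
  rw [h5]
  exact h4

/-- Differentiation of a pullback replaces `V` by `[X, V]`, again a smooth field on `U`; hence the
induction, in which `V` varies. -/
theorem contDiffOn_pull (hx : x ∈ S.level) {U : Set M} (hU : IsOpen U) :
    ∀ (n : ℕ) {V : M → E}, (∀ z ∈ U, SmoothFieldAt V z) →
      ContDiffOn ℝ n (S.pull V x) {s | S.φ s x ∈ U} := by
  intro n
  induction n with
  | zero =>
    intro V hV
    rw [Nat.cast_zero, contDiffOn_zero]
    exact fun s hs => (hasDerivAt_pull hx (hV _ hs)).continuousAt.continuousWithinAt
  | succ n ih =>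
    intro V hV
    have ho : IsOpen {s | S.φ s x ∈ U} := by
      exact hU.preimage (continuous_φ S hx)
    rw [Nat.cast_add, Nat.cast_one, contDiffOn_succ_iff_deriv_of_isOpen ho]
    refine ⟨fun s hs => (hasDerivAt_pull hx (hV _ hs)).differentiableAt.differentiableWithinAt,
      by simp, (ih fun z hz => SmoothFieldAt.lieX S (hV z hz)).congr fun s hs =>
        (hasDerivAt_pull hx (hV _ hs)).deriv⟩

theorem contDiffAt_pull (hx : x ∈ S.level) {U : Set M} (hU : IsOpen U)
    {V : M → E} (hV : ∀ z ∈ U, SmoothFieldAt V z) {s : ℝ}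
    (hs : S.φ s x ∈ U) : ContDiffAt ℝ ∞ (S.pull V x) s :=
  contDiffAt_infty.2 fun n => (contDiffOn_pull hx hU n hV).contDiffAt
    ((hU.preimage (continuous_φ S hx)).mem_nhds hs)

end HamiltonianLevel

/-! ### Exponential decay on Green bundles by compactness -/

section Hyperbolicity

open Filter

/-- The dynamical properties of a linear flow `Ψ` with norm `N`, over a compact base, which has a
Lagrangian distribution `L` and the Green bundles `Gp` and `Gm`. -/
structure IsGreenSystem {P : Type*} (Ψ : ℝ → P → P) (N : P → ℝ) (L Gp Gm : Set P) (C : ℝ) :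
    Prop where
  one_le : 1 ≤ C
  zero : ∀ p, Ψ 0 p = p
  add : ∀ s t p, Ψ s (Ψ t p) = Ψ (s + t) p
  nonneg : ∀ p, 0 ≤ N p
  short : ∀ s p, |s| ≤ 1 → N (Ψ s p) ≤ C * N p
  -- The vector `q` plays the role of the limit of `p k / a k`. Estimates survive only up to the
  -- factor `C`, since continuity of `N` in the base point is not assumed. The ultrafilter provides
  -- one limit that serves all times `s`.
  limit : ∀ (p : ℕ → P) (a : ℕ → ℝ), (∀ k, 0 < a k) → (∃ K, ∀ k, N (p k) ≤ K * a k) →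
    ∃ q, ∀ s, (∀ b, (∀ᶠ k in (hyperfilter ℕ : Filter ℕ), N (Ψ s (p k)) ≤ b * a k) →
        N (Ψ s q) ≤ C * b) ∧
      (∀ b, (∀ᶠ k in (hyperfilter ℕ : Filter ℕ), b * a k ≤ N (Ψ s (p k))) →
        b ≤ C * N (Ψ s q)) ∧
      ((∀ᶠ k in (hyperfilter ℕ : Filter ℕ), Ψ s (p k) ∈ L) → Ψ s q ∈ L)
  mem_p : ∀ p, (∃ K, ∀ t, 0 ≤ t → N (Ψ t p) ≤ K) → p ∈ Gp
  mem_m : ∀ p, (∃ K, ∀ t, t ≤ 0 → N (Ψ t p) ≤ K) → p ∈ Gm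
  disjoint_p : ∀ p, p ∈ Gp → p ∈ L → N p = 0
  disjoint_m : ∀ p, p ∈ Gm → p ∈ L → N p = 0
  approx_p : ∀ p ∈ Gp, ∃ u : ℝ → P, (∀ᶠ T in atTop, Ψ T (u T) ∈ L) ∧
    ∀ s, Tendsto (fun T => N (Ψ s (u T))) atTop (𝓝 (N (Ψ s p)))
  approx_m : ∀ p ∈ Gm, ∃ u : ℝ → P, (∀ᶠ T in atBot, Ψ T (u T) ∈ L) ∧
    ∀ s, Tendsto (fun T => N (Ψ s (u T))) atBot (𝓝 (N (Ψ s p)))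
  inv_p : ∀ s, ∀ p ∈ Gp, Ψ s p ∈ Gp
  inv_m : ∀ s, ∀ p ∈ Gm, Ψ s p ∈ Gm

namespace IsGreenSystem

variable {P : Type*} {Ψ : ℝ → P → P} {N : P → ℝ} {L Gp Gm : Set P} {C : ℝ}

theorem reverse (h : IsGreenSystem Ψ N L Gp Gm C) :
    IsGreenSystem (fun s => Ψ (-s)) N L Gm Gp C where
  one_le := h.one_le
  zero p := by rw [neg_zero, h.zero]
  add s t p := by rw [h.add, neg_add]
  nonneg := h.nonneg
  short s p hs := h.short _ p (by rwa [abs_neg])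
  limit p a ha hK := by
    obtain ⟨q, hq⟩ := h.limit p a ha hK
    exact ⟨q, fun s => hq (-s)⟩
  mem_p p := fun ⟨K, hK⟩ => h.mem_m p ⟨K, fun t ht => by simpa using hK (-t) (by linarith)⟩
  mem_m p := fun ⟨K, hK⟩ => h.mem_p p ⟨K, fun t ht => by simpa using hK (-t) (by linarith)⟩
  disjoint_p := h.disjoint_m
  disjoint_m := h.disjoint_p
  approx_p p hp := by
    obtain ⟨u, h1, h2⟩ := h.approx_m p hp
    exact ⟨fun T => u (-T), tendsto_neg_atTop_atBot.eventually h1,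
      fun s => (h2 (-s)).comp tendsto_neg_atTop_atBot⟩
  approx_m p hp := by
    obtain ⟨u, h1, h2⟩ := h.approx_p p hp
    exact ⟨fun T => u (-T), tendsto_neg_atBot_atTop.eventually h1,
      fun s => (h2 (-s)).comp tendsto_neg_atBot_atTop⟩
  inv_p s := h.inv_m (-s)
  inv_m s := h.inv_p (-s)

theorem norm_nat_le (h : IsGreenSystem Ψ N L Gp Gm C) (n : ℕ) (p : P) :
    N (Ψ n p) ≤ C ^ n * N p := by
  induction n with
  | zero => simp [h.zero]
  | succ n ih =>
    have h1 := h.short 1 (Ψ n p) (by simp)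
    rw [h.add] at h1
    rw [Nat.cast_succ, add_comm]
    calc N (Ψ (1 + n) p) ≤ C * N (Ψ n p) := h1
      _ ≤ C * (C ^ n * N p) := by
        have := h.one_le
        gcongr
      _ = C ^ (n + 1) * N p := by ring

theorem norm_floor_le (h : IsGreenSystem Ψ N L Gp Gm C) (t : ℝ) (p : P) :
    N (Ψ t p) ≤ C * N (Ψ (⌊t⌋ : ℤ) p) := by
  have h1 := h.short (t - ⌊t⌋) (Ψ (⌊t⌋ : ℤ) p) (by
    rw [abs_of_nonneg (sub_nonneg.2 (Int.floor_le t))]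
    linarith [Int.lt_floor_add_one t])
  rwa [h.add, sub_add_cancel] at h1

theorem norm_int_le (h : IsGreenSystem Ψ N L Gp Gm C) (p : P) {j : ℤ} {K : ℝ}
    (hK : ∀ i : ℤ, i ≤ j → N (Ψ i p) ≤ K) {t : ℝ} (ht : t ≤ j) : N (Ψ t p) ≤ C * K := by
  refine (h.norm_floor_le t p).trans (mul_le_mul_of_nonneg_left (hK _ ?_) (by linarith [h.one_le]))
  have h1 := (Int.floor_le t).trans ht
  exact_mod_cast h1

/-- Vectors of the Green bundle have bounded future. -/
theorem bounded_growth (h : IsGreenSystem Ψ N L Gp Gm C)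
    (h0 : ∀ p, (∃ K, ∀ t, N (Ψ t p) ≤ K) → N p = 0) :
    ∃ A, 0 < A ∧ ∀ p ∈ Gp, ∀ t, 0 ≤ t → N (Ψ t p) ≤ A * N p := by
  have hC := h.one_le
  by_contra! hcon
  -- Vectors of the Green bundle that violate the bound are replaced by nearby vectors that reach
  -- `L` at a late integer time. The strict inequality survives by convergence of the norms at times
  -- `0` and `⌊t⌋₊`.
  have h1 : ∀ k : ℕ, ∃ (p : P) (n T : ℕ), n ≤ T ∧ Ψ T p ∈ L ∧ (k + 1) * N p < N (Ψ n p) := by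
    intro k
    obtain ⟨p, hp, t, ht, hlt⟩ := hcon (C * (k + 1)) (by positivity)
    have h2 : (k + 1) * N p < N (Ψ (⌊t⌋₊ : ℕ) p) := by
      have h3 := h.norm_floor_le t p
      rw [← natCast_floor_eq_intCast_floor ht] at h3
      have h4 : C * ((k + 1) * N p) < C * N (Ψ (⌊t⌋₊ : ℕ) p) := by linarith
      exact lt_of_mul_lt_mul_left h4 (by linarith)
    obtain ⟨u, hu1, hu2⟩ := h.approx_p p hp
    have h5 : ∀ᶠ T in atTop, (k + 1) * N (u T) < N (Ψ (⌊t⌋₊ : ℕ) (u T)) := by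
      have h6 := hu2 0
      simp only [h.zero] at h6
      exact (h6.const_mul ((k : ℝ) + 1)).eventually_lt (hu2 _) h2
    obtain ⟨T, ⟨hT1, hT2⟩, hT3⟩ := ((tendsto_natCast_atTop_atTop.eventually (hu1.and h5)).and
      (eventually_ge_atTop ⌊t⌋₊)).exists
    exact ⟨u T, ⌊t⌋₊, T, hT3, hT1, hT2⟩
  choose p n T hnT hL hlt using h1
  -- The orbit segment is recentred at the integer time `τ k` at which it is largest. After
  -- rescaling it has size one there and at most one at the integer times from `-τ k` to `T k - τ
  -- k`.
  have h2 : ∀ k, ∃ τ ∈ Finset.range (T k + 1), ∀ j ∈ Finset.range (T k + 1),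
      N (Ψ j (p k)) ≤ N (Ψ τ (p k)) := fun k =>
    Finset.exists_max_image (Finset.range (T k + 1)) (fun j : ℕ => N (Ψ j (p k))) ⟨0, by simp⟩
  choose τ hτ hmax using h2
  have hτT : ∀ k, τ k ≤ T k := fun k => Nat.lt_succ_iff.1 (Finset.mem_range.1 (hτ k))
  have hbig : ∀ k, (k + 1) * N (p k) < N (Ψ (τ k) (p k)) := fun k =>
    (hlt k).trans_le (hmax k (n k) (Finset.mem_range.2 (Nat.lt_succ_of_le (hnT k))))
  have hapos : ∀ k, 0 < N (Ψ (τ k) (p k)) := fun k =>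
    lt_of_le_of_lt (mul_nonneg (by positivity) (h.nonneg _)) (hbig k)
  have hint : ∀ k (j : ℤ), -(τ k : ℤ) ≤ j → j ≤ T k - τ k →
      N (Ψ j (Ψ (τ k) (p k))) ≤ 1 * N (Ψ (τ k) (p k)) := by
    intro k j hj1 hj2
    rw [h.add, one_mul]
    obtain ⟨i, hi⟩ : ∃ i : ℕ, j + τ k = i := ⟨(j + τ k).toNat, by omega⟩
    have h3 : (j : ℝ) + (τ k : ℝ) = (i : ℝ) := by exact_mod_cast hi
    rw [h3]
    exact hmax k i (Finset.mem_range.2 (by omega))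
  -- A unit of time multiplies the size by at most `C`, so growth by the factor `k + 1` forces `τ k`
  -- to infinity.
  have hτtop : ∀ K : ℕ, ∀ᶠ k in (hyperfilter ℕ : Filter ℕ), K < τ k := by
    intro K
    obtain ⟨k₀, hk₀⟩ := exists_nat_gt (C ^ K)
    have hev : ∀ᶠ k in (hyperfilter ℕ : Filter ℕ), k₀ ≤ k :=
      Nat.hyperfilter_le_atTop (eventually_ge_atTop k₀)
    filter_upwards [hev] with k hk
    by_contra! hle
    have h3 := h.norm_nat_le (τ k) (p k)
    have h4 : C ^ τ k ≤ C ^ K := pow_le_pow_right₀ hC hle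
    have h5 : (k₀ : ℝ) ≤ k := by exact_mod_cast hk
    have h6 : C ^ τ k * N (p k) ≤ (k + 1) * N (p k) :=
      mul_le_mul_of_nonneg_right (by linarith) (h.nonneg _)
    linarith [hbig k]
  obtain ⟨q, hq⟩ := h.limit (fun k => Ψ (τ k) (p k)) (fun k => N (Ψ (τ k) (p k))) hapos
    ⟨1, fun k => by rw [one_mul]⟩
  have hq0 : N q ≠ 0 := by
    have h3 := (hq 0).2.1 1 (Eventually.of_forall fun k => by rw [h.zero, one_mul])
    rw [h.zero] at h3
    intro h4
    rw [h4] at h3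
    linarith
  -- If the end of the segment recedes to infinity, the limit `q` has a bounded orbit. Otherwise the
  -- distance to the end is a constant `J` along the ultrafilter, and the vector `Ψ J q` lies in `L`
  -- and has a bounded past, so it is in `Gm` as well. Either way `q` has size zero, while the
  -- recentring gives it positive size.
  by_cases hcase : ∀ K : ℕ, ∀ᶠ k in (hyperfilter ℕ : Filter ℕ), K < T k - τ k
  · refine hq0 (h0 q ⟨C * C, fun t => (h.norm_floor_le t q).trans
      (mul_le_mul_of_nonneg_left ?_ (by linarith))⟩)
    have h3 := (hq (⌊t⌋ : ℤ)).1 1 ?_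
    · simpa using h3
    · filter_upwards [hτtop ⌊t⌋.natAbs, hcase ⌊t⌋.natAbs] with k hk1 hk2
      have := hτT k
      exact hint k _ (by omega) (by omega)
  · push Not at hcase
    obtain ⟨K, hK⟩ := hcase
    obtain ⟨J, -, hJ⟩ : ∃ J ∈ Finset.range (K + 1),
        ∀ᶠ k in (hyperfilter ℕ : Filter ℕ), T k - τ k = J := by
      have h3 : ∀ᶠ k in (hyperfilter ℕ : Filter ℕ), ∃ J ∈ (Finset.range (K + 1) : Set ℕ),
          T k - τ k = J :=
        hK.mono fun k hk => ⟨_, by simpa using Nat.lt_succ_of_le hk, rfl⟩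
      obtain ⟨J, hJ1, hJ2⟩ := (Ultrafilter.eventually_exists_mem_iff
        (Finset.finite_toSet (Finset.range (K + 1)))).1 h3
      exact ⟨J, by simpa using hJ1, hJ2⟩
    have h4 : Ψ (J : ℕ) q ∈ L := by
      refine (hq (J : ℕ)).2.2 ?_
      filter_upwards [hJ] with k hk
      have h5 : ((J : ℕ) : ℝ) + (τ k : ℝ) = T k := by
        have := hτT k
        have h6 : J + τ k = T k := by omega
        exact_mod_cast h6
      rw [h.add, h5]
      exact hL k
    have h5 : Ψ (J : ℕ) q ∈ Gm := by
      refine h.mem_m _ ⟨C * (C * 1), fun t ht => ?_⟩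
      rw [h.add]
      refine h.norm_int_le q (j := (J : ℤ)) (fun i hi => (hq i).1 1 ?_) (by push_cast; linarith)
      filter_upwards [hτtop i.natAbs, hJ] with k hk1 hk2
      have := hτT k
      exact hint k _ (by omega) (by omega)
    have h6 := h.disjoint_m _ h5 h4
    have h7 := (h.reverse.norm_nat_le J (Ψ (J : ℕ) q))
    rw [h6, mul_zero, h.add, neg_add_cancel, h.zero] at h7
    exact hq0 (le_antisymm h7 (h.nonneg q))

/-- Vectors of the Green bundle decay exponentially. -/
theorem exponential_decay (h : IsGreenSystem Ψ N L Gp Gm C)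
    (h0 : ∀ p, (∃ K, ∀ t, N (Ψ t p) ≤ K) → N p = 0) :
    ∃ c₁ > 0, ∃ c₂ > 0, ∀ p ∈ Gp, ∀ t, 0 ≤ t → N (Ψ t p) ≤ c₁ * N p * Real.exp (-c₂ * t) := by
  have hC := h.one_le
  obtain ⟨A, hA, hgrow⟩ := h.bounded_growth h0
  have hhalf : ∃ k : ℕ, 0 < k ∧ ∀ p ∈ Gp, N (Ψ k p) ≤ 1 / 2 * N p := by
    by_contra! hcon
    -- Even times, so that the midpoint `k + 1` is an integer too. Recentred there, the orbit is
    -- bounded on a half-line that starts at `-(k + 1)`, so the limit has a bounded orbit.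
    have h1 : ∀ k : ℕ, ∃ p ∈ Gp, 1 / 2 * N p < N (Ψ ((2 * (k + 1) : ℕ) : ℝ) p) := fun k =>
      hcon (2 * (k + 1)) (by omega)
    choose p hp hlt using h1
    have hpos : ∀ k, 0 < N (p k) := by
      intro k
      refine lt_of_le_of_ne (h.nonneg _) fun h2 => ?_
      have h3 := h.norm_nat_le (2 * (k + 1)) (p k)
      have h4 := hlt k
      rw [← h2] at h3 h4
      linarith
    obtain ⟨q, hq⟩ := h.limit (fun k => Ψ (k + 1 : ℕ) (p k)) (fun k => N (p k)) hpos
      ⟨A, fun k => hgrow _ (hp k) _ (by positivity)⟩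
    have h2 : N q = 0 := by
      refine h0 q ⟨C * A, fun t => (hq t).1 A ?_⟩
      have hev : ∀ᶠ k in (hyperfilter ℕ : Filter ℕ), ⌈-t⌉₊ ≤ k :=
        Nat.hyperfilter_le_atTop (eventually_ge_atTop _)
      filter_upwards [hev] with k hk
      rw [h.add]
      refine hgrow _ (hp k) _ ?_
      have h3 : -t ≤ k := (Nat.le_ceil _).trans (by exact_mod_cast hk)
      push_cast
      linarith
    -- From the midpoint to the time `2 (k + 1)` the size grows at most by `A`, and at the end it
    -- exceeds half of the initial size. So the midpoint has size at least `1 / (2 * A)` after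
    -- rescaling, and the limit cannot vanish.
    have h3 := (hq 0).2.1 (1 / (2 * A)) (Eventually.of_forall fun k => ?_)
    · rw [h.zero, h2, mul_zero] at h3
      have : 0 < 1 / (2 * A) := by positivity
      linarith
    · rw [h.zero]
      have h4 := hgrow _ (h.inv_p (k + 1 : ℕ) _ (hp k)) (k + 1 : ℕ) (by positivity)
      rw [h.add] at h4
      have h5 : ((k + 1 : ℕ) : ℝ) + ((k + 1 : ℕ) : ℝ) = ((2 * (k + 1) : ℕ) : ℝ) := by
        push_cast; ring
      rw [h5] at h4
      have h6 := (hlt k).trans_le h4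
      rw [div_mul_eq_mul_div, one_mul, div_le_iff₀ (by positivity)]
      linarith
  obtain ⟨k, hk, hhalf⟩ := hhalf
  have hk' : (0 : ℝ) < k := by exact_mod_cast hk
  have hpow : ∀ m : ℕ, ∀ p ∈ Gp, N (Ψ (m * k) p) ≤ (1 / 2) ^ m * N p := by
    intro m
    induction m with
    | zero => intro p _; simp [h.zero]
    | succ m ih =>
      intro p hp
      have h1 := hhalf _ (h.inv_p (m * k) p hp)
      rw [h.add] at h1
      have h2 : ((m + 1 : ℕ) : ℝ) * k = k + m * k := by push_cast; ring
      rw [h2, pow_succ]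
      have := ih p hp
      linarith
  -- The rate is that of halving in time `k`. In the constant, `A` covers the time left after the
  -- last complete period, and `2` the loss from rounding `t / k` down.
  refine ⟨2 * A, by positivity, Real.log 2 / k, div_pos (Real.log_pos (by norm_num)) hk',
    fun p hp t ht => ?_⟩
  have h1 : (⌊t / k⌋₊ : ℝ) ≤ t / k := Nat.floor_le (by positivity)
  have h2 : t / k < ⌊t / k⌋₊ + 1 := Nat.lt_floor_add_one _
  set m := ⌊t / k⌋₊ with hm
  have h3 : (m : ℝ) * k ≤ t := (le_div_iff₀ hk').1 h1
  have h4 := hgrow _ (h.inv_p (m * k) p hp) (t - m * k) (by linarith)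
  rw [h.add, sub_add_cancel] at h4
  have h5 := hpow m p hp
  have h6 : ((1 : ℝ) / 2) ^ m ≤ 2 * Real.exp (-(Real.log 2 / k) * t) := by
    have e1 : ((1 : ℝ) / 2) ^ m = 2 * Real.exp (-Real.log 2 * (m + 1)) := by
      have : Real.exp (-Real.log 2 * (m + 1)) = (1 / 2 : ℝ) ^ (m + 1) := by
        have e2 : -Real.log 2 * ((m : ℝ) + 1) = ((m + 1 : ℕ) : ℝ) * -Real.log 2 := by
          push_cast; ring
        rw [e2, Real.exp_nat_mul, Real.exp_neg, Real.exp_log (by norm_num), one_div]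
      rw [this, pow_succ]
      ring
    rw [e1]
    refine mul_le_mul_of_nonneg_left (Real.exp_le_exp.2 ?_) (by norm_num)
    have e2 : -(Real.log 2 / k) * t = -Real.log 2 * (t / k) := by ring
    rw [e2]
    have := Real.log_pos (show (1 : ℝ) < 2 by norm_num)
    nlinarith
  calc N (Ψ t p) ≤ A * N (Ψ (m * k) p) := h4
    _ ≤ A * ((1 / 2) ^ m * N p) := by gcongr
    _ ≤ A * (2 * Real.exp (-(Real.log 2 / k) * t) * N p) := by
      have := h.nonneg p
      gcongr
    _ = _ := by ring

end IsGreenSystem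

end Hyperbolicity

/-! ### The Jacobi curves are monotone -/

namespace HamiltonianLevel

variable {E : Type*} [NormedAddCommGroup E] [NormedSpace ℝ E]
  {M : Type*} [TopologicalSpace M] [ChartedSpace E M] [IsManifold 𝓘(ℝ, E) ∞ M]
  {S : HamiltonianLevel E M} {x : M}

variable (S) in
/-- The Lagrangian distribution, as a family of subspaces of the model space. -/
def lag (x : M) : Submodule ℝ E := S.Λ x

variable (S) in
/-- The Jacobi curves, as curves of subspaces of the model space. -/
noncomputable def jac (x : M) (t : ℝ) : Submodule ℝ E := S.jacobi x t

/-- A linear combination of vector fields with constant coefficients. -/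
noncomputable def combination {m : ℕ} (V : Fin m → M → E) (c : Fin m → ℝ) (x : M) : E :=
  ∑ i, c i • V i x

theorem smoothFieldAt_combination {m : ℕ} {V : Fin m → M → E}
    (hV : ∀ i, SmoothFieldAt (V i) x) (c : Fin m → ℝ) : SmoothFieldAt (combination V c) x := by
  have := isManifold_one E M
  exact ContMDiffAt.sum_section (fun i _ => (hV i).const_smul_section (a := c i))

theorem pull_combination {m : ℕ} (V : Fin m → M → E) (c : Fin m → ℝ)
    (s : ℝ) : S.pull (combination V c) x s = ∑ i, c i • S.pull (V i) x s := by
  have h1 : ∀ u : Fin m → E, S.T (-s) (S.φ s x) (∑ i, c i • u i)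
      = ∑ i, c i • S.T (-s) (S.φ s x) (u i) := fun u => by simp
  exact h1 fun i => V i (S.φ s x)

theorem exists_lagrangian_frame (S : HamiltonianLevel E M) (x : M) :
    ∃ (U : Set M) (V : Fin S.n → M → E), IsOpen U ∧ x ∈ U ∧
      (∀ i, ∀ z ∈ U, SmoothFieldAt (V i) z) ∧
      ∀ z ∈ U, LinearIndependent ℝ (fun i => V i z) ∧
        Submodule.span ℝ (Set.range fun i => V i z) = S.lag z := by
  obtain ⟨U, hU, hx, V, hV, h⟩ := S.lagrangian.smooth x
  exact ⟨U, V, hU, hx, fun i z hz => (hV i).contMDiffAt (hU.mem_nhds hz), h⟩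

theorem form_lieX_pos (hmono : S.Monotone) {U : Set M} (hU : IsOpen U) (hx : x ∈ U)
    {V : M → E} (hV : ∀ z ∈ U, SmoothFieldAt V z)
    (hm : ∀ z ∈ U, V z ∈ S.lag z) (h0 : V x ≠ 0) : 0 < S.form x (S.lieX V x) (V x) :=
  hmono x U V hU hx (fun z hz => (hV z hz).contMDiffWithinAt) hm h0

theorem isLagrangianSubspace_Λ [FiniteDimensional ℝ E] (x : M) :
    IsLagrangianSubspace (S.form x) (S.lag x) := by
  refine isLagrangianSubspace_of_finrank (S.isSymplecticBilin_form x)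
    (fun u hu w hw => S.lagrangian.isotropic x u hu w hw) ?_
  obtain ⟨U, V, -, hx, -, h⟩ := exists_lagrangian_frame S x
  rw [← (h x hx).2, finrank_span_eq_card (h x hx).1, Fintype.card_fin, S.finrank_eq]

theorem mem_jacobi {t : ℝ} {v : E} : v ∈ (S.jac x t) ↔
    S.T t x v ∈ S.lag (S.φ t x) := Iff.rfl

theorem pull_mem_jacobi (hx : x ∈ S.level) {V : M → E} {t : ℝ}
    (h : V (S.φ t x) ∈ S.lag (S.φ t x)) : S.pull V x t ∈ (S.jac x t) := by
  rw [mem_jacobi, T_pull hx]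
  exact h

theorem isLagrangianSubspace_jacobi [FiniteDimensional ℝ E] (hx : x ∈ S.level) (t : ℝ) :
    IsLagrangianSubspace (S.form x) (S.jac x t) := by
  intro u
  rw [mem_jacobi, isLagrangianSubspace_Λ (S := S) (S.φ t x) (S.T t x u)]
  constructor
  · intro h w hw
    rw [← form_T hx t]
    exact h _ hw
  · intro h w hw
    have h1 := T_T_neg hx t w
    rw [← h1, form_T hx t]
    refine h _ ?_
    rw [mem_jacobi, h1]
    exact hw

variable [CompleteSpace E]

theorem form_pull_pull (hx : x ∈ S.level) (V W : M → E) (t : ℝ) :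
    S.form x (S.pull V x t) (S.pull W x t) = S.form (S.φ t x) (V (S.φ t x)) (W (S.φ t x)) := by
  rw [← form_T hx t, T_pull hx, T_pull hx]

theorem lieX_combination (hx : x ∈ S.level) {m : ℕ}
    {V : Fin m → M → E} (hV : ∀ i, SmoothFieldAt (V i) x)
    (c : Fin m → ℝ) : S.lieX (combination V c) x = ∑ i, c i • S.lieX (V i) x := by
  have h1 := hasDerivAt_pull_zero (S := S) hx (smoothFieldAt_combination hV c)
  have h2 : HasDerivAt (fun s => ∑ i, c i • S.pull (V i) x s) (∑ i, c i • S.lieX (V i) x) 0 :=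
    HasDerivAt.fun_sum fun i _ => (hasDerivAt_pull_zero hx (hV i)).const_smul (c i)
  exact (h1.congr_of_eventuallyEq
    (Filter.Eventually.of_forall fun s => (pull_combination V c s).symm)).unique h2

theorem pull_lieX_combination (hx : x ∈ S.level) {m : ℕ} {t : ℝ}
    {V : Fin m → M → E} (hV : ∀ i, SmoothFieldAt (V i) (S.φ t x))
    (c : Fin m → ℝ) : S.pull (S.lieX (combination V c)) x t = ∑ i, c i • S.pull (S.lieX (V i)) x t := by
  rw [← pull_combination, pull, pull]
  exact congrArg (S.T (-t) (S.φ t x)) (lieX_combination (φ_mem hx t) hV c)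

theorem NoConjugatePoints.sup_eq_top (hconj : S.NoConjugatePoints) (hx : x ∈ S.level) {t : ℝ}
    (ht : t ≠ 0) : (S.lag x).map (S.T t x).toLinearMap ⊔ S.lag (S.φ t x) = ⊤ :=
  hconj x hx t ht

/-- The Jacobi curves are monotone. -/
theorem isMonotoneFamily_jacobi [FiniteDimensional ℝ E] (hmono : S.Monotone)
    (hconj : S.NoConjugatePoints) (hx : x ∈ S.level) :
    IsMonotoneFamily (S.form x) (fun t => (S.jac x t)) where
  symplectic := S.isSymplecticBilin_form x
  lagrangian := isLagrangianSubspace_jacobi hx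
  frame t₀ := by
    obtain ⟨U, V, hU, hz, hV, h⟩ := exists_lagrangian_frame S (S.φ t₀ x)
    refine ⟨S.n, fun i => S.pull (V i) x, fun i => S.pull (S.lieX (V i)) x t₀, ?_, ?_, ?_, ?_⟩
    · exact fun i => contDiffAt_iff_dual.2 (contDiffAt_pull hx hU (hV i) hz)
    · exact fun i => hasVelocity_iff.2 (hasDerivAt_pull hx (hV i _ hz))
    · filter_upwards [(hU.preimage (continuous_φ S hx)).mem_nhds hz] with t ht
      have hinj : Function.Injective (S.T (-t) (S.φ t x)).toLinearMap := by
        intro u w huw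
        have h1 := congrArg (S.T t x) (show S.T (-t) (S.φ t x) u = S.T (-t) (S.φ t x) w from huw)
        rwa [T_T_neg hx, T_T_neg hx] at h1
      refine ⟨(h _ ht).1.map' (S.T (-t) (S.φ t x)).toLinearMap (LinearMap.ker_eq_bot.2 hinj), ?_⟩
      have h2 : Set.range (fun i => S.pull (V i) x t)
          = (S.T (-t) (S.φ t x)).toLinearMap '' Set.range (fun i => V i (S.φ t x)) := by
        rw [← Set.range_comp]; rfl
      rw [h2, ← Submodule.map_span, (h _ ht).2]
      ext v
      rw [mem_jacobi, Submodule.mem_map]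
      constructor
      · rintro ⟨u, hu, rfl⟩
        change S.T t x (S.T (-t) (S.φ t x) u) ∈ _
        rw [T_T_neg hx]
        exact hu
      · intro hv
        exact ⟨_, hv, T_neg_T hx t v⟩
    · intro c hc
      -- A combination of the frame fields with constant coefficients is itself a section of `Λ`.
      -- Invariance of the form moves its velocity form to `φ_{t₀}(x)`, where monotonicity applies
      -- to that section.
      rw [← pull_lieX_combination hx (fun i => hV i _ hz), ← pull_combination, form_pull_pull hx]
      refine form_lieX_pos hmono hU hz (fun z hz => smoothFieldAt_combination (fun i => hV i z hz) c)
        (fun z hz => ?_) ?_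
      · have h1 : (∑ i, c i • V i z) ∈ S.lag z := by
          rw [← (h z hz).2]
          exact Submodule.sum_mem _ fun i _ => Submodule.smul_mem _ _ (Submodule.subset_span ⟨i, rfl⟩)
        exact h1
      · intro h1
        exact hc (funext (Fintype.linearIndependent_iff.1 (h _ hz).1 c h1))
  transversal s t hst := by
    rw [Submodule.eq_bot_iff]
    rintro v ⟨hs, ht⟩
    have hz := φ_mem hx s
    have h1 := hconj.sup_eq_top hz (sub_ne_zero.2 hst.symm)
    have h2 : S.T t x v = S.T (t - s) (S.φ s x) (S.T s x v) := by rw [T_T hx, sub_add_cancel]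
    have h3 : S.φ (t - s) (S.φ s x) = S.φ t x := by rw [φ_φ hx, sub_add_cancel]
    -- The vector `dφ_t v` lies in two Lagrangian subspaces that together span the tangent space, so
    -- it is skew-orthogonal to everything.
    have h4 : ∀ w : E, S.form (S.φ t x) (S.T t x v) w = 0 := by
      intro w
      rw [← h3, h2]
      obtain ⟨a, ⟨u, hu, rfl⟩, b, hb, rfl⟩ := Submodule.mem_sup.1 (h1 ▸ Submodule.mem_top (x := w))
      have h6 : S.form (S.φ (t - s) (S.φ s x)) (S.T (t - s) (S.φ s x) (S.T s x v))
          (S.T (t - s) (S.φ s x) u) = 0 := by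
        rw [form_T hz]
        exact (isLagrangianSubspace_Λ (S := S) _).apply_eq_zero hs hu
      have h7 : S.form (S.φ (t - s) (S.φ s x)) (S.T (t - s) (S.φ s x) (S.T s x v)) b = 0 := by
        refine (isLagrangianSubspace_Λ (S := S) _).apply_eq_zero ?_ hb
        rw [← h2, h3]
        exact ht
      rw [map_add, h7, add_zero]; exact h6
    have h5 := (S.isSymplecticBilin_form _).nondeg _ h4
    rw [← T_neg_T hx t v, h5, map_zero]

end HamiltonianLevel

/-! ### Locally uniform positivity and bounds -/

section Compactness

/-- A locally uniform bound is uniform on compact sets. -/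
theorem IsCompact.exists_uniform {Y : Type*} [TopologicalSpace Y] {K : Set Y} (hK : IsCompact K)
    {P : ℝ → Y → Prop} (hP : ∀ C C' y, C ≤ C' → P C y → P C' y)
    (h : ∀ z ∈ K, ∃ C, ∀ᶠ y in 𝓝[K] z, P C y) : ∃ C, ∀ y ∈ K, P C y := by
  refine hK.induction_on (p := fun s => ∃ C, ∀ y ∈ s, P C y) ⟨0, by simp⟩ ?_ ?_ ?_
  · rintro s t hst ⟨C, hC⟩
    exact ⟨C, fun y hy => hC y (hst hy)⟩
  · rintro s t ⟨C, hC⟩ ⟨C', hC'⟩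
    refine ⟨max C C', fun y hy => hy.elim (fun hy => ?_) fun hy => ?_⟩
    · exact hP _ _ _ (le_max_left _ _) (hC y hy)
    · exact hP _ _ _ (le_max_right _ _) (hC' y hy)
  · intro z hz
    obtain ⟨C, hC⟩ := h z hz
    exact ⟨_, hC, C, fun y hy => hy⟩

theorem eventually_abs_le {Y ι : Type*} [TopologicalSpace Y] [Fintype ι] {f : ι → Y → ℝ} {z : Y}
    (hf : ∀ i, ContinuousAt (f i) z) : ∃ B, 0 ≤ B ∧ ∀ᶠ y in 𝓝 z, ∀ i, |f i y| ≤ B := by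
  refine ⟨∑ i, (|f i z| + 1), Finset.sum_nonneg fun i _ => by positivity, ?_⟩
  rw [Filter.eventually_all]
  intro i
  filter_upwards [(hf i).abs.eventually (gt_mem_nhds (lt_add_one |f i z|))] with y hy
  exact hy.le.trans (Finset.single_le_sum (f := fun i => |f i z| + 1)
    (fun i _ => by positivity) (Finset.mem_univ i))

/-- Positive definiteness is locally uniform. -/
theorem eventually_elliptic {Y : Type*} [TopologicalSpace Y] {m : ℕ} {G : Fin m → Fin m → Y → ℝ}
    {z : Y} (hG : ∀ i j, ContinuousAt (G i j) z)
    (hpos : ∀ x : Fin m → ℝ, x ≠ 0 → 0 < ∑ i, ∑ j, x i * x j * G i j z) :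
    ∃ c, 0 < c ∧ ∀ᶠ y in 𝓝 z, ∀ x : Fin m → ℝ,
      c * ∑ i, x i ^ 2 ≤ ∑ i, ∑ j, x i * x j * G i j y := by
  have hcpt : IsCompact {x : Fin m → ℝ | ∑ i, x i ^ 2 = 1} := by
    refine Metric.isCompact_of_isClosed_isBounded
      (isClosed_eq (by fun_prop) continuous_const) ?_
    refine (Metric.isBounded_closedBall (x := (0 : Fin m → ℝ)) (r := 1)).subset fun x hx => ?_
    rw [mem_closedBall_zero_iff, pi_norm_le_iff_of_nonneg zero_le_one]
    intro i
    have h1 : x i ^ 2 ≤ 1 := by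
      rw [← (show ∑ i, x i ^ 2 = 1 from hx)]
      exact Finset.single_le_sum (f := fun i => x i ^ 2) (fun i _ => sq_nonneg _)
        (Finset.mem_univ i)
    rw [Real.norm_eq_abs]
    exact abs_le_one_iff_mul_self_le_one.2 (by rwa [← sq])
  obtain ⟨c, hc, hcle⟩ := hcpt.exists_forall_le' (f := fun x => ∑ i, ∑ j, x i * x j * G i j z)
    (a := 0) (by fun_prop) (fun x hx => hpos x (by rintro rfl; simp at hx))
  -- Half of a positive lower bound on the unit sphere at `z` survives at nearby points because the
  -- sphere is compact; homogeneity extends the estimate to all vectors.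
  refine ⟨c / 2, by positivity, ?_⟩
  have h1 := hcpt.eventually_forall_of_forall_eventually (x₀ := z)
    (P := fun y x => c / 2 < ∑ i, ∑ j, x i * x j * G i j y) (fun x hx => by
      have h2 : ContinuousAt (fun p : Y × (Fin m → ℝ) =>
          ∑ i, ∑ j, p.2 i * p.2 j * G i j p.1) (z, x) := by
        refine tendsto_finsetSum _ fun i _ => tendsto_finsetSum _ fun j _ => ?_
        have h3 : ∀ i, ContinuousAt (fun p : Y × (Fin m → ℝ) => p.2 i) (z, x) := fun i => by
          fun_prop
        exact ((h3 i).mul (h3 j)).mul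
          (ContinuousAt.comp (g := G i j) (f := Prod.fst) (hG i j) continuousAt_fst)
      exact h2.eventually (lt_mem_nhds (by have := hcle x hx; simp only; linarith)))
  filter_upwards [h1] with y hy x
  rcases eq_or_ne x 0 with rfl | hx
  · simp
  have hr : 0 < ∑ i, x i ^ 2 := by
    refine (Finset.sum_nonneg fun i _ => sq_nonneg _).lt_of_ne' fun h => hx (funext fun i => ?_)
    have := (Finset.sum_eq_zero_iff_of_nonneg (fun i _ => sq_nonneg (x i))).1 h i (Finset.mem_univ i)
    simpa using this
  set r := √(∑ i, x i ^ 2) with hrdef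
  have hr2 : r ^ 2 = ∑ i, x i ^ 2 := Real.sq_sqrt hr.le
  have hr0 : r ≠ 0 := (Real.sqrt_pos.2 hr).ne'
  have h4 := hy (fun i => x i / r) (by
    simp only [div_pow]
    rw [← Finset.sum_div, hr2, div_self hr.ne'])
  have h5 : ∑ i, ∑ j, x i * x j * G i j y
      = (∑ i, x i ^ 2) * ∑ i, ∑ j, x i / r * (x j / r) * G i j y := by
    rw [← hr2, Finset.mul_sum]
    refine Finset.sum_congr rfl fun i _ => ?_
    rw [Finset.mul_sum]
    refine Finset.sum_congr rfl fun j _ => ?_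
    field_simp
  rw [h5, mul_comm]
  exact mul_le_mul_of_nonneg_left h4.le hr.le

/-- A quadratic form that is bounded below controls the squares of linear forms. -/
theorem sq_sum_mul_le_of_elliptic {m : ℕ} {x a : Fin m → ℝ} {c A q : ℝ} (hc : 0 < c)
    (ha : ∀ i, |a i| ≤ A) (hq : c * ∑ i, x i ^ 2 ≤ q) :
    (∑ i, x i * a i) ^ 2 ≤ m * A ^ 2 / c * q := by
  have h1 : (∑ i, x i * a i) ^ 2 ≤ (∑ i, x i ^ 2) * ∑ i, a i ^ 2 :=
    Finset.sum_mul_sq_le_sq_mul_sq _ _ _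
  have h2 : ∑ i, a i ^ 2 ≤ m * A ^ 2 := by
    calc ∑ i, a i ^ 2 ≤ ∑ _i : Fin m, A ^ 2 := Finset.sum_le_sum fun i _ => by
          rw [← sq_abs]; exact pow_le_pow_left₀ (abs_nonneg _) (ha i) 2
      _ = m * A ^ 2 := by simp
  have h3 : 0 ≤ ∑ i, x i ^ 2 := Finset.sum_nonneg fun i _ => sq_nonneg _
  calc (∑ i, x i * a i) ^ 2 ≤ (∑ i, x i ^ 2) * (m * A ^ 2) :=
        h1.trans (mul_le_mul_of_nonneg_left h2 h3)
    _ = m * A ^ 2 / c * (c * ∑ i, x i ^ 2) := by field_simp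
    _ ≤ m * A ^ 2 / c * q := mul_le_mul_of_nonneg_left hq (by positivity)

end Compactness

/-- In a basis of `F` the value of the form is a finite sum of products of smooth scalar functions.
-/
theorem contDiffAt_form_apply {F G : Type*} [NormedAddCommGroup F] [NormedSpace ℝ F]
    [FiniteDimensional ℝ F] [NormedAddCommGroup G] [NormedSpace ℝ G]
    {η : G → F [⋀^Fin 2]→L[ℝ] ℝ} {u v : G → F} {p : G} (hη : ContDiffAt ℝ ∞ η p)
    (hu : ContDiffAt ℝ ∞ u p) (hv : ContDiffAt ℝ ∞ v p) :
    ContDiffAt ℝ ∞ (fun q => η q ![u q, v q]) p := by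
  set b := finBasis ℝ F
  have h1 : ∀ (θ : F [⋀^Fin 2]→L[ℝ] ℝ) (x y : F),
      θ ![x, y] = ∑ i, ∑ j, b.repr x i * (b.repr y j * θ ![b i, b j]) := by
    intro θ x y
    let B : F →ₗ[ℝ] F →ₗ[ℝ] ℝ := formAt (E := F) (M := F) (fun _ => θ) (0 : F)
    have h2 : B (∑ i, b.repr x i • b i) (∑ j, b.repr y j • b j)
        = ∑ i, ∑ j, b.repr x i * (b.repr y j * B (b i) (b j)) := by
      simp only [map_sum, map_smul, LinearMap.sum_apply, LinearMap.smul_apply, smul_eq_mul,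
        Finset.mul_sum]
      rw [Finset.sum_comm]
      exact Finset.sum_congr rfl fun i _ => Finset.sum_congr rfl fun j _ => mul_left_comm _ _ _
    rw [b.sum_repr, b.sum_repr] at h2
    exact h2
  have h2 : (fun q => η q ![u q, v q])
      = fun q => ∑ i, ∑ j, b.repr (u q) i * (b.repr (v q) j * η q ![b i, b j]) := by
    funext q; exact h1 _ _ _
  rw [h2]
  have hb : ∀ i, ContDiff ℝ ∞ (fun x : F => b.repr x i) := fun i =>
    (LinearMap.toContinuousLinearMap (b.coord i)).contDiff
  refine ContDiffAt.sum fun i _ => ContDiffAt.sum fun j _ => ?_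
  exact ((hb i).contDiffAt.comp p hu).mul (((hb j).contDiffAt.comp p hv).mul
    ((ContinuousAlternatingMap.apply ℝ F ℝ ![b i, b j]).contDiff.contDiffAt.comp p hη))

/-! ### Smoothness of pairings of vector fields -/

namespace HamiltonianLevel

variable {E : Type*} [NormedAddCommGroup E] [NormedSpace ℝ E] [FiniteDimensional ℝ E]
  {M : Type*} [TopologicalSpace M] [ChartedSpace E M] [IsManifold 𝓘(ℝ, E) ∞ M]
  {S : HamiltonianLevel E M} {x : M}

/-- The symplectic form of two smooth vector fields is smooth. -/
theorem contMDiffAt_form {V W : M → E} (hV : SmoothFieldAt V x) (hW : SmoothFieldAt W x) :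
    ContMDiffAt 𝓘(ℝ, E) 𝓘(ℝ, ℝ) ∞ (fun y => S.form y (V y) (W y)) x := by
  have h1 : ContDiffAt ℝ ∞ (fun p => formInChart S.Ω x p
      ![fieldInChart V x p, fieldInChart W x p]) (extChartAt 𝓘(ℝ, E) x x) :=
    contDiffAt_form_apply ((S.symplectic.smooth x).contDiffAt
      ((isOpen_extChartAt_target x).mem_nhds (mem_extChartAt_target x)))
      (contDiffAt_fieldInChart_iff.2 hV) (contDiffAt_fieldInChart_iff.2 hW)
  refine (ContMDiffAt.comp x h1.contMDiffAt (contMDiffAt_extChartAt (n := ∞))).congr_of_eventuallyEq ?_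
  filter_upwards [extChartAt_source_mem_nhds (I := 𝓘(ℝ, E)) x] with y hy
  simp only [Function.comp]
  rw [fieldInChart_extChartAt hy, fieldInChart_extChartAt hy]
  exact formAt_eq_formInChart S.Ω hy _ _

variable (S) in
theorem continuousAt_form {V W : M → E} (hV : SmoothFieldAt V x) (hW : SmoothFieldAt W x) :
    ContinuousAt (fun y => S.form y (V y) (W y)) x := (contMDiffAt_form hV hW).continuousAt

theorem continuousAt_form_T (hx : x ∈ S.level) {V W : M → E} {s : ℝ} (hV : SmoothFieldAt V x)
    (hW : SmoothFieldAt W (S.φ s x)) :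
    ContinuousAt (fun p : ℝ × M => S.form (S.φ p.1 p.2) (S.T p.1 p.2 (V p.2)) (W (S.φ p.1 p.2)))
      (s, x) :=
  S.flow.continuousAt_form S.symplectic (S.complete s x hx) hV hW

end HamiltonianLevel

/-! ### The Hamiltonian field lies in the limit, so the reduced Jacobi curves are monotone -/

namespace HamiltonianLevel

variable {E : Type*} [NormedAddCommGroup E] [NormedSpace ℝ E] [FiniteDimensional ℝ E]
  {M : Type*} [TopologicalSpace M] [ChartedSpace E M] [IsManifold 𝓘(ℝ, E) ∞ M]
  {S : HamiltonianLevel E M} {x : M}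

theorem ham_ne_zero (hx : x ∈ S.level) : S.ham x ≠ 0 := by
  intro h0
  refine S.regular x hx (ContinuousLinearMap.ext fun w => ?_)
  have h1 := S.hamiltonian x w
  have h2 : S.form x (S.ham x) w = 0 := by rw [h0, map_zero]; rfl
  have h3 : S.Ω x ![S.X x, w] = 0 := h2
  rw [h3] at h1
  exact neg_eq_zero.1 h1.symm

theorem n_pos (hx : x ∈ S.level) : S.n - 1 + 1 = S.n := by
  refine Nat.sub_add_cancel (Nat.one_le_iff_ne_zero.2 fun h0 => ham_ne_zero hx ?_)
  have h1 := S.finrank_eq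
  rw [h0, mul_zero] at h1
  have := finrank_zero_iff.1 h1
  exact Subsingleton.elim _ _

section

variable [CompleteSpace E]

theorem form_lieX_combination (hx : x ∈ S.level) {m : ℕ} {V : Fin m → M → E}
    (hV : ∀ i, SmoothFieldAt (V i) x) (c : Fin m → ℝ) :
    S.form x (S.lieX (combination V c) x) (combination V c x)
      = ∑ i, ∑ j, c i * c j * S.form x (S.lieX (V i) x) (V j x) := by
  rw [lieX_combination hx hV, combination]
  simp only [map_sum, map_smul, LinearMap.sum_apply, LinearMap.smul_apply, smul_eq_mul,
    Finset.mul_sum, mul_assoc]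
  rw [Finset.sum_comm]
  exact Finset.sum_congr rfl fun i _ => Finset.sum_congr rfl fun j _ => mul_left_comm _ _ _

/-- The form of a monotone field is locally uniformly elliptic. -/
theorem eventually_elliptic_form (hmono : S.Monotone) {z : M} (hz : z ∈ S.level) {U : Set M}
    (hU : IsOpen U) (hzU : z ∈ U) {m : ℕ} {V : Fin m → M → E}
    (hV : ∀ i, ∀ y ∈ U, SmoothFieldAt (V i) y) (hm : ∀ i, ∀ y ∈ U, V i y ∈ S.lag y)
    (hli : LinearIndependent ℝ (fun i => V i z)) :
    ∃ c, 0 < c ∧ ∀ᶠ y in 𝓝 z, ∀ a : Fin m → ℝ, c * ∑ i, a i ^ 2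
      ≤ ∑ i, ∑ j, a i * a j * S.form y (S.lieX (V i) y) (V j y) := by
  refine eventually_elliptic
    (fun i j => continuousAt_form S (SmoothFieldAt.lieX S (hV i z hzU)) (hV j z hzU)) fun a ha => ?_
  rw [← form_lieX_combination hz fun i => hV i z hzU]
  refine form_lieX_pos hmono hU hzU (fun y hy => smoothFieldAt_combination (fun i => hV i y hy) a)
    (fun y hy => Submodule.sum_mem _ fun i _ => Submodule.smul_mem _ _ (hm i y hy)) fun h => ?_
  exact ha (funext (Fintype.linearIndependent_iff.1 hli a h))

/-- Near a point the velocity form is bounded below by `c` times the sum of squares of the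
coordinates, and the pairings of `X` with a local frame are bounded by some `A`; Cauchy–Schwarz
gives the constant `n A² / c`. Compactness makes it independent of the point. -/
theorem exists_form_ham_sq_le (hmono : S.Monotone) (hcompact : IsCompact S.level) :
    ∃ C, ∀ y ∈ S.level, ∃ (U : Set M) (V : Fin S.n → M → E), IsOpen U ∧ y ∈ U ∧
      (∀ i, ∀ z ∈ U, SmoothFieldAt (V i) z) ∧ (∀ i, ∀ z ∈ U, V i z ∈ S.lag z) ∧
      Submodule.span ℝ (Set.range fun i => V i y) = S.lag y ∧
      ∀ c, 0 ≤ S.form y (S.lieX (combination V c) y) (combination V c y) ∧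
        S.form y (S.ham y) (combination V c y) ^ 2
          ≤ C * S.form y (S.lieX (combination V c) y) (combination V c y) := by
  refine hcompact.exists_uniform ?_ fun z hz => ?_
  · rintro C C' y hC ⟨U, V, h1, h2, h3, h4, h5, h6⟩
    exact ⟨U, V, h1, h2, h3, h4, h5, fun c => ⟨(h6 c).1,
      (h6 c).2.trans (mul_le_mul_of_nonneg_right hC (h6 c).1)⟩⟩
  · obtain ⟨U, V, hU, hzU, hV, hsp⟩ := exists_lagrangian_frame S z
    have hm : ∀ i, ∀ y ∈ U, V i y ∈ S.lag y := fun i y hy => by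
      rw [← (hsp y hy).2]; exact Submodule.subset_span ⟨i, rfl⟩
    obtain ⟨c, hc, hell⟩ := eventually_elliptic_form hmono hz hU hzU hV hm (hsp z hzU).1
    obtain ⟨A, hA0, hA⟩ := eventually_abs_le
      (fun i => continuousAt_form S (S.smoothFieldAt_ham z) (hV i z hzU))
    refine ⟨S.n * A ^ 2 / c, ?_⟩
    filter_upwards [self_mem_nhdsWithin, mem_nhdsWithin_of_mem_nhds hell,
      mem_nhdsWithin_of_mem_nhds hA, mem_nhdsWithin_of_mem_nhds (hU.mem_nhds hzU)]
      with y hy hy1 hy2 hyU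
    refine ⟨U, V, hU, hyU, hV, hm, (hsp y hyU).2, fun a => ?_⟩
    rw [form_lieX_combination hy fun i => hV i y hyU]
    refine ⟨(mul_nonneg hc.le (Finset.sum_nonneg fun i _ => sq_nonneg _)).trans (hy1 a), ?_⟩
    have h1 : S.form y (S.ham y) (combination V a y)
        = ∑ i, a i * S.form y (S.ham y) (V i y) := by
      simp only [combination, map_sum, map_smul, smul_eq_mul]
    rw [h1]
    exact sq_sum_mul_le_of_elliptic hc hy2 (hy1 a)

/-- The velocity form of the Jacobi curves controls the pairing with the Hamiltonian vector field. -/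
theorem form_ham_sq_le (hmono : S.Monotone) (hconj : S.NoConjugatePoints)
    (hcompact : IsCompact S.level) (hx : x ∈ S.level) :
    ∃ C, ∀ t e e', IsVelocityIn (S.jac x) t e e' →
      S.form x (S.ham x) (e t) ^ 2 ≤ C * S.form x e' (e t) := by
  obtain ⟨C, hC⟩ := exists_form_ham_sq_le hmono hcompact
  refine ⟨C, fun t e e' he => ?_⟩
  obtain ⟨U, V, hU, hyU, hV, hm, hsp, hle⟩ := hC _ (φ_mem hx t)
  have h1 : e t ∈ S.jac x t := he.2.self_of_nhds
  rw [mem_jacobi, ← hsp, Submodule.mem_span_range_iff_exists_fun ℝ] at h1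
  obtain ⟨c, hc⟩ := h1
  have hc' : combination V c (S.φ t x) = S.T t x (e t) := hc
  have h2 : S.pull (combination V c) x t = e t := by
    rw [pull, hc', T_neg_T hx]
  have h3 : IsVelocityIn (S.jac x) t (S.pull (combination V c) x)
      (S.pull (S.lieX (combination V c)) x t) := by
    refine ⟨hasVelocity_iff.2 (hasDerivAt_pull hx
      (smoothFieldAt_combination (fun i => hV i _ hyU) c)), ?_⟩
    filter_upwards [(hU.preimage (continuous_φ S hx)).mem_nhds hyU] with s hs
    exact pull_mem_jacobi hx (Submodule.sum_mem _ fun i _ => Submodule.smul_mem _ _ (hm i _ hs))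
  -- The velocity form depends only on the value of the curve at `t`, so the given curve may be
  -- exchanged for the pullback of a combination of frame fields.
  have h4 := (isMonotoneFamily_jacobi hmono hconj hx).velocity_eq he h3 h2.symm
  rw [h4, form_pull_pull hx, ← form_T hx t, T_ham hx, ← hc']
  exact (hle c).2

end

/-- The Hamiltonian vector field lies in the limit of the Jacobi curve. -/
theorem ham_mem_limSubspace (hmono : S.Monotone) (hconj : S.NoConjugatePoints)
    (hcompact : IsCompact S.level) (hx : x ∈ S.level) :
    S.ham x ∈ limSubspace (S.jac x) Filter.atTop := by
  have := FiniteDimensional.complete ℝ E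
  obtain ⟨C, hC⟩ := form_ham_sq_le hmono hconj hcompact hx
  exact (isMonotoneFamily_jacobi hmono hconj hx).mem_limSubspace_atTop (t₀ := 0)
    fun t _ => hC t

/-- `Λ` is the Jacobi curve at time zero, and the limit, which contains the nonzero vector `X`, is
transversal to it. -/
theorem ham_notMem_lag (hmono : S.Monotone) (hconj : S.NoConjugatePoints)
    (hcompact : IsCompact S.level) (hx : x ∈ S.level) : S.ham x ∉ S.lag x := by
  have := FiniteDimensional.complete ℝ E
  intro h
  have h1 : S.ham x ∈ S.jac x 0 := by
    rw [mem_jacobi, T_zero, S.flow.zero]; exact h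
  exact ham_ne_zero hx (Submodule.disjoint_def.1
    ((isMonotoneFamily_jacobi hmono hconj hx).limit_atTop.2.2 0).disjoint _
    (ham_mem_limSubspace hmono hconj hcompact hx) h1)

/-- The reduced Jacobi curves are monotone. -/
theorem isMonotoneFamily_reducedJacobi (hmono : S.Monotone) (hconj : S.NoConjugatePoints)
    (hcompact : IsCompact S.level) (α : S.level) :
    IsMonotoneFamily (S.reducedForm α) (S.reducedJacobi α) := by
  have := FiniteDimensional.complete ℝ E
  exact (isMonotoneFamily_jacobi hmono hconj α.2).reduce (ham_ne_zero α.2)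
    (ham_mem_limSubspace hmono hconj hcompact α.2)

theorem finiteDimensional_reducedBundle (α : S.level) :
    FiniteDimensional ℝ (S.ReducedBundle α) :=
  inferInstanceAs (FiniteDimensional ℝ (Reduction (S.form α) (S.ham α)))

theorem finrank_reducedBundle (α : S.level) :
    finrank ℝ (S.ReducedBundle α) = 2 * (S.n - 1) := by
  have h1 : finrank ℝ (S.ReducedBundle α) + 2 = finrank ℝ E :=
    finrank_reduction (S.isSymplecticBilin_form α) (ham_ne_zero α.2)
  have h2 := S.finrank_eq
  have h3 := n_pos α.2
  omega

end HamiltonianLevel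

/-! ### Norming frames: uniform coordinates on the reduced bundle -/

namespace HamiltonianLevel

variable {E : Type*} [NormedAddCommGroup E] [NormedSpace ℝ E]
  {M : Type*} [TopologicalSpace M] [ChartedSpace E M] [IsManifold 𝓘(ℝ, E) ∞ M]
  {S : HamiltonianLevel E M} {x : M}

variable (S) in
/-- The vectors over the level set that are skew-orthogonal to the Hamiltonian vector field. -/
abbrev Lift : Type _ := {p : M × E // p.1 ∈ S.level ∧ S.form p.1 (S.ham p.1) p.2 = 0}

namespace Lift

/-- The base point of a vector over the level set. -/
abbrev base (p : S.Lift) : M := p.1.1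

/-- The vector part of a vector over the level set. -/
abbrev vec (p : S.Lift) : E := p.1.2

theorem base_mem (p : S.Lift) : p.base ∈ S.level := p.2.1

theorem form_ham (p : S.Lift) : S.form p.base (S.ham p.base) p.vec = 0 := p.2.2

/-- The class of a vector in the reduced bundle. -/
noncomputable def cls (p : S.Lift) : S.ReducedBundle ⟨p.base, p.2.1⟩ :=
  (lineIn (formAt S.Ω p.base) (S.X p.base)).mkQ ⟨p.vec, p.2.2⟩

/-- The norm of the class of a vector in the reduced bundle. -/
noncomputable def size (p : S.Lift) : ℝ := S.norm _ p.cls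

theorem exists_cls_eq (α : S.level) (w : S.ReducedBundle α) :
    ∃ (u : E) (hu : S.form α (S.ham α) u = 0), cls ⟨((α : M), u), α.2, hu⟩ = w := by
  obtain ⟨⟨u, hu⟩, rfl⟩ := Submodule.mkQ_surjective _ w
  exact ⟨u, hu, rfl⟩

end Lift

theorem exists_projection (α : S.level) : ∃ π : E →ₗ[ℝ] S.ReducedBundle α,
    ∀ (u : E) (hu : S.form α (S.ham α) u = 0), π u = Lift.cls ⟨((α : M), u), α.2, hu⟩ := by
  obtain ⟨π, hπ⟩ := LinearMap.exists_extend (lineIn (S.form α) (S.ham α)).mkQ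
  exact ⟨π, fun u hu => congrArg (fun f => f ⟨u, hu⟩) hπ⟩

theorem reducedForm_cls (α : S.level) {u w : E} (hu : S.form α (S.ham α) u = 0)
    (hw : S.form α (S.ham α) w = 0) :
    S.reducedForm α (Lift.cls ⟨((α : M), u), α.2, hu⟩) (Lift.cls ⟨((α : M), w), α.2, hw⟩)
      = S.form α u w := rfl

theorem mem_reducedJacobi {α : S.level} {t : ℝ} {w : S.ReducedBundle α} :
    w ∈ S.reducedJacobi α t ↔ ∃ (u : E) (hu : S.form α (S.ham α) u = 0), u ∈ S.jac α t ∧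
      Lift.cls ⟨((α : M), u), α.2, hu⟩ = w := by
  constructor
  · rintro ⟨⟨u, hu⟩, h1, rfl⟩
    exact ⟨u, hu, h1, rfl⟩
  · rintro ⟨u, hu, h1, rfl⟩
    exact ⟨⟨u, hu⟩, h1, rfl⟩

variable (S) in
/-- The vector fields `β` on `U` represent frames of the reduced bundle, for which the norms are
uniformly comparable with the norms of coordinates, with the constant `C`. -/
structure IsNormingFrame (C : ℝ) (U : Set M) (β : Fin (S.n - 1) ⊕ Fin (S.n - 1) → M → E) :
    Prop where
  isOpen : IsOpen U
  smooth : ∀ l, ∀ y ∈ U, SmoothFieldAt (β l) y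
  form_ham : ∀ l, ∀ y ∈ S.level, y ∈ U → S.form y (S.ham y) (β l y) = 0
  size_le : ∀ p : S.Lift, p.base ∈ U → p.size ≤ C * ∑ l, |S.form p.base p.vec (β l p.base)|
  le_size : ∀ p : S.Lift, p.base ∈ U → ∑ l, |S.form p.base p.vec (β l p.base)| ≤ C * p.size
  expand : ∀ p : S.Lift, p.base ∈ U → ∃ (z : Fin (S.n - 1) ⊕ Fin (S.n - 1) → ℝ) (r : ℝ),
    p.vec = ∑ l, z l • β l p.base + r • S.ham p.base ∧ ∀ l, |z l| ≤ C * p.size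
  mem_iff : ∀ p : S.Lift, p.base ∈ U →
    (p.cls ∈ S.reducedJacobi _ 0 ↔ ∀ j, S.form p.base p.vec (β (Sum.inl j) p.base) = 0)

theorem size_nonneg (p : S.Lift) : 0 ≤ p.size := by
  rw [Lift.size, HamiltonianLevel.norm, canonicalNorm]
  split_ifs
  · exact basisNorm_nonneg _ _
  · exact le_rfl

theorem IsNormingFrame.mono {C C' : ℝ} {U : Set M} {β : Fin (S.n - 1) ⊕ Fin (S.n - 1) → M → E}
    (h : IsNormingFrame S C U β) (hC : C ≤ C') : IsNormingFrame S C' U β where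
  isOpen := h.isOpen
  smooth := h.smooth
  form_ham := h.form_ham
  size_le p hp := (h.size_le p hp).trans
    (mul_le_mul_of_nonneg_right hC (Finset.sum_nonneg fun _ _ => abs_nonneg _))
  le_size p hp := (h.le_size p hp).trans (mul_le_mul_of_nonneg_right hC (size_nonneg p))
  expand p hp := by
    obtain ⟨z, r, h1, h2⟩ := h.expand p hp
    exact ⟨z, r, h1, fun l => (h2 l).trans (mul_le_mul_of_nonneg_right hC (size_nonneg p))⟩
  mem_iff := h.mem_iff

variable [FiniteDimensional ℝ E]

/-- Local frames of the part of the Lagrangian distribution in the skew-orthogonal complement of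
the Hamiltonian vector field. -/
theorem exists_reduced_frame (hmono : S.Monotone) (hconj : S.NoConjugatePoints)
    (hcompact : IsCompact S.level) (hx : x ∈ S.level) :
    ∃ (U : Set M) (W : Fin (S.n - 1) → M → E), IsOpen U ∧ x ∈ U ∧
      (∀ i, ∀ z ∈ U, SmoothFieldAt (W i) z) ∧ ∀ z ∈ U, LinearIndependent ℝ (fun i => W i z) ∧
        Submodule.span ℝ (Set.range fun i => W i z)
          = S.lag z ⊓ skewCompl (S.form z) (S.ham z) := by
  have hframe : ∀ m, m = S.n → ∃ (U : Set M) (V : Fin m → M → E), IsOpen U ∧ x ∈ U ∧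
      (∀ i, ∀ z ∈ U, SmoothFieldAt (V i) z) ∧
      ∀ z ∈ U, LinearIndependent ℝ (fun i => V i z) ∧
        Submodule.span ℝ (Set.range fun i => V i z) = S.lag z := by
    rintro m rfl
    exact exists_lagrangian_frame S x
  obtain ⟨U, V, hU, hxU, hV, h⟩ := hframe _ (n_pos hx)
  obtain ⟨i₀, hi₀⟩ : ∃ i, S.form x (S.ham x) (V i x) ≠ 0 := by
    by_contra! h0
    refine ham_notMem_lag hmono hconj hcompact hx ((isLagrangianSubspace_Λ (S := S) x _).2 ?_)
    intro w hw
    rw [← (h x hxU).2, Submodule.mem_span_range_iff_exists_fun ℝ] at hw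
    obtain ⟨c, rfl⟩ := hw
    simp [h0]
  have ha : ∀ i, ∀ z ∈ U, ContMDiffAt 𝓘(ℝ, E) 𝓘(ℝ, ℝ) ∞
      (fun y => S.form y (S.ham y) (V i y)) z := fun i z hz =>
    contMDiffAt_form (S.smoothFieldAt_ham z) (hV i z hz)
  refine ⟨U ∩ {y | S.form y (S.ham y) (V i₀ y) ≠ 0}, fun j y => V (i₀.succAbove j) y
    - (S.form y (S.ham y) (V (i₀.succAbove j) y) / S.form y (S.ham y) (V i₀ y)) • V i₀ y, ?_,
    ⟨hxU, hi₀⟩, ?_, ?_⟩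
  · exact ContinuousOn.isOpen_inter_preimage
      (fun z hz => (ha i₀ z hz).continuousAt.continuousWithinAt) hU isOpen_ne
  · rintro j z ⟨hz, hz0⟩
    have := isManifold_one E M
    have h1 : ContMDiffAt 𝓘(ℝ, E) 𝓘(ℝ, ℝ) ∞ (fun y => S.form y (S.ham y) (V (i₀.succAbove j) y)
        / S.form y (S.ham y) (V i₀ y)) z := (ha _ z hz).div₀ (ha _ z hz) hz0
    exact ContMDiffAt.sub_section (hV _ z hz) (h1.smul_section (hV i₀ z hz))
  · rintro z ⟨hz, hz0⟩
    have h1 := span_reduced_frame (σ := S.form z) (v := S.ham z) (E := fun i => V i z) hz0 (h z hz).1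
    rwa [(h z hz).2] at h1

variable [CompleteSpace E]

/-- Along an orbit in the level set the pullbacks of `W` stay skew-orthogonal to `X(x)`, and the
derivative of the pullback at time zero is the bracket. -/
theorem form_ham_lieX {U : Set M} (hU : IsOpen U) {W : M → E} (hW : ∀ z ∈ U, SmoothFieldAt W z)
    (h : ∀ z ∈ S.level, z ∈ U → S.form z (S.ham z) (W z) = 0) (hx : x ∈ S.level) (hxU : x ∈ U) :
    S.form x (S.ham x) (S.lieX W x) = 0 := by
  have h1 := (LinearMap.toContinuousLinearMap (S.form x (S.ham x))).hasFDerivAt.comp_hasDerivAt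
    (0 : ℝ) (hasDerivAt_pull_zero hx (hW x hxU))
  have h2 : (fun s => S.form x (S.ham x) (S.pull W x s)) =ᶠ[𝓝 0] fun _ => 0 := by
    have h3 : S.φ 0 x ∈ U := by rwa [S.flow.zero]
    filter_upwards [(hU.preimage (continuous_φ S hx)).mem_nhds h3] with s hs
    rw [← form_T hx s, T_ham hx, T_pull hx]
    exact h _ (φ_mem hx s) hs
  exact (h1.congr_of_eventuallyEq h2.symm).unique (hasDerivAt_const 0 0)

theorem hasVelocity_pull (hx : x ∈ S.level) {U : Set M} (hU : IsOpen U) {W : M → E}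
    (hW : ∀ z ∈ U, SmoothFieldAt W z) (hxU : x ∈ U) {F : Type*} [AddCommGroup F] [Module ℝ F]
    (π : E →ₗ[ℝ] F) :
    ∀ᶠ s in 𝓝 (0 : ℝ), HasVelocity (fun s => π (S.pull W x s)) (π (S.pull (S.lieX W) x s)) s := by
  have h3 : S.φ 0 x ∈ U := by rwa [S.flow.zero]
  filter_upwards [(hU.preimage (continuous_φ S hx)).mem_nhds h3] with s hs l
  exact hasVelocity_iff.2 (hasDerivAt_pull hx (hW _ hs)) (l.comp π)

/-- The pullbacks of the `W_j` form a moving frame of the reduced Jacobi curve, whose first two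
derivatives at time zero are the classes of `[X, W_j]` and `[X, [X, W_j]]`. The comparison with a
canonical frame therefore needs only the pairings of these fields at the base point, which are
continuous. So the constant can be chosen locally uniform, although no continuity of the canonical
frames in the base point is shown. -/
theorem norming_frame_spec (hmono : S.Monotone) (hconj : S.NoConjugatePoints)
    (hcompact : IsCompact S.level) {U : Set M} {W : Fin (S.n - 1) → M → E} (hU : IsOpen U)
    (hW : ∀ i, ∀ y ∈ U, SmoothFieldAt (W i) y)
    (hsp : ∀ z ∈ U, Submodule.span ℝ (Set.range fun i => W i z)
          = S.lag z ⊓ skewCompl (S.form z) (S.ham z))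
    (h0 : ∀ i, ∀ y ∈ S.level, y ∈ U → S.form y (S.ham y) (W i y) = 0)
    (h0' : ∀ i, ∀ y ∈ S.level, y ∈ U → S.form y (S.ham y) (S.lieX (W i) y) = 0)
    (h0'' : ∀ i, ∀ y ∈ S.level, y ∈ U → S.form y (S.ham y) (S.lieX (S.lieX (W i)) y) = 0)
    (p : S.Lift) (hyU : p.base ∈ U) {c B : ℝ} (hc : 0 < c) (hB : 0 ≤ B)
    (hell : ∀ a : Fin (S.n - 1) → ℝ, c * ∑ i, a i ^ 2
      ≤ ∑ i, ∑ j, a i * a j * S.form p.base (S.lieX (W i) p.base) (W j p.base))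
    (hb₁ : ∀ i j, |S.form p.base (S.lieX (W i) p.base) (W j p.base)| ≤ B)
    (hb₂ : ∀ i j, |S.form p.base (S.lieX (W i) p.base) (S.lieX (W j) p.base)| ≤ B)
    (hb₃ : ∀ i j, |S.form p.base (S.lieX (S.lieX (W i)) p.base) (W j p.base)| ≤ B) :
    (p.size ≤ frameConst (S.n - 1) c B * ∑ j, (|S.form p.base p.vec (W j p.base)|
          + |S.form p.base p.vec (S.lieX (W j) p.base)|) ∧
        ∑ j, (|S.form p.base p.vec (W j p.base)|
          + |S.form p.base p.vec (S.lieX (W j) p.base)|) ≤ frameConst (S.n - 1) c B * p.size ∧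
        ∃ a b : Fin (S.n - 1) → ℝ, (∃ r : ℝ, p.vec = ∑ j, a j • W j p.base
            + ∑ j, b j • S.lieX (W j) p.base + r • S.ham p.base) ∧
          ∀ j, |a j| ≤ frameConst (S.n - 1) c B * p.size ∧
            |b j| ≤ frameConst (S.n - 1) c B * p.size) ∧
      (p.cls ∈ S.reducedJacobi _ 0 ↔ ∀ j, S.form p.base p.vec (W j p.base) = 0) := by
  obtain ⟨⟨y, v⟩, hy, hv⟩ := p
  simp only [Lift.base, Lift.vec] at *
  let α : S.level := ⟨y, hy⟩
  have := finiteDimensional_reducedBundle α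
  have h := isMonotoneFamily_reducedJacobi hmono hconj hcompact α
  have hex := h.exists_canonicalFrame (finrank_reducedBundle α)
  have hN : Lift.size ⟨(y, v), hy, hv⟩
      = basisNorm (hex.choose 0) (Lift.cls ⟨(y, v), hy, hv⟩) := dif_pos hex
  obtain ⟨π, hπ⟩ := exists_projection α
  have hform : ∀ u w, S.form y (S.ham y) u = 0 → S.form y (S.ham y) w = 0 →
      S.reducedForm α (π u) (π w) = S.form y u w := fun u w hu hw => by
    rw [hπ u hu, hπ w hw]
    exact reducedForm_cls α hu hw
  have hWm : ∀ i, ∀ z ∈ U, W i z ∈ S.lag z ⊓ skewCompl (S.form z) (S.ham z) := fun i z hz => by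
    rw [← hsp z hz]; exact Submodule.subset_span ⟨i, rfl⟩
  have hlag : S.reducedJacobi α 0 = Submodule.span ℝ (Set.range fun i => π (W i y)) := by
    have e1 : (Set.range fun i => π (W i y)) = π '' Set.range fun i => W i y := by
      rw [← Set.range_comp]; rfl
    rw [e1, ← Submodule.map_span, hsp y hyU]
    ext w
    rw [mem_reducedJacobi, Submodule.mem_map]
    have e2 : ∀ u, u ∈ S.jac y 0 ↔ u ∈ S.lag y := fun u => by
      rw [mem_jacobi, T_zero, S.flow.zero]
    constructor
    · rintro ⟨u, hu, hu1, rfl⟩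
      exact ⟨u, ⟨(e2 u).1 hu1, hu⟩, hπ u hu⟩
    · rintro ⟨u, ⟨hu1, hu⟩, rfl⟩
      exact ⟨u, hu, (e2 u).2 hu1, (hπ u hu).symm⟩
  have hcls : Lift.cls ⟨(y, v), hy, hv⟩ = π v := (hπ v hv).symm
  have hmem : Lift.cls ⟨(y, v), hy, hv⟩ ∈ S.reducedJacobi α 0 ↔
      ∀ j, S.form y v (W j y) = 0 := by
    rw [hcls, h.lagrangian 0, hlag]
    constructor
    · intro h1 j
      rw [← hform v _ hv (h0 j y hy hyU)]
      exact h1 _ (Submodule.subset_span ⟨j, rfl⟩)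
    · intro h1 w hw
      obtain ⟨a, rfl⟩ := (Submodule.mem_span_range_iff_exists_fun ℝ).1 hw
      simp [hform v _ hv (h0 _ y hy hyU), h1]
  refine ⟨?_, hmem⟩
  have hcmp := h.basisNorm_comparison (E := fun j s => π (S.pull (W j) y s))
    (E' := fun j s => π (S.pull (S.lieX (W j)) y s))
    (E'' := fun j => π (S.pull (S.lieX (S.lieX (W j))) y 0)) (c := c) (B₀ := B)
    hex.choose_spec (Filter.eventually_all.2 fun j => hasVelocity_pull hy hU (hW j) hyU π)
    (fun j => (hasVelocity_pull hy hU (fun z hz => SmoothFieldAt.lieX S (hW j z hz)) hyU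
      π).self_of_nhds) ?_ ?_ hc hB ?_ ?_ ?_ ?_ (π v)
  · simp only [pull_zero, hform v _ hv (h0 _ y hy hyU), hform v _ hv (h0' _ y hy hyU)] at hcmp
    rw [hN, hcls]
    refine ⟨hcmp.1, hcmp.2.1, ?_⟩
    obtain ⟨a, b, hab, hle⟩ := hcmp.2.2
    refine ⟨a, b, ?_, hle⟩
    -- The coordinates are those of the class of `v`. The representatives `v` and `u` of this class
    -- differ by a multiple of `X`, for which no bound is claimed.
    set u := ∑ j, a j • W j y + ∑ j, b j • S.lieX (W j) y with hu
    have hu0 : S.form y (S.ham y) u = 0 := by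
      simp [hu, h0 _ y hy hyU, h0' _ y hy hyU]
    have h1 : π v = π u := by
      rw [hab, hu]; simp
    have h2 : S.form y (S.ham y) (v - u) = 0 := by rw [map_sub, hv, hu0, sub_zero]
    have h3 : Lift.cls ⟨(y, v - u), hy, h2⟩ = 0 := by
      refine (hπ _ h2).symm.trans ?_
      rw [map_sub, h1, sub_self]
    obtain ⟨r, hr⟩ := mkQ_lineIn_eq_zero.1 h3
    exact ⟨r, sub_eq_iff_eq_add'.1 hr⟩
  · rw [Filter.eventually_all]
    intro j
    have h3 : S.φ 0 y ∈ U := by rwa [S.flow.zero]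
    filter_upwards [(hU.preimage (continuous_φ S hy)).mem_nhds h3] with s hs
    have h4 := hWm j _ hs
    have h5 : S.form y (S.ham y) (S.pull (W j) y s) = 0 := by
      rw [← form_T hy s, T_ham hy, T_pull hy]; exact h4.2
    exact mem_reducedJacobi.2 ⟨_, h5, pull_mem_jacobi hy h4.1, (hπ _ h5).symm⟩
  · simp only [pull_zero]
    exact hlag.le
  · simpa only [pull_zero, hform _ _ (h0' _ y hy hyU) (h0 _ y hy hyU)] using hell
  · simpa only [pull_zero, hform _ _ (h0' _ y hy hyU) (h0 _ y hy hyU)] using hb₁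
  · simpa only [pull_zero, hform _ _ (h0' _ y hy hyU) (h0' _ y hy hyU)] using hb₂
  · simpa only [pull_zero, hform _ _ (h0'' _ y hy hyU) (h0 _ y hy hyU)] using hb₃

/-- Near each point of the level set there is a norming frame. -/
theorem exists_isNormingFrame (hmono : S.Monotone) (hconj : S.NoConjugatePoints)
    (hcompact : IsCompact S.level) (hx : x ∈ S.level) :
    ∃ C U β, x ∈ U ∧ IsNormingFrame S C U β := by
  obtain ⟨U, W, hU, hxU, hW, hsp⟩ := exists_reduced_frame hmono hconj hcompact hx
  have hWm : ∀ i, ∀ y ∈ U, W i y ∈ S.lag y ⊓ skewCompl (S.form y) (S.ham y) := fun i y hy => by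
    rw [← (hsp y hy).2]; exact Submodule.subset_span ⟨i, rfl⟩
  have hW' : ∀ i, ∀ y ∈ U, SmoothFieldAt (S.lieX (W i)) y := fun i y hy =>
    SmoothFieldAt.lieX S (hW i y hy)
  have hW'' : ∀ i, ∀ y ∈ U, SmoothFieldAt (S.lieX (S.lieX (W i))) y := fun i y hy =>
    SmoothFieldAt.lieX S (hW' i y hy)
  have h0 : ∀ i, ∀ y ∈ S.level, y ∈ U → S.form y (S.ham y) (W i y) = 0 := fun i y _ hy =>
    (hWm i y hy).2
  have h0' : ∀ i, ∀ y ∈ S.level, y ∈ U → S.form y (S.ham y) (S.lieX (W i) y) = 0 :=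
    fun i y hy hyU => form_ham_lieX hU (hW i) (h0 i) hy hyU
  have h0'' : ∀ i, ∀ y ∈ S.level, y ∈ U →
      S.form y (S.ham y) (S.lieX (S.lieX (W i)) y) = 0 :=
    fun i y hy hyU => form_ham_lieX hU (hW' i) (h0' i) hy hyU
  obtain ⟨c, hc, hell⟩ := eventually_elliptic_form hmono hx hU hxU hW
    (fun i y hy => (hWm i y hy).1) (hsp x hxU).1
  obtain ⟨B₁, hB₁, hb₁⟩ := eventually_abs_le (fun q : Fin (S.n - 1) × Fin (S.n - 1) =>
    continuousAt_form S (hW' q.1 x hxU) (hW q.2 x hxU))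
  obtain ⟨B₂, hB₂, hb₂⟩ := eventually_abs_le (fun q : Fin (S.n - 1) × Fin (S.n - 1) =>
    continuousAt_form S (hW' q.1 x hxU) (hW' q.2 x hxU))
  obtain ⟨B₃, hB₃, hb₃⟩ := eventually_abs_le (fun q : Fin (S.n - 1) × Fin (S.n - 1) =>
    continuousAt_form S (hW'' q.1 x hxU) (hW q.2 x hxU))
  obtain ⟨U', hU'sub, hU', hxU'⟩ := eventually_nhds_iff.1
    (((hell.and hb₁).and (hb₂.and hb₃)).and (hU.mem_nhds hxU))
  set B := max B₁ (max B₂ B₃)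
  set C := frameConst (S.n - 1) c B
  have key := fun (p : S.Lift) (hp : p.base ∈ U') =>
    norming_frame_spec hmono hconj hcompact hU hW (fun z hz => (hsp z hz).2) h0 h0' h0'' p
      (hU'sub _ hp).2 hc (B := B) (hB₁.trans (le_max_left _ _)) (hU'sub _ hp).1.1.1
      (fun i j => ((hU'sub _ hp).1.1.2 (i, j)).trans (le_max_left _ _))
      (fun i j => ((hU'sub _ hp).1.2.1 (i, j)).trans
        ((le_max_left _ _).trans (le_max_right _ _)))
      (fun i j => ((hU'sub _ hp).1.2.2 (i, j)).trans
        ((le_max_right _ _).trans (le_max_right _ _)))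
  refine ⟨C, U', Sum.elim W fun j => S.lieX (W j), hxU', ?_⟩
  refine ⟨hU', ?_, ?_, fun p hp => ?_, fun p hp => ?_, fun p hp => ?_, fun p hp => (key p hp).2⟩
  · rintro (l | l) y hy
    · exact hW l y (hU'sub y hy).2
    · exact hW' l y (hU'sub y hy).2
  · rintro (l | l) y hyl hy
    · exact h0 l y hyl (hU'sub y hy).2
    · exact h0' l y hyl (hU'sub y hy).2
  · rw [Fintype.sum_sum_type, ← Finset.sum_add_distrib]
    exact (key p hp).1.1
  · rw [Fintype.sum_sum_type, ← Finset.sum_add_distrib]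
    exact (key p hp).1.2.1
  · obtain ⟨a, b, ⟨r, hr⟩, hab⟩ := (key p hp).1.2.2
    refine ⟨Sum.elim a b, r, ?_, ?_⟩
    · rw [Fintype.sum_sum_type]
      exact hr
    · rintro (l | l)
      · exact (hab l).1
      · exact (hab l).2

end HamiltonianLevel

theorem IsCompact.exists_tendsto_ultrafilter {X ι : Type*} [TopologicalSpace X] {K : Set X}
    (hK : IsCompact K) (f : Ultrafilter ι) {u : ι → X} (h : ∀ᶠ k in (f : Filter ι), u k ∈ K) :
    ∃ x ∈ K, Filter.Tendsto u f (𝓝 x) := by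
  obtain ⟨x, hx, hle⟩ := hK.ultrafilter_le_nhds (f.map u) (by
    rw [Ultrafilter.coe_map, Filter.le_principal_iff]
    exact h)
  exact ⟨x, hx, hle⟩

/-! ### The flow on the reduced bundle: short-time bounds and limits of vectors -/

namespace HamiltonianLevel

variable {E : Type*} [NormedAddCommGroup E] [NormedSpace ℝ E]
  {M : Type*} [TopologicalSpace M] [ChartedSpace E M] [IsManifold 𝓘(ℝ, E) ∞ M]
  {S : HamiltonianLevel E M} {x : M}

/-- The flow on the vectors over the level set. -/
noncomputable def liftFlow (t : ℝ) (p : S.Lift) : S.Lift :=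
  ⟨(S.φ t p.base, S.T t p.base p.vec), φ_mem p.base_mem t, by
    rw [← T_ham p.base_mem, form_T p.base_mem]; exact p.form_ham⟩

theorem cls_liftFlow (t : ℝ) (p : S.Lift) :
    (liftFlow t p).cls = S.reducedFlow t ⟨p.base, p.base_mem⟩ p.cls := rfl

theorem liftFlow_zero (p : S.Lift) : liftFlow 0 p = p :=
  Subtype.ext (Prod.ext (S.flow.zero _) (T_zero _ _))

/-- Pairs of a base point and a vector of the model space make the group law an equation in a single
type; in the reduced bundle the two sides would have values in fibres over base points that are
equal only propositionally. -/
theorem liftFlow_liftFlow (s t : ℝ) (p : S.Lift) :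
    liftFlow s (liftFlow t p) = liftFlow (s + t) p :=
  Subtype.ext (Prod.ext (φ_φ p.base_mem s t) (T_T p.base_mem s t _))

/-- The component along `X` drops out, because the flow carries `X` to `X` and the fields `γ` are
skew-orthogonal to it. This is why the coefficient `r` never needs a bound. -/
theorem IsNormingFrame.form_flow {C : ℝ} {U : Set M}
    {γ : Fin (S.n - 1) ⊕ Fin (S.n - 1) → M → E} (h : IsNormingFrame S C U γ) {s : ℝ} {p : S.Lift}
    (hp : S.φ s p.base ∈ U) {β : Fin (S.n - 1) ⊕ Fin (S.n - 1) → M → E}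
    {z : Fin (S.n - 1) ⊕ Fin (S.n - 1) → ℝ} {r : ℝ}
    (hz : p.vec = ∑ l, z l • β l p.base + r • S.ham p.base) (m : Fin (S.n - 1) ⊕ Fin (S.n - 1)) :
    S.form (S.φ s p.base) (S.T s p.base p.vec) (γ m (S.φ s p.base))
      = ∑ l, z l * S.form (S.φ s p.base) (S.T s p.base (β l p.base)) (γ m (S.φ s p.base)) := by
  have h1 := h.form_ham m _ (φ_mem p.base_mem s) hp
  rw [hz]
  simp [T_ham p.base_mem, h1]

variable [FiniteDimensional ℝ E]

theorem exists_uniform_isNormingFrame (hmono : S.Monotone) (hconj : S.NoConjugatePoints)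
    (hcompact : IsCompact S.level) :
    ∃ C, 1 ≤ C ∧ ∀ x ∈ S.level, ∃ U β, x ∈ U ∧ IsNormingFrame S C U β := by
  have := FiniteDimensional.complete ℝ E
  obtain ⟨C, hC⟩ := hcompact.exists_uniform (P := fun C x => ∃ U β, x ∈ U ∧ IsNormingFrame S C U β)
    (fun C C' y hC ⟨U, β, h1, h2⟩ => ⟨U, β, h1, h2.mono hC⟩) (fun x hx => by
      obtain ⟨C, U, β, h1, h2⟩ := exists_isNormingFrame hmono hconj hcompact hx
      refine ⟨C, mem_nhdsWithin_of_mem_nhds ?_⟩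
      filter_upwards [h2.isOpen.mem_nhds h1] with y hy
      exact ⟨U, β, hy, h2⟩)
  refine ⟨max 1 C, le_max_left _ _, fun x hx => ?_⟩
  obtain ⟨U, β, h1, h2⟩ := hC x hx
  exact ⟨U, β, h1, h2.mono (le_max_right _ _)⟩

theorem continuousAt_flow (hx : x ∈ S.level) (s : ℝ) :
    ContinuousAt (fun q : ℝ × M => S.φ q.1 q.2) (s, x) :=
  (S.flow.contMDiffAt (S.complete s x hx)).continuousAt

theorem tendsto_form_T {ι : Type*} {f : Filter ι} {u : ι → M} (hx : x ∈ S.level)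
    (hu : Filter.Tendsto u f (𝓝 x)) {V W : M → E} {s : ℝ} (hV : SmoothFieldAt V x)
    (hW : SmoothFieldAt W (S.φ s x)) :
    Filter.Tendsto (fun k => S.form (S.φ s (u k)) (S.T s (u k) (V (u k))) (W (S.φ s (u k)))) f
      (𝓝 (S.form (S.φ s x) (S.T s x (V x)) (W (S.φ s x)))) := by
  have h1 : Filter.Tendsto (fun k => (s, u k)) f (𝓝 (s, x)) := tendsto_const_nhds.prodMk_nhds hu
  have h2 := (continuousAt_form_T hx hV hW).tendsto.comp h1
  simp only [Function.comp_def] at h2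
  exact h2

/-- The flow is bounded on the reduced bundle, uniformly for times in a compact interval. -/
theorem exists_size_liftFlow_le {C : ℝ} (hC : 1 ≤ C) (hcompact : IsCompact S.level)
    (hframe : ∀ x ∈ S.level, ∃ U β, x ∈ U ∧ IsNormingFrame S C U β) :
    ∃ K, ∀ (s : ℝ) (p : S.Lift), |s| ≤ 1 → (liftFlow s p).size ≤ K * p.size := by
  suffices h : ∀ q ∈ Set.Icc (-1 : ℝ) 1 ×ˢ S.level, ∃ K, ∀ᶠ q' in 𝓝[Set.Icc (-1 : ℝ) 1 ×ˢ S.level] q,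
      ∀ p : S.Lift, p.base = q'.2 → (liftFlow q'.1 p).size ≤ K * p.size by
    obtain ⟨K, hK⟩ := (isCompact_Icc.prod hcompact).exists_uniform
      (P := fun K q => ∀ p : S.Lift, p.base = q.2 → (liftFlow q.1 p).size ≤ K * p.size)
      (fun K K' q hK h p hp => (h p hp).trans (mul_le_mul_of_nonneg_right hK (size_nonneg p))) h
    exact ⟨K, fun s p hs => hK (s, p.base) ⟨abs_le.1 hs, p.base_mem⟩ p rfl⟩
  rintro ⟨s₀, x₀⟩ ⟨-, hx₀⟩
  obtain ⟨U, β, hxU, hβ⟩ := hframe x₀ hx₀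
  obtain ⟨U', γ, hxU', hγ⟩ := hframe _ (φ_mem hx₀ s₀)
  obtain ⟨B, hB, hb⟩ := eventually_abs_le (z := (s₀, x₀))
    (fun lm : (Fin (S.n - 1) ⊕ Fin (S.n - 1)) × (Fin (S.n - 1) ⊕ Fin (S.n - 1)) =>
      continuousAt_form_T hx₀ (hβ.smooth lm.1 _ hxU) (hγ.smooth lm.2 _ hxU'))
  refine ⟨C * ∑ _m : Fin (S.n - 1) ⊕ Fin (S.n - 1), ∑ _l : Fin (S.n - 1) ⊕ Fin (S.n - 1),
    C * B, mem_nhdsWithin_of_mem_nhds ?_⟩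
  filter_upwards [hb, (continuousAt_flow hx₀ s₀).eventually (hγ.isOpen.mem_nhds hxU'),
    continuousAt_snd.eventually (hβ.isOpen.mem_nhds hxU)] with q hq hqU' hqU p hp
  obtain ⟨s, y⟩ := q
  obtain rfl : p.base = y := hp
  obtain ⟨z, r, hz, hzle⟩ := hβ.expand p hqU
  refine (hγ.size_le (liftFlow s p) hqU').trans ?_
  rw [mul_assoc]
  refine mul_le_mul_of_nonneg_left ?_ (zero_le_one.trans hC)
  rw [Finset.sum_mul]
  refine Finset.sum_le_sum fun m _ => ?_
  refine (le_of_eq (congrArg abs (hγ.form_flow hqU' hz m))).trans ?_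
  rw [Finset.sum_mul]
  refine (Finset.abs_sum_le_sum_abs _ _).trans (Finset.sum_le_sum fun l _ => ?_)
  rw [abs_mul]
  calc _ ≤ (C * p.size) * B := mul_le_mul (hzle l) (hq (l, m)) (abs_nonneg _)
        (mul_nonneg (zero_le_one.trans hC) (size_nonneg p))
    _ = C * B * p.size := by ring

/-- Convergence of coordinates implies convergence of norms up to a constant factor, at all times. -/
theorem limit_lift_spec {C : ℝ} (hC : 1 ≤ C)
    (hframe : ∀ x ∈ S.level, ∃ U β, x ∈ U ∧ IsNormingFrame S C U β) (f : Ultrafilter ℕ)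
    (p : ℕ → S.Lift) (a : ℕ → ℝ) (ha : ∀ k, 0 < a k) (q : S.Lift)
    (hlim : Filter.Tendsto (fun k => (p k).base) f (𝓝 q.base)) {U : Set M}
    {β : Fin (S.n - 1) ⊕ Fin (S.n - 1) → M → E} (hxU : q.base ∈ U) (hβ : IsNormingFrame S C U β)
    {z : ℕ → Fin (S.n - 1) ⊕ Fin (S.n - 1) → ℝ} {r : ℕ → ℝ}
    (hzr : ∀ k, (p k).base ∈ U →
      (p k).vec = ∑ l, z k l • β l (p k).base + r k • S.ham (p k).base)
    {ζ : Fin (S.n - 1) ⊕ Fin (S.n - 1) → ℝ}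
    (hζ : ∀ l, Filter.Tendsto (fun k => z k l / a k) f (𝓝 (ζ l)))
    (hq : q.vec = ∑ l, ζ l • β l q.base) (s : ℝ) :
      (∀ b, (∀ᶠ k in (f : Filter ℕ), (liftFlow s (p k)).size ≤ b * a k) →
        (liftFlow s q).size ≤ C ^ 2 * b) ∧
      (∀ b, (∀ᶠ k in (f : Filter ℕ), b * a k ≤ (liftFlow s (p k)).size) →
        b ≤ C ^ 2 * (liftFlow s q).size) ∧
      ((∀ᶠ k in (f : Filter ℕ), (liftFlow s (p k)).cls ∈ S.reducedJacobi _ 0) →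
        (liftFlow s q).cls ∈ S.reducedJacobi _ 0) := by
  have hC0 : 0 ≤ C := zero_le_one.trans hC
  have hx₀ := q.base_mem
  have hU := hlim.eventually (hβ.isOpen.mem_nhds hxU)
  obtain ⟨U', γ, hxU', hγ⟩ := hframe _ (φ_mem hx₀ s)
  have hpair : Filter.Tendsto (fun k => (s, (p k).base)) f (𝓝 (s, q.base)) :=
    (tendsto_const_nhds.prodMk_nhds hlim)
  have hU' : ∀ᶠ k in (f : Filter ℕ), (liftFlow s (p k)).base ∈ U' :=
    hpair.eventually ((continuousAt_flow hx₀ s).eventually (hγ.isOpen.mem_nhds hxU'))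
  have hqU' : (liftFlow s q).base ∈ U' := hxU'
  have hβγ : ∀ l m, Filter.Tendsto (fun k => S.form (S.φ s (p k).base)
      (S.T s (p k).base (β l (p k).base)) (γ m (S.φ s (p k).base))) f
      (𝓝 (S.form (S.φ s q.base) (S.T s q.base (β l q.base)) (γ m (S.φ s q.base)))) := fun l m =>
    tendsto_form_T hx₀ hlim (hβ.smooth l _ hxU) (hγ.smooth m _ hxU')
  -- The pairings at time `s` are linear in the coordinates, with coefficients that depend
  -- continuously on the base point. So convergence of the base points and of the rescaled
  -- coordinates suffices.
  have hconv : ∀ m, Filter.Tendsto (fun k => S.form (liftFlow s (p k)).base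
      (liftFlow s (p k)).vec (γ m (liftFlow s (p k)).base) / a k) f
      (𝓝 (S.form (liftFlow s q).base (liftFlow s q).vec (γ m (liftFlow s q).base))) := by
    intro m
    have h1 : S.form (liftFlow s q).base (liftFlow s q).vec (γ m (liftFlow s q).base)
        = ∑ l, ζ l * S.form (S.φ s q.base) (S.T s q.base (β l q.base)) (γ m (S.φ s q.base)) :=
      hγ.form_flow (p := q) (r := 0) hxU' (by simp [hq]) m
    rw [h1]
    have h2 : Filter.Tendsto (fun k => ∑ l, z k l / a k * S.form (S.φ s (p k).base)
        (S.T s (p k).base (β l (p k).base)) (γ m (S.φ s (p k).base))) f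
        (𝓝 (∑ l, ζ l * S.form (S.φ s q.base) (S.T s q.base (β l q.base)) (γ m (S.φ s q.base)))) :=
      tendsto_finsetSum _ fun l _ => (hζ l).mul (hβγ l m)
    refine h2.congr' ?_
    filter_upwards [hU, hU'] with k hk hk'
    have h3 := hγ.form_flow (p := p k) hk' (hzr k hk) m
    refine Eq.trans ?_ (congrArg (· / a k) h3).symm
    simp only [Finset.sum_div, div_mul_eq_mul_div]
  have hsum : Filter.Tendsto (fun k => (∑ m, |S.form (liftFlow s (p k)).base
      (liftFlow s (p k)).vec (γ m (liftFlow s (p k)).base)|) / a k) f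
      (𝓝 (∑ m, |S.form (liftFlow s q).base (liftFlow s q).vec (γ m (liftFlow s q).base)|)) := by
    have h1 := tendsto_finsetSum (Finset.univ) fun m _ => (hconv m).abs
    refine h1.congr fun k => ?_
    simp only [abs_div, abs_of_pos (ha k), Finset.sum_div]
  -- Size is compared with pairings once along the sequence and once at the limit, each time at the
  -- cost of a factor `C`. Membership in the reduced distribution is the vanishing of half of the
  -- pairings, a closed condition.
  refine ⟨fun b hb => ?_, fun b hb => ?_, fun h => ?_⟩
  · have h1 : ∑ m, |S.form (liftFlow s q).base (liftFlow s q).vec (γ m (liftFlow s q).base)|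
        ≤ C * b := by
      refine le_of_tendsto hsum ?_
      filter_upwards [hb, hU'] with k hk hk'
      rw [div_le_iff₀ (ha k)]
      calc _ ≤ C * (liftFlow s (p k)).size := hγ.le_size _ hk'
        _ ≤ C * (b * a k) := mul_le_mul_of_nonneg_left hk hC0
        _ = C * b * a k := by ring
    calc _ ≤ C * _ := hγ.size_le _ hqU'
      _ ≤ C * (C * b) := mul_le_mul_of_nonneg_left h1 hC0
      _ = C ^ 2 * b := by ring
  · have h1 : b ≤ C * ∑ m, |S.form (liftFlow s q).base (liftFlow s q).vec
        (γ m (liftFlow s q).base)| := by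
      refine ge_of_tendsto (hsum.const_mul C) ?_
      filter_upwards [hb, hU'] with k hk hk'
      rw [← mul_div_assoc, le_div_iff₀ (ha k)]
      exact hk.trans (hγ.size_le _ hk')
    calc b ≤ _ := h1
      _ ≤ C * (C * (liftFlow s q).size) := mul_le_mul_of_nonneg_left (hγ.le_size _ hqU') hC0
      _ = C ^ 2 * (liftFlow s q).size := by ring
  · refine (hγ.mem_iff _ hqU').2 fun j => ?_
    refine tendsto_nhds_unique (hconv (Sum.inl j)) (tendsto_const_nhds.congr' ?_)
    filter_upwards [h, hU'] with k hk hk'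
    rw [(hγ.mem_iff _ hk').1 hk j, zero_div]

/-- Limits of bounded sequences of vectors, along an ultrafilter. -/
theorem exists_limit_lift {C : ℝ} (hC : 1 ≤ C) (hcompact : IsCompact S.level)
    (hframe : ∀ x ∈ S.level, ∃ U β, x ∈ U ∧ IsNormingFrame S C U β) (f : Ultrafilter ℕ)
    (p : ℕ → S.Lift) (a : ℕ → ℝ) (ha : ∀ k, 0 < a k) {K : ℝ} (hK : ∀ k, (p k).size ≤ K * a k) :
    ∃ q : S.Lift, ∀ s,
      (∀ b, (∀ᶠ k in (f : Filter ℕ), (liftFlow s (p k)).size ≤ b * a k) →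
        (liftFlow s q).size ≤ C ^ 2 * b) ∧
      (∀ b, (∀ᶠ k in (f : Filter ℕ), b * a k ≤ (liftFlow s (p k)).size) →
        b ≤ C ^ 2 * (liftFlow s q).size) ∧
      ((∀ᶠ k in (f : Filter ℕ), (liftFlow s (p k)).cls ∈ S.reducedJacobi _ 0) →
        (liftFlow s q).cls ∈ S.reducedJacobi _ 0) := by
  have hC0 : 0 ≤ C := zero_le_one.trans hC
  obtain ⟨x₀, hx₀, hlim⟩ := hcompact.exists_tendsto_ultrafilter f (u := fun k => (p k).base)
    (Filter.Eventually.of_forall fun k => (p k).base_mem)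
  obtain ⟨U, β, hxU, hβ⟩ := hframe x₀ hx₀
  have hex : ∀ k, ∃ (z : Fin (S.n - 1) ⊕ Fin (S.n - 1) → ℝ) (r : ℝ), (p k).base ∈ U →
      (p k).vec = ∑ l, z l • β l (p k).base + r • S.ham (p k).base ∧
        ∀ l, |z l| ≤ C * (p k).size := fun k => by
    by_cases hk : (p k).base ∈ U
    · obtain ⟨z, r, h⟩ := hβ.expand (p k) hk
      exact ⟨z, r, fun _ => h⟩
    -- Arbitrary coordinates off `U`; the base points are in `U` along the ultrafilter.
    · exact ⟨0, 0, fun h => absurd h hk⟩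
  choose z r hzr using hex
  have hU := hlim.eventually (hβ.isOpen.mem_nhds hxU)
  have hζ : ∀ l, ∃ ζ, Filter.Tendsto (fun k => z k l / a k) f (𝓝 ζ) := fun l => by
    obtain ⟨ζ, -, h⟩ := (isCompact_Icc (a := -(C * K)) (b := C * K)).exists_tendsto_ultrafilter f
      (u := fun k => z k l / a k) (by
        filter_upwards [hU] with k hk
        refine abs_le.1 ?_
        rw [abs_div, abs_of_pos (ha k), div_le_iff₀ (ha k)]
        calc |z k l| ≤ C * (p k).size := (hzr k hk).2 l
          _ ≤ C * (K * a k) := mul_le_mul_of_nonneg_left (hK k) hC0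
          _ = C * K * a k := by ring)
    exact ⟨ζ, h⟩
  choose ζ hζ using hζ
  exact ⟨⟨(x₀, ∑ l, ζ l • β l x₀), hx₀, by simp [hβ.form_ham _ x₀ hx₀ hxU]⟩,
    limit_lift_spec hC hframe f p a ha _ hlim hxU hβ (fun k hk => (hzr k hk).1) hζ rfl⟩

end HamiltonianLevel

/-! ### The canonical norm and the horizontal part -/

section Horizontal

variable {V : Type*} [AddCommGroup V] [Module ℝ V] {σ : V →ₗ[ℝ] V →ₗ[ℝ] ℝ}
  {J : ℝ → Submodule ℝ V} {m : ℕ}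

theorem canonicalNorm_eq (h : ∃ b : ℝ → Basis (Fin m ⊕ Fin m) ℝ V, IsCanonicalFrame σ J b) (w : V) :
    canonicalNorm σ J m w = basisNorm (h.choose 0) w := dif_pos h

theorem canonicalNorm_nonneg (w : V) : 0 ≤ canonicalNorm σ J m w := by
  rw [canonicalNorm]
  split_ifs
  · exact basisNorm_nonneg _ _
  · exact le_rfl

theorem canonicalNorm_zero : canonicalNorm σ J m 0 = 0 := by
  rw [canonicalNorm]
  split_ifs <;> simp [basisNorm]

theorem eq_zero_of_canonicalNorm_eq_zero
    (h : ∃ b : ℝ → Basis (Fin m ⊕ Fin m) ℝ V, IsCanonicalFrame σ J b) {w : V}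
    (hw : canonicalNorm σ J m w = 0) : w = 0 := by
  rw [canonicalNorm_eq h] at hw
  refine (h.choose 0).ext_elem fun k => ?_
  have h1 := abs_repr_le_basisNorm (h.choose 0) w k
  rw [hw] at h1
  simpa using h1

theorem sq_canonicalNorm_horizontalPart
    (h : ∃ b : ℝ → Basis (Fin m ⊕ Fin m) ℝ V, IsCanonicalFrame σ J b) (w : V) :
    canonicalNorm σ J m (horizontalPart σ J m w) ^ 2
      = ∑ k, ((h.choose 0).repr w (Sum.inr k)) ^ 2 := by
  rw [canonicalNorm_eq h, basisNorm, Real.sq_sqrt (Finset.sum_nonneg fun _ _ => sq_nonneg _),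
    horizontalPart, dif_pos h, Fintype.sum_sum_type]
  have h1 : ∀ k, (h.choose 0).repr (∑ i, (h.choose 0).repr w (Sum.inr i) • h.choose 0 (Sum.inr i))
      (Sum.inl k) = 0 := fun k => by
    simp
  have h2 : ∀ k, (h.choose 0).repr (∑ i, (h.choose 0).repr w (Sum.inr i) • h.choose 0 (Sum.inr i))
      (Sum.inr k) = (h.choose 0).repr w (Sum.inr k) := fun k => by
    simp [Finsupp.single_apply]
  simp only [h1, h2]
  simp

theorem canonicalNorm_horizontalPart_le (w : V) :
    canonicalNorm σ J m (horizontalPart σ J m w) ≤ canonicalNorm σ J m w := by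
  by_cases h : ∃ b : ℝ → Basis (Fin m ⊕ Fin m) ℝ V, IsCanonicalFrame σ J b
  · refine le_of_sq_le_sq ?_ (canonicalNorm_nonneg w)
    rw [sq_canonicalNorm_horizontalPart h, canonicalNorm_eq h, basisNorm,
      Real.sq_sqrt (Finset.sum_nonneg fun _ _ => sq_nonneg _), Fintype.sum_sum_type]
    exact le_add_of_nonneg_left (Finset.sum_nonneg fun _ _ => sq_nonneg _)
  · simp [canonicalNorm, dif_neg h]

/-- The horizontal part of `w` controls the pairings of `w` with the curve. -/
theorem IsMonotoneFamily.sq_apply_le_horizontalPart [FiniteDimensional ℝ V]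
    (h : IsMonotoneFamily σ J) (hd : finrank ℝ V = 2 * m) {e : ℝ → V} {e' : V}
    (he : IsVelocityIn J 0 e e') (w : V) :
    σ w (e 0) ^ 2 ≤ canonicalNorm σ J m (horizontalPart σ J m w) ^ 2 * σ e' (e 0) := by
  have hex := h.exists_canonicalFrame hd
  rw [sq_canonicalNorm_horizontalPart hex]
  have hb := hex.choose_spec
  set b := hex.choose
  set c : Fin m → ℝ := fun k => σ (b 0 (Sum.inr k)) (e 0)
  have h1 : e 0 = ∑ k, c k • b 0 (Sum.inl k) := by
    have h2 := hb.expand h.symplectic 0 (e 0)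
    have h3 : ∀ k, σ (e 0) (b 0 (Sum.inl k)) = 0 := fun k =>
      (h.lagrangian 0).apply_eq_zero he.2.self_of_nhds (hb.mem 0 k)
    simpa [h3] using h2
  -- The curve `e` is exchanged for one with constant coefficients in the canonical frame and the
  -- same value at `0`. Its velocity form is the sum of the squares of the coefficients, and
  -- Cauchy–Schwarz concludes.
  have h2 : IsVelocityIn J 0 (fun s => ∑ k, c k • b s (Sum.inl k)) (∑ k, c k • b 0 (Sum.inr k)) := by
    refine ⟨fun l => ?_, Filter.Eventually.of_forall fun s =>
      Submodule.sum_mem _ fun k _ => Submodule.smul_mem _ _ (hb.mem s k)⟩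
    simp only [map_sum, map_smul, smul_eq_mul]
    exact HasDerivAt.fun_sum fun k _ => (hb.velocity 0 k l).const_mul (c k)
  rw [h.velocity_eq he h2 h1]
  have h3 : σ (∑ k, c k • b 0 (Sum.inr k)) (∑ k, c k • b 0 (Sum.inl k)) = ∑ k, c k ^ 2 := by
    simp [hb.form_f_e, sq]
  have h4 : σ w (e 0) = ∑ k, (b 0).repr w (Sum.inr k) * c k := by
    conv_lhs => rw [h1]
    simp only [map_sum, map_smul, smul_eq_mul, hb.repr_inr h.symplectic]
    exact Finset.sum_congr rfl fun k _ => mul_comm _ _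
  rw [h3, h4]
  exact Finset.sum_mul_sq_le_sq_mul_sq _ _ _

theorem tendsto_canonicalNorm {F : Filter ℝ} {u : ℝ → V} {w : V} (hu : VectorTendsto u F w) :
    Filter.Tendsto (fun t => canonicalNorm σ J m (u t)) F (𝓝 (canonicalNorm σ J m w)) := by
  by_cases h : ∃ b : ℝ → Basis (Fin m ⊕ Fin m) ℝ V, IsCanonicalFrame σ J b
  · simp only [canonicalNorm_eq h, basisNorm]
    exact (Real.continuous_sqrt.tendsto _).comp
      (tendsto_finsetSum _ fun k _ => (hu ((h.choose 0).coord k)).pow 2)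
  · simp only [canonicalNorm, dif_neg h]
    exact tendsto_const_nhds

theorem VectorTendsto.map {W : Type*} [AddCommGroup W] [Module ℝ W] {F : Filter ℝ} {u : ℝ → V}
    {w : V} (hu : VectorTendsto u F w) (A : V →ₗ[ℝ] W) : VectorTendsto (fun t => A (u t)) F (A w) :=
  fun l => hu (l.comp A)

theorem SubspaceTendsto.comp {F G : Filter ℝ} {Δ : Submodule ℝ V} (h : SubspaceTendsto J F Δ)
    {r : ℝ → ℝ} (hr : Filter.Tendsto r G F) : SubspaceTendsto (fun t => J (r t)) G Δ := by
  obtain ⟨k, u, v, h1, h2, h3, h4⟩ := h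
  exact ⟨k, fun t => u (r t), v, h1, h2, hr.eventually h3, fun i l => (h4 i l).comp hr⟩

end Horizontal

/-! ### The reduced flow acts on reduced Jacobi curves; bounded vectors lie in the Green bundles -/

namespace HamiltonianLevel

variable {E : Type*} [NormedAddCommGroup E] [NormedSpace ℝ E]
  {M : Type*} [TopologicalSpace M] [ChartedSpace E M] [IsManifold 𝓘(ℝ, E) ∞ M]
  {S : HamiltonianLevel E M} {x : M}

theorem mem_reducedJacobi_cls {t : ℝ} (p : S.Lift) :
    p.cls ∈ S.reducedJacobi ⟨p.base, p.base_mem⟩ t ↔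
      ∃ r : ℝ, p.vec + r • S.ham p.base ∈ S.jac p.base t := by
  rw [mem_reducedJacobi]
  have h0 : S.form p.base (S.ham p.base) (S.ham p.base) = 0 :=
    (S.isSymplecticBilin_form _).self_eq_zero _
  constructor
  · rintro ⟨u, hu, hm, h⟩
    have h1 : (lineIn (S.form p.base) (S.ham p.base)).mkQ (⟨u, hu⟩ - ⟨p.vec, p.form_ham⟩) = 0 := by
      rw [map_sub, sub_eq_zero]; exact h
    obtain ⟨r, hr⟩ := mkQ_lineIn_eq_zero.1 h1
    refine ⟨r, ?_⟩
    rwa [show p.vec + r • S.ham p.base = u from (sub_eq_iff_eq_add'.1 hr).symm]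
  · rintro ⟨r, hr⟩
    have h1 : S.form p.base (S.ham p.base) (p.vec + r • S.ham p.base) = 0 := by
      rw [map_add, map_smul, h0, p.form_ham]; simp
    refine ⟨_, h1, hr, ?_⟩
    have h2 : (lineIn (S.form p.base) (S.ham p.base)).mkQ
        (⟨p.vec + r • S.ham p.base, h1⟩ - ⟨p.vec, p.form_ham⟩) = 0 :=
      mkQ_lineIn_eq_zero.2 ⟨r, add_sub_cancel_left _ _⟩
    rw [map_sub, sub_eq_zero] at h2
    exact h2

/-- The group law for representatives. A correction by a multiple of `X` is carried to the same
multiple of `X`, so it does not interfere. -/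
theorem reducedFlow_mem_iff {s t : ℝ} {α : S.level} {w : S.ReducedBundle α} :
    S.reducedFlow s α w ∈ S.reducedJacobi (S.levelFlow s α) t ↔
      w ∈ S.reducedJacobi α (t + s) := by
  obtain ⟨u, hu, rfl⟩ := Lift.exists_cls_eq α w
  set p : S.Lift := ⟨((α : M), u), α.2, hu⟩ with hp
  refine (mem_reducedJacobi_cls (liftFlow s p)).trans (Iff.trans ?_ (mem_reducedJacobi_cls p).symm)
  refine exists_congr fun r => ?_
  have h1 : (liftFlow s p).vec + r • S.ham (liftFlow s p).base
      = S.T s p.base (p.vec + r • S.ham p.base) := by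
    rw [map_add, map_smul, T_ham p.base_mem]; rfl
  rw [h1, mem_jacobi, mem_jacobi]
  have h2 : S.T t (liftFlow s p).base (S.T s p.base (p.vec + r • S.ham p.base))
      = S.T (t + s) p.base (p.vec + r • S.ham p.base) := T_T p.base_mem t s _
  have h3 : S.φ t (liftFlow s p).base = S.φ (t + s) p.base := φ_φ p.base_mem t s
  rw [h2, h3]

theorem reducedForm_reducedFlow (t : ℝ) (α : S.level) (u w : S.ReducedBundle α) :
    S.reducedForm (S.levelFlow t α) (S.reducedFlow t α u) (S.reducedFlow t α w)
      = S.reducedForm α u w := by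
  obtain ⟨u, hu, rfl⟩ := Lift.exists_cls_eq α u
  obtain ⟨w, hw, rfl⟩ := Lift.exists_cls_eq α w
  exact form_T α.2 t u w

theorem reducedFlow_injective (t : ℝ) (α : S.level) : Function.Injective (S.reducedFlow t α) := by
  refine (injective_iff_map_eq_zero _).2 fun u hu => ?_
  refine (isSymplecticBilin_reduceForm (S.isSymplecticBilin_form α) (S.ham α)).nondeg u fun w => ?_
  have h1 := reducedForm_reducedFlow t α u w
  rw [hu, map_zero] at h1
  exact h1.symm

variable [FiniteDimensional ℝ E]

theorem reducedFlow_surjective (t : ℝ) (α : S.level) : Function.Surjective (S.reducedFlow t α) := by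
  have := finiteDimensional_reducedBundle α
  have := finiteDimensional_reducedBundle (S.levelFlow t α)
  exact (LinearMap.injective_iff_surjective_of_finrank_eq_finrank
    ((finrank_reducedBundle α).trans (finrank_reducedBundle _).symm)).1 (reducedFlow_injective t α)

theorem map_reducedJacobi (s t : ℝ) (α : S.level) :
    (S.reducedJacobi α (t + s)).map (S.reducedFlow s α)
      = S.reducedJacobi (S.levelFlow s α) t := by
  ext w
  obtain ⟨u, rfl⟩ := reducedFlow_surjective s α w
  rw [reducedFlow_mem_iff, Submodule.mem_map]
  exact ⟨fun ⟨v, hv, h⟩ => reducedFlow_injective s α h ▸ hv, fun h => ⟨u, h, rfl⟩⟩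

/-- The flow moves the curve at time `t` to the curve at `φ_t(α)` at time zero and preserves the
form. There the canonical frame gives the estimate by the horizontal part, in the shape required by
the criterion for the limit. -/
theorem sq_reducedForm_le (hmono : S.Monotone) (hconj : S.NoConjugatePoints)
    (hcompact : IsCompact S.level) {α : S.level} {t K : ℝ} {w : S.ReducedBundle α}
    (hw : S.norm (S.levelFlow t α) (S.horizontal _ (S.reducedFlow t α w)) ≤ K)
    {e : ℝ → S.ReducedBundle α} {e' : S.ReducedBundle α}
    (he : IsVelocityIn (S.reducedJacobi α) t e e') :
    S.reducedForm α w (e t) ^ 2 ≤ K ^ 2 * S.reducedForm α e' (e t) := by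
  have h := isMonotoneFamily_reducedJacobi hmono hconj hcompact (S.levelFlow t α)
  have := finiteDimensional_reducedBundle (S.levelFlow t α)
  have h1 : IsVelocityIn (S.reducedJacobi (S.levelFlow t α)) 0
      (fun s => S.reducedFlow t α (e (s + t))) (S.reducedFlow t α e') := by
    refine ⟨fun l => ?_, ?_⟩
    · have h2 : HasDerivAt (fun s => l (S.reducedFlow t α (e s))) (l (S.reducedFlow t α e'))
        (0 + t) := by rw [zero_add]; exact he.1 (l.comp (S.reducedFlow t α))
      exact h2.comp_add_const 0 t
    · have h2 : Filter.Tendsto (fun s : ℝ => s + t) (𝓝 0) (𝓝 t) := by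
        simpa using (continuous_add_const t).tendsto (0 : ℝ)
      filter_upwards [h2.eventually he.2] with s hs using reducedFlow_mem_iff.2 hs
  have h2 := h.sq_apply_le_horizontalPart (finrank_reducedBundle _) h1 (S.reducedFlow t α w)
  have hpos : 0 ≤ S.reducedForm (S.levelFlow t α) (S.reducedFlow t α e')
      ((fun s => S.reducedFlow t α (e (s + t))) 0) := by
    by_cases h0 : (fun s => S.reducedFlow t α (e (s + t))) 0 = 0
    · rw [h0, map_zero]
    · exact (h.velocity_pos h1 h0).le
  have h3 := h2.trans (mul_le_mul_of_nonneg_right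
    (pow_le_pow_left₀ (canonicalNorm_nonneg _) hw 2) hpos)
  simp only [zero_add, reducedForm_reducedFlow] at h3
  exact h3

/-- Vectors whose horizontal part stays bounded in the future lie in the limit of the reduced
Jacobi curve. -/
theorem mem_greenPlus (hmono : S.Monotone) (hconj : S.NoConjugatePoints)
    (hcompact : IsCompact S.level) {α : S.level} {K : ℝ} {w : S.ReducedBundle α}
    (hw : ∀ t, 0 ≤ t → S.norm (S.levelFlow t α) (S.horizontal _ (S.reducedFlow t α w)) ≤ K) :
    w ∈ S.greenPlus α := by
  have := finiteDimensional_reducedBundle α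
  exact (isMonotoneFamily_reducedJacobi hmono hconj hcompact α).mem_limSubspace_atTop (t₀ := 0)
    (C := K ^ 2) fun t ht e e' he => sq_reducedForm_le hmono hconj hcompact (hw t ht) he

theorem mem_greenMinus (hmono : S.Monotone) (hconj : S.NoConjugatePoints)
    (hcompact : IsCompact S.level) {α : S.level} {K : ℝ} {w : S.ReducedBundle α}
    (hw : ∀ t, t ≤ 0 → S.norm (S.levelFlow t α) (S.horizontal _ (S.reducedFlow t α w)) ≤ K) :
    w ∈ S.greenMinus α := by
  have := finiteDimensional_reducedBundle α
  exact (isMonotoneFamily_reducedJacobi hmono hconj hcompact α).mem_limSubspace_atBot (t₀ := 0)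
    (C := K ^ 2) fun t ht e e' he => sq_reducedForm_le hmono hconj hcompact (hw t ht) he

/-- The time `s` map takes the curve at `α`, shifted by `s`, to the curve at `φ_s(α)`, and a shift
of time does not change the limit. So the Green bundles are invariant. -/
theorem map_limSubspace_reducedJacobi {F : Filter ℝ} [F.NeBot] {α : S.level} (s : ℝ)
    (hF : Filter.Tendsto (fun t => t + s) F F)
    (h : SubspaceTendsto (S.reducedJacobi α) F (limSubspace (S.reducedJacobi α) F)) :
    (limSubspace (S.reducedJacobi α) F).map (S.reducedFlow s α)
      = limSubspace (S.reducedJacobi (S.levelFlow s α)) F := by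
  have := finiteDimensional_reducedBundle (S.levelFlow s α)
  have h1 := (h.comp hF).map (S.reducedFlow s α) (reducedFlow_injective s α)
  simp only [map_reducedJacobi] at h1
  exact (limSubspace_eq_of_subspaceTendsto h1).symm

end HamiltonianLevel

/-! ### The Green bundles form a Green system; exponential contraction -/

namespace HamiltonianLevel

variable {E : Type*} [NormedAddCommGroup E] [NormedSpace ℝ E] [FiniteDimensional ℝ E]
  {M : Type*} [TopologicalSpace M] [ChartedSpace E M] [IsManifold 𝓘(ℝ, E) ∞ M]
  {S : HamiltonianLevel E M}

theorem subspaceTendsto_greenPlus (hmono : S.Monotone) (hconj : S.NoConjugatePoints)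
    (hcompact : IsCompact S.level) (α : S.level) :
    SubspaceTendsto (S.reducedJacobi α) Filter.atTop (S.greenPlus α) := by
  have := finiteDimensional_reducedBundle α
  exact (isMonotoneFamily_reducedJacobi hmono hconj hcompact α).limit_atTop.1

theorem subspaceTendsto_greenMinus (hmono : S.Monotone) (hconj : S.NoConjugatePoints)
    (hcompact : IsCompact S.level) (α : S.level) :
    SubspaceTendsto (S.reducedJacobi α) Filter.atBot (S.greenMinus α) := by
  have := finiteDimensional_reducedBundle α
  exact (isMonotoneFamily_reducedJacobi hmono hconj hcompact α).limit_atBot.1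

theorem reducedFlow_mem_greenPlus (hmono : S.Monotone) (hconj : S.NoConjugatePoints)
    (hcompact : IsCompact S.level) (s : ℝ) {α : S.level} {w : S.ReducedBundle α}
    (hw : w ∈ S.greenPlus α) : S.reducedFlow s α w ∈ S.greenPlus (S.levelFlow s α) := by
  rw [greenPlus, ← map_limSubspace_reducedJacobi s
    (Filter.tendsto_atTop_add_const_right _ s Filter.tendsto_id)
    (subspaceTendsto_greenPlus hmono hconj hcompact α)]
  exact Submodule.mem_map_of_mem hw

theorem reducedFlow_mem_greenMinus (hmono : S.Monotone) (hconj : S.NoConjugatePoints)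
    (hcompact : IsCompact S.level) (s : ℝ) {α : S.level} {w : S.ReducedBundle α}
    (hw : w ∈ S.greenMinus α) : S.reducedFlow s α w ∈ S.greenMinus (S.levelFlow s α) := by
  rw [greenMinus, ← map_limSubspace_reducedJacobi s
    (Filter.tendsto_atBot_add_const_right _ s Filter.tendsto_id)
    (subspaceTendsto_greenMinus hmono hconj hcompact α)]
  exact Submodule.mem_map_of_mem hw

theorem cls_liftFlow_mem_greenPlus (hmono : S.Monotone) (hconj : S.NoConjugatePoints)
    (hcompact : IsCompact S.level) (s : ℝ) (p : S.Lift)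
    (hp : p.cls ∈ S.greenPlus ⟨p.base, p.base_mem⟩) :
    (liftFlow s p).cls ∈ S.greenPlus ⟨(liftFlow s p).base, (liftFlow s p).base_mem⟩ := by
  rw [cls_liftFlow]
  exact reducedFlow_mem_greenPlus hmono hconj hcompact s (α := ⟨p.base, p.base_mem⟩) hp

theorem cls_liftFlow_mem_greenMinus (hmono : S.Monotone) (hconj : S.NoConjugatePoints)
    (hcompact : IsCompact S.level) (s : ℝ) (p : S.Lift)
    (hp : p.cls ∈ S.greenMinus ⟨p.base, p.base_mem⟩) :
    (liftFlow s p).cls ∈ S.greenMinus ⟨(liftFlow s p).base, (liftFlow s p).base_mem⟩ := by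
  rw [cls_liftFlow]
  exact reducedFlow_mem_greenMinus hmono hconj hcompact s (α := ⟨p.base, p.base_mem⟩) hp

theorem cls_liftFlow_mem_iff (s t : ℝ) (p : S.Lift) :
    (liftFlow s p).cls ∈ S.reducedJacobi ⟨(liftFlow s p).base, (liftFlow s p).base_mem⟩ t ↔
      p.cls ∈ S.reducedJacobi ⟨p.base, p.base_mem⟩ (t + s) :=
  reducedFlow_mem_iff (α := ⟨p.base, p.base_mem⟩) (w := p.cls)

/-- A vector of the limit is a limit of vectors of `J_α(T)`, and the time `T` map carries these into
the curve at its time zero. At a fixed time `s` all norms are taken in one fibre, where the norm is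
continuous. -/
theorem exists_lift_approx {F : Filter ℝ} {α : S.level} {Δ : Submodule ℝ (S.ReducedBundle α)}
    (h : SubspaceTendsto (S.reducedJacobi α) F Δ) {v : E} (hv : S.form α (S.ham α) v = 0)
    (hm : Lift.cls ⟨((α : M), v), α.2, hv⟩ ∈ Δ) :
    ∃ u : ℝ → S.Lift, (∀ᶠ T in F, (liftFlow T (u T)).cls ∈ S.reducedJacobi _ 0) ∧
      ∀ s, Filter.Tendsto (fun T => (liftFlow s (u T)).size) F
        (𝓝 (liftFlow s ⟨((α : M), v), α.2, hv⟩).size) := by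
  have := finiteDimensional_reducedBundle α
  obtain ⟨w, h1, h2⟩ := h.exists_vectorTendsto hm
  have hw : ∀ T, ∃ (u : E) (hu : S.form α (S.ham α) u = 0),
      Lift.cls (S := S) ⟨((α : M), u), α.2, hu⟩ = w T := fun T => Lift.exists_cls_eq α (w T)
  choose u hu hcls using hw
  refine ⟨fun T => ⟨((α : M), u T), α.2, hu T⟩, ?_, fun s => ?_⟩
  · filter_upwards [h1] with T hT
    rw [cls_liftFlow_mem_iff, zero_add]
    change Lift.cls (S := S) ⟨((α : M), u T), α.2, hu T⟩ ∈ S.reducedJacobi α T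
    rw [hcls]
    exact hT
  · have h3 : (fun T => (liftFlow s (⟨((α : M), u T), α.2, hu T⟩ : S.Lift)).size)
        = fun T => S.norm (S.levelFlow s α) (S.reducedFlow s α (w T)) := by
      funext T
      rw [← hcls T]
      rfl
    rw [h3]
    exact tendsto_canonicalNorm (h2.map (S.reducedFlow s α))

theorem norm_horizontal_le (α : S.level) (w : S.ReducedBundle α) :
    S.norm α (S.horizontal α w) ≤ S.norm α w := canonicalNorm_horizontalPart_le w

/-- The reduced flow with the reduced Green bundles is a Green system. -/
theorem exists_isGreenSystem (hmono : S.Monotone) (hconj : S.NoConjugatePoints)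
    (hcompact : IsCompact S.level) :
    ∃ C, IsGreenSystem (fun t => liftFlow (S := S) t) Lift.size
      {p | p.cls ∈ S.reducedJacobi ⟨p.base, p.base_mem⟩ 0}
      {p | p.cls ∈ S.greenPlus ⟨p.base, p.base_mem⟩}
      {p | p.cls ∈ S.greenMinus ⟨p.base, p.base_mem⟩} C := by
  obtain ⟨C, hC, hframe⟩ := exists_uniform_isNormingFrame hmono hconj hcompact
  obtain ⟨K, hK⟩ := exists_size_liftFlow_le hC hcompact hframe
  have hC2 : 1 ≤ C ^ 2 := one_le_pow₀ hC
  refine ⟨max (C ^ 2) K, hC2.trans (le_max_left _ _), liftFlow_zero, liftFlow_liftFlow, size_nonneg,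
    fun s p hs => (hK s p hs).trans (mul_le_mul_of_nonneg_right (le_max_right _ _) (size_nonneg p)),
    ?_, ?_, ?_, ?_, ?_, fun p hp => ?_, fun p hp => ?_,
    cls_liftFlow_mem_greenPlus hmono hconj hcompact, cls_liftFlow_mem_greenMinus hmono hconj hcompact⟩
  · rintro p a ha ⟨K', hK'⟩
    obtain ⟨q, hq⟩ := exists_limit_lift hC hcompact hframe (Filter.hyperfilter ℕ) p a ha hK'
    refine ⟨q, fun s => ⟨fun b hb => ((hq s).1 b hb).trans ?_, fun b hb =>
      ((hq s).2.1 b hb).trans (mul_le_mul_of_nonneg_right (le_max_left _ _) (size_nonneg _)),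
      (hq s).2.2⟩⟩
    -- The bound `b` is nonnegative as soon as it holds for one index, which is needed to enlarge
    -- the constant from `C ^ 2` to the maximum.
    obtain ⟨k, hk⟩ := hb.exists
    have hb0 : 0 ≤ b := nonneg_of_mul_nonneg_left ((size_nonneg _).trans hk) (ha k)
    exact mul_le_mul_of_nonneg_right (le_max_left _ _) hb0
  · rintro p ⟨K', hK'⟩
    exact mem_greenPlus hmono hconj hcompact fun t ht => (norm_horizontal_le _ _).trans (hK' t ht)
  · rintro p ⟨K', hK'⟩
    exact mem_greenMinus hmono hconj hcompact fun t ht => (norm_horizontal_le _ _).trans (hK' t ht)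
  · intro p hp hL
    have := finiteDimensional_reducedBundle (S := S) ⟨p.base, p.base_mem⟩
    have h0 : p.cls = 0 := Submodule.disjoint_def.1
      ((isMonotoneFamily_reducedJacobi hmono hconj hcompact _).limit_atTop.2.2 0).disjoint _ hp hL
    rw [Lift.size, h0]
    exact canonicalNorm_zero
  · intro p hp hL
    have := finiteDimensional_reducedBundle (S := S) ⟨p.base, p.base_mem⟩
    have h0 : p.cls = 0 := Submodule.disjoint_def.1
      ((isMonotoneFamily_reducedJacobi hmono hconj hcompact _).limit_atBot.2.2 0).disjoint _ hp hL
    rw [Lift.size, h0]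
    exact canonicalNorm_zero
  · exact exists_lift_approx (subspaceTendsto_greenPlus hmono hconj hcompact ⟨p.base, p.base_mem⟩)
      p.form_ham hp
  · exact exists_lift_approx (subspaceTendsto_greenMinus hmono hconj hcompact ⟨p.base, p.base_mem⟩)
      p.form_ham hp

theorem exists_canonicalFrame_reducedJacobi (hmono : S.Monotone) (hconj : S.NoConjugatePoints)
    (hcompact : IsCompact S.level) (α : S.level) :
    ∃ b : ℝ → Basis (Fin (S.n - 1) ⊕ Fin (S.n - 1)) ℝ (S.ReducedBundle α),
      IsCanonicalFrame (S.reducedForm α) (S.reducedJacobi α) b := by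
  have := finiteDimensional_reducedBundle α
  exact (isMonotoneFamily_reducedJacobi hmono hconj hcompact α).exists_canonicalFrame
    (finrank_reducedBundle α)

theorem eq_zero_of_norm_eq_zero (hmono : S.Monotone) (hconj : S.NoConjugatePoints)
    (hcompact : IsCompact S.level) {α : S.level} {w : S.ReducedBundle α} (h : S.norm α w = 0) :
    w = 0 :=
  eq_zero_of_canonicalNorm_eq_zero (exists_canonicalFrame_reducedJacobi hmono hconj hcompact α) h

/-- Both Green bundles are Lagrangian, hence of half the dimension, so trivial intersection already
forces them to span. -/
theorem isCompl_green (hmono : S.Monotone) (hconj : S.NoConjugatePoints)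
    (hcompact : IsCompact S.level) {α : S.level} (h : S.greenPlus α ⊓ S.greenMinus α = ⊥) :
    IsCompl (S.greenPlus α) (S.greenMinus α) := by
  have := finiteDimensional_reducedBundle α
  have h1 := isMonotoneFamily_reducedJacobi hmono hconj hcompact α
  have h2 := h1.limit_atTop.2.1.two_mul_finrank h1.symplectic
  have h3 := h1.limit_atBot.2.1.two_mul_finrank h1.symplectic
  refine ⟨disjoint_iff.2 h, codisjoint_iff.2 (Submodule.eq_top_of_finrank_eq ?_)⟩
  have h4 := Submodule.finrank_sup_add_finrank_inf_eq (S.greenPlus α) (S.greenMinus α)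
  rw [h, finrank_bot, add_zero] at h4
  change 2 * finrank ℝ (S.greenPlus α) = _ at h2
  change 2 * finrank ℝ (S.greenMinus α) = _ at h3
  omega

/-- If no nonzero vector has a bounded horizontal part, then the flow is exponentially contracting
on the reduced Green bundles. -/
theorem exists_exponential_bound (hmono : S.Monotone) (hconj : S.NoConjugatePoints)
    (hcompact : IsCompact S.level)
    (h : ¬ ∃ (α : S.level) (w : S.ReducedBundle α), w ≠ 0 ∧
        ∃ C : ℝ, ∀ t : ℝ, S.norm (S.levelFlow t α) (S.horizontal _ (S.reducedFlow t α w)) ≤ C) :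
    ∃ c₁ > 0, ∃ c₂ > 0, ∀ (α : S.level) (t : ℝ), 0 ≤ t →
        (∀ w ∈ S.greenPlus α,
          S.norm (S.levelFlow t α) (S.reducedFlow t α w) ≤
            c₁ * S.norm α w * Real.exp (-c₂ * t)) ∧
        (∀ w ∈ S.greenMinus α,
          S.norm (S.levelFlow (-t) α) (S.reducedFlow (-t) α w) ≤
            c₁ * S.norm α w * Real.exp (-c₂ * t)) := by
  obtain ⟨C, hG⟩ := exists_isGreenSystem hmono hconj hcompact
  -- Only orbits with bounded full norm enter the compactness argument; their horizontal parts are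
  -- bounded a fortiori.
  have h0 : ∀ p : S.Lift, (∃ K, ∀ t, (liftFlow t p).size ≤ K) → p.size = 0 := by
    rintro p ⟨K, hK⟩
    by_contra hne
    refine h ⟨⟨p.base, p.base_mem⟩, p.cls, fun h0 => hne ?_, K, fun t =>
      (norm_horizontal_le _ _).trans (hK t)⟩
    rw [Lift.size, h0]
    exact canonicalNorm_zero
  obtain ⟨a₁, ha₁, a₂, ha₂, ha⟩ := hG.exponential_decay h0
  obtain ⟨b₁, hb₁, b₂, hb₂, hb⟩ := hG.reverse.exponential_decay fun p ⟨K, hK⟩ =>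
    h0 p ⟨K, fun t => by simpa using hK (-t)⟩
  refine ⟨max a₁ b₁, lt_max_of_lt_left ha₁, min a₂ b₂, lt_min ha₂ hb₂, fun α t ht => ?_⟩
  have hle : ∀ c₁ c₂ N : ℝ, c₁ ≤ max a₁ b₁ → min a₂ b₂ ≤ c₂ → 0 ≤ N → 0 ≤ c₁ →
      c₁ * N * Real.exp (-c₂ * t) ≤ max a₁ b₁ * N * Real.exp (-min a₂ b₂ * t) := by
    intro c₁ c₂ N h1 h2 hN hc
    have h3 : -c₂ * t ≤ -min a₂ b₂ * t := mul_le_mul_of_nonneg_right (neg_le_neg h2) ht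
    gcongr
  constructor
  · intro w hw
    obtain ⟨u, hu, rfl⟩ := Lift.exists_cls_eq α w
    exact (ha ⟨((α : M), u), α.2, hu⟩ hw t ht).trans
      (hle _ _ _ (le_max_left _ _) (min_le_left _ _) (canonicalNorm_nonneg _) ha₁.le)
  · intro w hw
    obtain ⟨u, hu, rfl⟩ := Lift.exists_cls_eq α w
    exact (hb ⟨((α : M), u), α.2, hu⟩ hw t ht).trans
      (hle _ _ _ (le_max_right _ _) (min_le_right _ _) (canonicalNorm_nonneg _) hb₁.le)

theorem reducedFlow_neg_reducedFlow (t : ℝ) (α : S.level) (w : S.ReducedBundle α) :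
    S.norm _ (S.reducedFlow (-t) (S.levelFlow t α) (S.reducedFlow t α w)) = S.norm α w := by
  obtain ⟨u, hu, rfl⟩ := Lift.exists_cls_eq α w
  have h1 := congrArg Lift.size (liftFlow_liftFlow (-t) t ⟨((α : M), u), α.2, hu⟩)
  rw [neg_add_cancel, liftFlow_zero] at h1
  exact h1

end HamiltonianLevel

/-! ### The four equivalent conditions -/

theorem mainTheorem5 {E : Type*} [NormedAddCommGroup E] [NormedSpace ℝ E] [FiniteDimensional ℝ E]
    {M : Type*} [TopologicalSpace M] [T2Space M] [ChartedSpace E M] [IsManifold 𝓘(ℝ, E) ∞ M]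
    (S : HamiltonianLevel E M) (hmono : S.Monotone) (hconj : S.NoConjugatePoints)
    (hcompact : IsCompact S.level) :
    -- the canonical frames and the limits that enter the four conditions exist
    (∀ α : S.level, ∃ b : ℝ → Module.Basis (Fin (S.n - 1) ⊕ Fin (S.n - 1)) ℝ (S.ReducedBundle α),
      IsCanonicalFrame (S.reducedForm α) (S.reducedJacobi α) b) ∧
    (∀ α : S.level, SubspaceTendsto (S.reducedJacobi α) Filter.atTop (S.greenPlus α) ∧
      SubspaceTendsto (S.reducedJacobi α) Filter.atBot (S.greenMinus α)) ∧
    -- the four equivalent conditions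
    List.TFAE [
      ∀ α : S.level, S.greenPlus α ⊓ S.greenMinus α = ⊥,
      ∀ α : S.level, IsCompl (S.greenPlus α) (S.greenMinus α),
      ¬ ∃ (α : S.level) (w : S.ReducedBundle α), w ≠ 0 ∧
        ∃ C : ℝ, ∀ t : ℝ, S.norm (S.levelFlow t α) (S.horizontal _ (S.reducedFlow t α w)) ≤ C,
      ∃ c₁ > 0, ∃ c₂ > 0, ∀ (α : S.level) (t : ℝ), 0 ≤ t →
        (∀ w ∈ S.greenPlus α,
          S.norm (S.levelFlow t α) (S.reducedFlow t α w) ≤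
            c₁ * S.norm α w * Real.exp (-c₂ * t)) ∧
        (∀ w ∈ S.greenMinus α,
          S.norm (S.levelFlow (-t) α) (S.reducedFlow (-t) α w) ≤
            c₁ * S.norm α w * Real.exp (-c₂ * t))] := by
  open HamiltonianLevel in
  refine ⟨exists_canonicalFrame_reducedJacobi hmono hconj hcompact, fun α =>
    ⟨subspaceTendsto_greenPlus hmono hconj hcompact α,
      subspaceTendsto_greenMinus hmono hconj hcompact α⟩, ?_⟩
  tfae_have 1 → 2 := fun h α => isCompl_green hmono hconj hcompact (h α)
  tfae_have 2 → 1 := fun h α => (h α).inf_eq_bot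
  -- Boundedness of the horizontal part in the future and in the past puts the vector into both
  -- Green bundles.
  tfae_have 1 → 3 := by
    rintro h ⟨α, w, hw, C, hC⟩
    refine hw ((Submodule.mem_bot ℝ).1 ?_)
    rw [← h α]
    exact ⟨mem_greenPlus hmono hconj hcompact fun t _ => hC t,
      mem_greenMinus hmono hconj hcompact fun t _ => hC t⟩
  tfae_have 3 → 4 := exists_exponential_bound hmono hconj hcompact
  -- A common vector decays forward under the flow, and by invariance its image lies in the other
  -- bundle and decays on the way back. The round trip is the identity, so the norm is at most `c₁²
  -- e^{-2 c₂ t}` times itself for every `t ≥ 0`.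
  tfae_have 4 → 1 := by
    rintro ⟨c₁, hc₁, c₂, hc₂, h⟩ α
    rw [Submodule.eq_bot_iff]
    rintro w ⟨hp, hm⟩
    refine eq_zero_of_norm_eq_zero hmono hconj hcompact (le_antisymm ?_ (canonicalNorm_nonneg w))
    have h1 : ∀ t, 0 ≤ t → S.norm α w ≤ c₁ * (c₁ * S.norm α w * Real.exp (-c₂ * t))
        * Real.exp (-c₂ * t) := by
      intro t ht
      have h2 := (h (S.levelFlow t α) t ht).2 _ (reducedFlow_mem_greenMinus hmono hconj hcompact t hm)
      rw [reducedFlow_neg_reducedFlow] at h2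
      refine h2.trans ?_
      have h3 := (h α t ht).1 w hp
      gcongr
    have h2 : Filter.Tendsto (fun t => Real.exp (-c₂ * t)) Filter.atTop (𝓝 0) :=
      Real.tendsto_exp_atBot.comp
        (Filter.tendsto_id.const_mul_atTop_of_neg (neg_neg_of_pos hc₂))
    have h3 := ((h2.const_mul (c₁ * S.norm α w)).const_mul c₁).mul h2
    rw [mul_zero] at h3
    refine ge_of_tendsto h3 ?_
    filter_upwards [Filter.eventually_ge_atTop 0] with t ht using h1 t ht
  tfae_finish
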